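/- Theorem. Let $\{U,B,S\}$-\textsc{Bounded SAS$^+$ Planning} be the following parameterized problem. An instance is a pair $(\Pi,k)$ of a SAS$^+$ instance $\Pi$ satisfying the restrictions U, B and S below and a positive integer $k$; the parameter is $k$; the question is whether $\Pi$ has a plan of length at most $k$. This problem is $\mathrm{W}[1]$-hard, i.e. every parameterized problem in $\mathrm{W}[1]$ reduces to it by a parameterized reduction. It remains $\mathrm{W}[1]$-hard when restricted to the instances $(\Pi,k)$ in which every action has at most one precondition and at most one postcondition. Definitions. A SAS$^+$ instance is a tuple $\Pi=\langle V,D,A,I,G\rangle$ with a finite set $V$ of variables, a finite domain $D$, a finite set $A$ of actions, an initial state $I:V\to D$ and a goal $G:V\to D\cup\{\mathbf u\}$, where $\mathbf u\notin D$ means "undefined". Each $a\in A$ has a precondition $\mathrm{pre}(a)$ and an effect (postcondition) $\mathrm{eff}(a)$, both maps $V\to D\cup\{\mathbf u\}$; the number of preconditions (postconditions) of $a$ is the number of $v\in V$ with $\mathrm{pre}(a)[v]\ne\mathbf u$ (resp. $\mathrm{eff}(a)[v]\neq\mathbf u$). The action $a$ is valid in a state $s:V\to D$ if $\mathrm{pre}(a)[v]\in\{s[v],\mathbf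 u\}$ for all $v$, and its result in $s$ is the state $t$ with $t[v]=\mathrm{eff}(a)[v]$ if $\mathrm{eff}(a)[v]\ne\mathbf u$ and $t[v]=s[v]$ otherwise. A plan for $\Pi$ is a finite sequence of actions of $A$ that can be applied one after the other, each valid in the current state, starting from $I$ and ending in a state $s$ with $G[v]\in\{s[v],\mathbf u\}$ for all $v$. The restrictions are: (U) for every $a\in A$ there is exactly one $v\in V$ with $\mathrm{eff}(a)[v]\ne\mathbf u$; (B) $|D|=2$; (S) for all $a,b\in A$ and $v\in V$, if $\mathrm{pre}(a)[v]\ne\mathbf u$, $\mathrm{pre}(b)[v]\neq\mathbf u$ and $\mathrm{eff}(a)[v]=\mathrm{eff}(b)[v]=\mathbf u$, then $\mathrm{pre}(a)[v]=\mathrm{pre}(b)[v]$. A parameterized reduction from $L$ to $L'$ is a map $R$ from instances of $L$ to instances of $L'$ such that (1) $x$ is a Yes-instance of $L$ if and only if $R(x)$ is a Yes-instance of $L'$; (2) there is a computable $g$ such that the parameter of $R(x)$ is at most $g(k)$, where $k$ is the parameter of $x$; (3) there are a computable function $f$ and a constant $c$ such that $R$ can be computed by a Turing machine in time $O(f(k)\cdot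 n^{c})$, where $n$ is the size of $x$. The class $\mathrm{W}[1]$ consists of the parameterized problems that, for some constant $q$, have a parameterized reduction to \textsc{Weighted $q$-CNF Satisfiability} (given a CNF formula whose clauses have at most $q$ literals and a number $k$, the parameter, does the formula have a satisfying assignment that makes exactly $k$ variables true?). -/

import Mathlib

/-! ### Self-delimiting binary encodings -/

/-- `e` is a prefix-free code: a code word can be read off the front of a bit string in at most
one way. -/
def IsPrefixCode {α : Type} (e : α → List Bool) : Prop :=
  ∀ a b s t, e a ++ s = e b ++ t → a = b ∧ s = t

/-- Unary code of a natural number: `n` ones followed by a zero. -/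
def encNat (n : ℕ) : List Bool := List.replicate n true ++ [false]

/-- Code of an element of `{0, …, n - 1}`: the unary code of its value. -/
def encFin {n : ℕ} (i : Fin n) : List Bool := encNat i.val

/-- Code of an optional value: `0` for `none`, and `1` followed by the code for `some a`. -/
def encOption {α : Type} (e : α → List Bool) : Option α → List Bool
  | none => [false]
  | some a => true :: e a

/-- Code of a finite list: each entry is announced by a `1`, and a `0` marks the end. -/
def encList {α : Type} (e : α → List Bool) : List α → List Bool
  | [] => [false]
  | a :: l => true :: (e a ++ encList e l)

/-- Code of a vector of known length: the codes of its entries, one after the other. -/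
def encVec {n : ℕ} {α : Type} (e : α → List Bool) (f : Fin n → α) : List Bool :=
  (List.ofFn f).flatMap e

theorem IsPrefixCode.injective {α : Type} {e : α → List Bool} (h : IsPrefixCode e) :
    Function.Injective e := fun a b hab => (h a b [] [] (by rw [hab])).1

theorem isPrefixCode_encNat : IsPrefixCode encNat := by
  intro a
  induction a with
  | zero =>
    intro b s t h
    cases b with
    | zero => simpa [encNat] using h
    | succ b => simp [encNat, List.replicate_succ] at h
  | succ a ih =>
    intro b s t h
    cases b with
    | zero => simp [encNat, List.replicate_succ] at h
    | succ b =>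
      have h' : encNat a ++ s = encNat b ++ t := by
        simpa [encNat, List.replicate_succ] using h
      obtain ⟨h1, h2⟩ := ih b s t h'
      exact ⟨by rw [h1], h2⟩

theorem isPrefixCode_encFin {n : ℕ} : IsPrefixCode (encFin : Fin n → List Bool) := by
  intro a b s t h
  obtain ⟨h1, h2⟩ := isPrefixCode_encNat _ _ _ _ h
  exact ⟨Fin.ext h1, h2⟩

theorem isPrefixCode_encOption {α : Type} {e : α → List Bool} (he : IsPrefixCode e) :
    IsPrefixCode (encOption e) := by
  intro a b s t h
  cases a <;> cases b <;> simp [encOption] at h ⊢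
  · exact h
  · exact he _ _ _ _ h

theorem isPrefixCode_encList {α : Type} {e : α → List Bool} (he : IsPrefixCode e) :
    IsPrefixCode (encList e) := by
  intro a
  induction a with
  | nil =>
    intro b s t h
    cases b <;> simp [encList] at h ⊢
    exact h
  | cons x a ih =>
    intro b s t h
    cases b with
    | nil => simp [encList] at h
    | cons y b =>
      simp only [encList, List.cons_append, List.append_assoc, List.cons.injEq, true_and] at h
      obtain ⟨rfl, h1⟩ := he _ _ _ _ h
      obtain ⟨rfl, h2⟩ := ih _ _ _ h1
      exact ⟨rfl, h2⟩

theorem isPrefixCode_encVec {n : ℕ} {α : Type} {e : α → List Bool} (he : IsPrefixCode e) :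
    IsPrefixCode (encVec e : (Fin n → α) → List Bool) := by
  induction n with
  | zero =>
    intro a b s t h
    exact ⟨Subsingleton.elim _ _, by simpa [encVec] using h⟩
  | succ n ih =>
    intro a b s t h
    simp only [encVec, List.ofFn_succ, List.flatMap_cons, List.append_assoc] at h
    obtain ⟨h0, h1⟩ := he _ _ _ _ h
    obtain ⟨h2, h3⟩ := ih (fun i => a i.succ) (fun i => b i.succ) _ _ h1
    refine ⟨funext fun i => ?_, h3⟩
    refine Fin.cases h0 (fun j => ?_) i
    exact congrFun h2 j

/-! ### Parameterized problems, parameterized reductions -/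

/-- A parameterized decision problem: its instances are pairs `(x, k)` of a main part `x` and a
parameter `k : ℕ`. Main parts are presented to machines as bit strings. -/
structure ParamProblem where
  /-- the type of main parts -/
  Main : Type
  /-- the encoding of main parts by bit strings -/
  enc : Main → List Bool
  /-- different main parts have different encodings -/
  enc_injective : Function.Injective enc
  /-- which pairs are instances -/
  IsInst : Main → ℕ → Prop
  /-- which pairs are Yes-instances (only relevant for instances) -/
  IsYes : Main → ℕ → Prop

namespace ParamProblem

/-- The instances of a parameterized problem. -/
def Inst (L : ParamProblem) : Type := {p : L.Main × ℕ // L.IsInst p.1 p.2}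

/-- The parameter of an instance. -/
def param {L : ParamProblem} (x : L.Inst) : ℕ := x.1.2

/-- `x` is a Yes-instance. -/
def Yes {L : ParamProblem} (x : L.Inst) : Prop := L.IsYes x.1.1 x.1.2

/-- The bit string that represents the instance `(x, k)`: the parameter, then the main part. -/
def code {L : ParamProblem} (x : L.Inst) : List Bool := encNat x.1.2 ++ L.enc x.1.1

end ParamProblem

/-- `R` can be computed in fpt time: some Turing machine (with finitely many stacks) computes the
code of `R x` from the code of `x` within `f k * (n + 1) ^ c` steps, where `k` is the parameter of
`x`, `n` is the size of (the code of) `x`, `f` is a computable function and `c` is a constant. -/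
def ComputableInFPTTime {L L' : ParamProblem} (R : L.Inst → L'.Inst) : Prop :=
  ∃ (f : ℕ → ℕ) (c : ℕ) (M : Turing.TM2ComputableAux Bool Bool), Computable f ∧
    ∀ x : L.Inst, Nonempty (Turing.TM2OutputsInTime M.tm
      ((ParamProblem.code x).map M.inputAlphabet.symm)
      (some ((ParamProblem.code (R x)).map M.outputAlphabet.symm))
      (f (ParamProblem.param x) * ((ParamProblem.code x).length + 1) ^ c))

/-- `L` reduces to `L'` by a parameterized reduction. -/
def ParamReduces (L L' : ParamProblem) : Prop :=
  ∃ R : L.Inst → L'.Inst,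
    (∀ x, ParamProblem.Yes x ↔ ParamProblem.Yes (R x)) ∧
    (∃ g : ℕ → ℕ, Computable g ∧ ∀ x, ParamProblem.param (R x) ≤ g (ParamProblem.param x)) ∧
    ComputableInFPTTime R

/-! ### The class W[1] -/

/-- A propositional formula in conjunctive normal form over the variables `0, …, numVars - 1`.
A clause is a list of literals; `(i, true)` is the literal `xᵢ` and `(i, false)` is `¬ xᵢ`. -/
structure CNFFormula where
  numVars : ℕ
  clauses : List (List (Fin numVars × Bool))

namespace CNFFormula

/-- The assignment `τ` satisfies `φ`: every clause contains a literal that is true under `τ`. -/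
def SatisfiedBy (φ : CNFFormula) (τ : Fin φ.numVars → Bool) : Prop :=
  ∀ C ∈ φ.clauses, ∃ l ∈ C, τ l.1 = l.2

/-- The weight of an assignment: the number of variables that it makes true. -/
def weight {n : ℕ} (τ : Fin n → Bool) : ℕ := (Finset.univ.filter fun i => τ i = true).card

/-- Code of a literal: the variable, then the sign bit. -/
def encLiteral {n : ℕ} (l : Fin n × Bool) : List Bool := encFin l.1 ++ [l.2]

/-- Code of a formula: the number of variables, then the list of clauses. -/
def enc (φ : CNFFormula) : List Bool :=
  encNat φ.numVars ++ encList (encList encLiteral) φ.clauses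

theorem isPrefixCode_encLiteral {n : ℕ} :
    IsPrefixCode (encLiteral : Fin n × Bool → List Bool) := by
  rintro ⟨a, x⟩ ⟨b, y⟩ s t h
  simp only [encLiteral, List.append_assoc] at h
  obtain ⟨rfl, h1⟩ := isPrefixCode_encFin _ _ _ _ h
  simpa using h1

theorem enc_injective : Function.Injective enc := by
  rintro ⟨n, C⟩ ⟨m, D⟩ h
  obtain ⟨h1, h2⟩ := isPrefixCode_encNat _ _ _ _ h
  dsimp only at h1
  subst h1
  have := (isPrefixCode_encList (isPrefixCode_encList isPrefixCode_encLiteral)).injective h2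
  dsimp only at this
  rw [this]

end CNFFormula

/-- WEIGHTED `q`-CNF SATISFIABILITY. Instance: a CNF formula all of whose clauses have at most `q`
literals, and `k : ℕ`. Parameter: `k`. Question: does the formula have a satisfying assignment of
weight exactly `k`? -/
def weightedCNFSat (q : ℕ) : ParamProblem where
  Main := CNFFormula
  enc := CNFFormula.enc
  enc_injective := CNFFormula.enc_injective
  IsInst φ _ := ∀ C ∈ φ.clauses, C.length ≤ q
  IsYes φ k := ∃ τ, φ.SatisfiedBy τ ∧ CNFFormula.weight τ = k

/-- `L` belongs to W[1], the closure under parameterized reductions of the weighted satisfiability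
problems for CNF formulas of bounded clause length. -/
def InW1 (L : ParamProblem) : Prop := ∃ q : ℕ, ParamReduces L (weightedCNFSat q)

/-- `L` is W[1]-hard: every problem in W[1] reduces to it. -/
def IsW1Hard (L : ParamProblem) : Prop := ∀ L' : ParamProblem, InW1 L' → ParamReduces L' L

/-! ### SAS⁺ planning -/

/-- Total states over `n` variables and a domain of `d` values. -/
abbrev TotalState (n d : ℕ) : Type := Fin n → Fin d

/-- Partial states; `none` is the undefined value. -/
abbrev PartialState (n d : ℕ) : Type := Fin n → Option (Fin d)

/-- An action: a precondition and an effect. -/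
structure SASAction (n d : ℕ) where
  pre : PartialState n d
  eff : PartialState n d

namespace SASAction

variable {n d : ℕ}

/-- `a` is valid in the state `s`. -/
def Valid (a : SASAction n d) (s : TotalState n d) : Prop :=
  ∀ v, a.pre v = some (s v) ∨ a.pre v = none

/-- The result of `a` in the state `s`. -/
def result (a : SASAction n d) (s : TotalState n d) : TotalState n d :=
  fun v => (a.eff v).getD (s v)

/-- The number of preconditions of `a`: variables with a defined value in the precondition. -/
def numPre (a : SASAction n d) : ℕ := (Finset.univ.filter fun v => a.pre v ≠ none).card

/-- The number of postconditions of `a`: variables with a defined value in the effect. -/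
def numEff (a : SASAction n d) : ℕ := (Finset.univ.filter fun v => a.eff v ≠ none).card

/-- Code of an action: its precondition, then its effect. -/
def enc (a : SASAction n d) : List Bool :=
  encVec (encOption encFin) a.pre ++ encVec (encOption encFin) a.eff

theorem isPrefixCode_enc : IsPrefixCode (enc : SASAction n d → List Bool) := by
  rintro ⟨p, e⟩ ⟨p', e'⟩ s t h
  simp only [enc, List.append_assoc] at h
  have hv := isPrefixCode_encVec (n := n) (isPrefixCode_encOption (isPrefixCode_encFin (n := d)))
  obtain ⟨rfl, h1⟩ := hv _ _ _ _ h
  obtain ⟨rfl, h2⟩ := hv _ _ _ _ h1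
  exact ⟨rfl, h2⟩

end SASAction

/-- A SAS⁺ instance: finitely many variables, a finite domain, finitely many actions (given by a
list), a total initial state and a partial goal state. -/
structure SASInstance where
  numVars : ℕ
  domSize : ℕ
  acts : List (SASAction numVars domSize)
  init : TotalState numVars domSize
  goal : PartialState numVars domSize

namespace SASInstance

/-- `IsPlanFrom acts s ω t`: the sequence `ω` of actions from `acts` is a plan from `s` to `t`. -/
def IsPlanFrom {n d : ℕ} (acts : List (SASAction n d)) :
    TotalState n d → List (SASAction n d) → TotalState n d → Prop
  | s, [], t => s = t
  | s, a :: ω, t => a ∈ acts ∧ a.Valid s ∧ IsPlanFrom acts (a.result s) ω t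

/-- `s` is a goal state. -/
def IsGoalState (P : SASInstance) (s : TotalState P.numVars P.domSize) : Prop :=
  ∀ v, P.goal v = some (s v) ∨ P.goal v = none

/-- `ω` is a plan for `P`: it leads from the initial state to some goal state. -/
def IsPlan (P : SASInstance) (ω : List (SASAction P.numVars P.domSize)) : Prop :=
  ∃ s, P.IsGoalState s ∧ IsPlanFrom P.acts P.init ω s

/-- Restriction U: every action changes exactly one variable. -/
def RestrictionU (P : SASInstance) : Prop := ∀ a ∈ P.acts, ∃! v, a.eff v ≠ none

/-- Restriction B: the domain has exactly two values. -/
def RestrictionB (P : SASInstance) : Prop := P.domSize = 2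

/-- Restriction S: any two actions with a precondition, but no effect, on the same variable have
the same precondition on it. -/
def RestrictionS (P : SASInstance) : Prop :=
  ∀ a ∈ P.acts, ∀ b ∈ P.acts, ∀ v, a.pre v ≠ none → b.pre v ≠ none →
    a.eff v = none → b.eff v = none → a.pre v = b.pre v

/-- Code of an instance: the numbers of variables and of values, the initial state, the goal, and
the list of actions. -/
def enc (P : SASInstance) : List Bool :=
  encNat P.numVars ++ (encNat P.domSize ++ (encVec encFin P.init ++
    (encVec (encOption encFin) P.goal ++ encList SASAction.enc P.acts)))

theorem enc_injective : Function.Injective enc := by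
  rintro ⟨n, d, A, i, g⟩ ⟨n', d', A', i', g'⟩ h
  obtain ⟨h1, h⟩ := isPrefixCode_encNat _ _ _ _ h
  dsimp only at h1
  subst h1
  obtain ⟨h2, h⟩ := isPrefixCode_encNat _ _ _ _ h
  dsimp only at h2
  subst h2
  obtain ⟨h3, h⟩ := isPrefixCode_encVec isPrefixCode_encFin _ _ _ _ h
  obtain ⟨h4, h⟩ := isPrefixCode_encVec (isPrefixCode_encOption isPrefixCode_encFin) _ _ _ _ h
  have h5 := (isPrefixCode_encList SASAction.isPrefixCode_enc).injective h
  dsimp only at h3 h4 h5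
  subst h3 h4 h5
  rfl

end SASInstance

/-- BOUNDED SAS⁺ PLANNING for the SAS⁺ instances that satisfy `R`. Instance: such a SAS⁺ instance
and a positive integer `k`. Parameter: `k`. Question: is there a plan of length at most `k`? -/
def boundedSASPlanning (R : SASInstance → Prop) : ParamProblem where
  Main := SASInstance
  enc := SASInstance.enc
  enc_injective := SASInstance.enc_injective
  IsInst P k := R P ∧ 0 < k
  IsYes P k := ∃ ω, P.IsPlan ω ∧ ω.length ≤ k

/-! By the definition of W[1] it suffices to reduce weighted `q`-CNF satisfiability, for each fixed
`q`, to planning in polynomial time, with a new parameter bounded in terms of the old one: composing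
with a parameterized reduction stays within fpt time (`ParamReduces.trans_polyOut`).

An assignment of weight `k` to `n` variables amounts to a chain `0 = a₀ < a₁ < ⋯ < aₖ₊₁ = n + 1`,
that is, to `k + 1` gaps `(i, aᵢ, aᵢ₊₁)` taken from `(k + 1)(n + 2)²` candidates. A single gap
witnesses that a literal is false: `x_v` is false iff some gap jumps over `v + 1`, and `¬ x_v` is
false iff some gap starts at `v + 1`. Hence the `(q + 2)`-tuples of chosen gaps show whether the
gaps form a chain and whether a clause is violated. The constraints are the `(k + 1) ^ (q + 2)`
vectors of indices; each asks for a good tuple of chosen gaps with these indices. If at most `k + 1`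
gaps are chosen, the constraints force exactly one gap per index, so every tuple of chosen gaps is
good (`WeightedSat.exists_assignment`; conversely `WeightedSat.exists_gaps`).

It remains to express "all elements of some good tuple are chosen" by actions with one precondition
each, always of value `1`, so that S is automatic. Each tuple has a row of variables. The row is
switched on one variable after the other, starting only if the tuple is good, and its last variable
permits switching on the constraint. The goal wants the row off again, and position `j` can be
switched off only while element `j` is on. The cleaning up thus performs the conjunction. Every
constraint costs at least `2(q + 2) + 1` different effects, so a tight length bound leaves at most
`k + 1` actions for choosing elements (`TupleSystem.exists_plan`, `TupleSystem.exists_elements`).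

For the running time, a small language of stack programs is compiled to Turing machines, and the
functions computable in polynomial time with numbers in unary are shown to be closed under bounded
recursion (`PolyTime.bounded_recursion`). A one-pass automaton (`Scan`) reads the formula and tests
whether a tuple falsifies a clause. -/

/-! ### Structured programs over stacks of bits -/

/-- Programs that operate on stacks of bits, indexed by natural numbers. -/
inductive Prog
  | push (r : ℕ) (b : Bool)
  | pop (r : ℕ)
  | move (r r' : ℕ)
  | seq (P Q : Prog)
  | ite (r : ℕ) (P Q : Prog)
  | whl (r : ℕ) (P : Prog)

/-- The contents of the stacks. -/
abbrev Store : Type := ℕ → List Bool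

namespace Prog

/-- Move the top of stack `r`, if there is one, to stack `r'`. -/
def moveStore (r r' : ℕ) (s : Store) : Store :=
  match s r with
  | [] => s
  | b :: l => Function.update (Function.update s r l) r' (b :: Function.update s r l r')

/-- `Exec P s t s'`: started in `s`, the program `P` terminates in `s'` after `t` steps.
`ite r P Q` branches on whether the top of stack `r` is `true`; `whl r P` loops while stack `r` is
nonempty. -/
inductive Exec : Prog → Store → ℕ → Store → Prop
  | push (r b s) : Exec (push r b) s 1 (Function.update s r (b :: s r))
  | pop (r s) : Exec (pop r) s 1 (Function.update s r (s r).tail)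
  | move (r r' s) : Exec (move r r') s 1 (moveStore r r' s)
  | seq {P Q s s' s'' t t'} : Exec P s t s' → Exec Q s' t' s'' → Exec (seq P Q) s (t + t') s''
  | ite_true {r P Q s s' t} : (s r).head? = some true → Exec P s t s' →
      Exec (ite r P Q) s (1 + t) s'
  | ite_false {r P Q s s' t} : (s r).head? ≠ some true → Exec Q s t s' →
      Exec (ite r P Q) s (1 + t) s'
  | whl_nil {r P s} : s r = [] → Exec (whl r P) s 1 s
  | whl_cons {r P s s' s'' t t'} : s r ≠ [] → Exec P s t s' → Exec (whl r P) s' t' s'' →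
      Exec (whl r P) s (1 + t + t') s''

/-- An upper bound for the indices of the stacks that a program uses. -/
def regs : Prog → ℕ
  | push r _ => r
  | pop r => r
  | move r r' => max r r'
  | seq P Q => max P.regs Q.regs
  | ite r P Q => max r (max P.regs Q.regs)
  | whl r P => max r P.regs

/-- The labels of the compiled program. -/
@[reducible] def Lab : Prog → Type
  | push _ _ => Unit
  | pop _ => Unit
  | move _ _ => Unit
  | seq P Q => Lab P ⊕ Lab Q
  | ite _ P Q => Option (Lab P ⊕ Lab Q)
  | whl _ P => Option (Lab P)

instance finite_lab (P : Prog) : Finite P.Lab := by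
  induction P with
  | push | pop | move => exact inferInstanceAs (Finite Unit)
  | seq P Q hP hQ => exact inferInstanceAs (Finite (Lab P ⊕ Lab Q))
  | ite _ P Q hP hQ => exact inferInstanceAs (Finite (Option (Lab P ⊕ Lab Q)))
  | whl _ P hP => exact inferInstanceAs (Finite (Option (Lab P)))

/-- The label at which the compiled program starts. -/
def entry : (P : Prog) → Lab P
  | push _ _ => ()
  | pop _ => ()
  | move _ _ => ()
  | seq P _ => Sum.inl (entry P)
  | ite _ _ _ => none
  | whl _ _ => none

section Compile

open Turing

variable {K₁ : Type} {Γ₁ : K₁ → Type} {Λ σ₁ : Type} {R : ℕ}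

/-- The stack of the compiled program that represents stack `r`. -/
abbrev reg (K₁ : Type) (R r : ℕ) : K₁ ⊕ Fin (R + 1) := Sum.inr (Fin.ofNat (R + 1) r)

/-- The alphabets of a machine to which stacks of bits are added. -/
@[reducible] def Alph (Γ₁ : K₁ → Type) (R : ℕ) : K₁ ⊕ Fin (R + 1) → Type
  | .inl k => Γ₁ k
  | .inr _ => Bool

/-- The compiled program, as part of a larger machine; `emb` embeds its labels, `exit` is the
label to go to at the end. -/
def compile : (P : Prog) → (Lab P → Λ) → Λ → Lab P →
    -- The second component of the internal state buffers the bit just popped or peeked, on which a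
    -- branch or a push in the same statement depends.
    TM2.Stmt (Alph Γ₁ R) Λ (σ₁ × Option Bool)
  | push r b, _, exit, _ => .push (reg K₁ R r) (fun _ => b) (.goto fun _ => exit)
  | pop r, _, exit, _ => .pop (reg K₁ R r) (fun v _ => v) (.goto fun _ => exit)
  | move r r', _, exit, _ => .pop (reg K₁ R r) (fun v o => (v.1, o))
      (.branch (fun v => v.2.isSome)
        (.push (reg K₁ R r') (fun v => v.2.getD false) (.goto fun _ => exit))
        (.goto fun _ => exit))
  | seq P Q, emb, _, .inl l => compile P (emb ∘ .inl) (emb (.inr (entry Q))) l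
  | seq _ Q, emb, exit, .inr l => compile Q (emb ∘ .inr) exit l
  | ite r P Q, emb, _, none => .peek (reg K₁ R r) (fun v o => (v.1, o))
      (.branch (fun v => v.2 == some true)
        (.goto fun _ => emb (some (.inl (entry P)))) (.goto fun _ => emb (some (.inr (entry Q)))))
  | ite _ P _, emb, exit, some (.inl l) => compile P (emb ∘ some ∘ .inl) exit l
  | ite _ _ Q, emb, exit, some (.inr l) => compile Q (emb ∘ some ∘ .inr) exit l
  | whl r P, emb, exit, none => .peek (reg K₁ R r) (fun v o => (v.1, o))
      (.branch (fun v => v.2.isSome)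
        (.goto fun _ => emb (some (entry P))) (.goto fun _ => exit))
  | whl _ P, emb, _, some l => compile P (emb ∘ some) (emb none) l

/-- The stacks of a machine together with added stacks of bits. -/
def joinStk (S : ∀ k, List (Γ₁ k)) (s : Store) : ∀ k, List (Alph Γ₁ R k)
  | .inl k => S k
  | .inr i => s i.val

/-- Stack indices are reduced modulo `R + 1` by `reg`; the hypothesis `r ≤ R` makes this harmless.
-/
theorem joinStk_reg (S : ∀ k, List (Γ₁ k)) (s : Store) {r : ℕ} (h : r ≤ R) :
    joinStk (R := R) S s (reg K₁ R r) = s r := by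
  simp [joinStk, Nat.mod_eq_of_lt (Nat.lt_succ_of_le h)]

variable [DecidableEq K₁]

theorem update_joinStk_reg (S : ∀ k, List (Γ₁ k)) (s : Store) {r : ℕ} (h : r ≤ R)
    (x : List Bool) :
    Function.update (joinStk (R := R) S s) (reg K₁ R r) x = joinStk S (Function.update s r x) := by
  funext k
  rcases k with k | i
  · rw [Function.update_of_ne (by simp)]
    rfl
  · by_cases hi : i = Fin.ofNat (R + 1) r
    · subst hi
      simp [joinStk, Nat.mod_eq_of_lt (Nat.lt_succ_of_le h)]
    · rw [Function.update_of_ne (by simpa using hi)]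
      have : i.val ≠ r := by
        rintro rfl
        exact hi (by ext; simp)
      simp [joinStk, this]

theorem update_joinStk_inl (S : ∀ k, List (Γ₁ k)) (s : Store) (k : K₁) (x : List (Γ₁ k)) :
    Function.update (joinStk (R := R) S s) (Sum.inl k) x = joinStk (Function.update S k x) s := by
  funext k'
  rcases k' with k' | i
  · by_cases hk : k' = k
    · subst hk
      simp [joinStk]
    · rw [Function.update_of_ne (by simpa using hk)]
      simp [joinStk, hk]
  · rw [Function.update_of_ne (by simp)]
    rfl

/-- `n` steps of a partial step function. -/
def StepsIn {C : Type} (f : C → Option C) (n : ℕ) (c c' : C) : Prop :=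
  (flip bind f)^[n] (some c) = some c'

theorem StepsIn.trans {C : Type} {f : C → Option C} {n m : ℕ} {a b c : C}
    (h : StepsIn f n a b) (h' : StepsIn f m b c) : StepsIn f (n + m) a c := by
  unfold StepsIn at *
  rw [Nat.add_comm, Function.iterate_add_apply, h, h']

theorem StepsIn.single {C : Type} {f : C → Option C} {a b : C} (h : f a = some b) :
    StepsIn f 1 a b := h

theorem StepsIn.zero {C : Type} {f : C → Option C} (a : C) : StepsIn f 0 a a := rfl

theorem stepsIn_succ {C : Type} {f : C → Option C} {n : ℕ} {a b : C} :
    StepsIn f (n + 1) a b ↔ ∃ c, StepsIn f n a c ∧ f c = some b := by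
  unfold StepsIn
  rw [Function.iterate_succ_apply']
  cases (flip bind f)^[n] (some a) <;> simp [flip]

/-- Every primitive instruction and every test is compiled to one statement, hence to one machine
step, so the time of `Exec` is exact. The buffer `o` and the label `exit` have to vary in the
induction: instructions leave arbitrary bits in the buffer, and subprograms continue at different
labels. -/
theorem Exec.stepsIn (m : Λ → TM2.Stmt (Alph Γ₁ R) Λ (σ₁ × Option Bool)) {P : Prog}
    {s s' : Store} {t : ℕ} (h : Exec P s t s') (hR : P.regs ≤ R) (emb : Lab P → Λ) (exit : Λ)
    (hm : ∀ l, m (emb l) = compile P emb exit l) (v : σ₁) (o : Option Bool)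
    (S : ∀ k, List (Γ₁ k)) :
    ∃ o', StepsIn (TM2.step m) t ⟨some (emb (entry P)), (v, o), joinStk S s⟩
      ⟨some exit, (v, o'), joinStk S s'⟩ := by
  induction h generalizing exit o with
  | push r b s =>
    refine ⟨o, StepsIn.single ?_⟩
    rw [TM2.step, hm, compile, TM2.stepAux, TM2.stepAux, joinStk_reg S s (r := r) hR,
      update_joinStk_reg S s (r := r) hR]
  | pop r s =>
    refine ⟨o, StepsIn.single ?_⟩
    rw [TM2.step, hm, compile, TM2.stepAux, TM2.stepAux, joinStk_reg S s (r := r) hR,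
      update_joinStk_reg S s (r := r) hR]
  | move r r' s =>
    have h1 : r ≤ R := le_trans (le_max_left _ _) hR
    have h2 : r' ≤ R := le_trans (le_max_right _ _) hR
    refine ⟨(s r).head?, StepsIn.single ?_⟩
    rw [TM2.step, hm, compile, TM2.stepAux, joinStk_reg S s h1, update_joinStk_reg S s h1]
    cases hs : s r with
    | nil =>
      have : Function.update s r [] = s := by rw [← hs, Function.update_eq_self]
      simp [moveStore, hs, this]
    | cons b l =>
      simp only [TM2.stepAux, List.head?_cons, Option.isSome_some, cond_true, List.tail_cons,
        Option.getD_some, moveStore, hs]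
      rw [joinStk_reg S _ h2, update_joinStk_reg S _ h2]
  | @seq P Q s s' s'' t t' _ _ ih1 ih2 =>
    obtain ⟨o1, h1⟩ := ih1 (le_trans (le_max_left _ _) hR) (emb ∘ .inl) (emb (.inr (entry Q)))
      (fun l => hm (.inl l)) o
    obtain ⟨o2, h2⟩ := ih2 (le_trans (le_max_right _ _) hR) (emb ∘ .inr) exit
      (fun l => hm (.inr l)) o1
    exact ⟨o2, h1.trans h2⟩
  | @ite_true r P Q s s' t hs _ ih =>
    have h0 : r ≤ R := le_trans (le_max_left _ _) hR
    have h1 : P.regs ≤ R := le_trans (le_trans (le_max_left _ _) (le_max_right _ _)) hR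
    obtain ⟨o1, h1⟩ := ih h1 (emb ∘ some ∘ .inl) exit (fun l => hm (some (.inl l))) (some true)
    refine ⟨o1, StepsIn.trans (StepsIn.single ?_) h1⟩
    rw [entry, TM2.step, hm, compile, TM2.stepAux, joinStk_reg S s h0, hs]
    simp
  | @ite_false r P Q s s' t hs _ ih =>
    have h0 : r ≤ R := le_trans (le_max_left _ _) hR
    have h1 : Q.regs ≤ R := le_trans (le_trans (le_max_right _ _) (le_max_right _ _)) hR
    obtain ⟨o1, h1⟩ := ih h1 (emb ∘ some ∘ .inr) exit (fun l => hm (some (.inr l))) (s r).head?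
    refine ⟨o1, StepsIn.trans (StepsIn.single ?_) h1⟩
    rw [entry, TM2.step, hm, compile, TM2.stepAux, joinStk_reg S s h0]
    have : ((s r).head? == some true) = false := by simpa using hs
    simp [this]
  | @whl_nil r P s hs =>
    have h0 : r ≤ R := le_trans (le_max_left _ _) hR
    refine ⟨none, StepsIn.single ?_⟩
    rw [entry, TM2.step, hm, compile, TM2.stepAux, joinStk_reg S s h0, hs]
    simp
  | @whl_cons r P s s' s'' t t' hs _ _ ih1 ih2 =>
    have h0 : r ≤ R := le_trans (le_max_left _ _) hR
    have h1 : P.regs ≤ R := le_trans (le_max_right _ _) hR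
    obtain ⟨o1, h1⟩ := ih1 h1 (emb ∘ some) (emb none) (fun l => hm (some l)) (s r).head?
    obtain ⟨o2, h2⟩ := ih2 hR emb exit hm o1
    refine ⟨o2, StepsIn.trans (StepsIn.trans (StepsIn.single ?_) h1) h2⟩
    rw [entry, TM2.step, hm, compile, TM2.stepAux, joinStk_reg S s h0]
    have : (s r).head?.isSome = true := by
      cases h : s r with
      | nil => exact absurd h hs
      | cons => rfl
    simp [this]

end Compile

end Prog

/-! ### Running a program on the output of a machine -/

namespace Turing

open Prog

section Lift

variable {K₁ : Type} {Γ₁ : K₁ → Type} {Λ₁ Λ σ₁ : Type} {R : ℕ}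

/-- Statements of a machine as statements of a larger machine; it jumps to `xfer` where the
original machine halts. -/
def liftStmt (emb : Λ₁ → Λ) (xfer : Λ) :
    TM2.Stmt Γ₁ Λ₁ σ₁ → TM2.Stmt (Alph Γ₁ R) Λ (σ₁ × Option Bool)
  | .push k f q => .push (Sum.inl k) (fun v => f v.1) (liftStmt emb xfer q)
  | .peek k f q => .peek (Sum.inl k) (fun v o => (f v.1 o, v.2)) (liftStmt emb xfer q)
  | .pop k f q => .pop (Sum.inl k) (fun v o => (f v.1 o, v.2)) (liftStmt emb xfer q)
  | .load f q => .load (fun v => (f v.1, v.2)) (liftStmt emb xfer q)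
  | .branch f q q' => .branch (fun v => f v.1) (liftStmt emb xfer q) (liftStmt emb xfer q')
  | .goto f => .goto fun v => emb (f v.1)
  | .halt => .goto fun _ => xfer

/-- Configurations of a machine as configurations of a larger machine. -/
def liftCfg (emb : Λ₁ → Λ) (xfer : Λ) (c : TM2.Cfg Γ₁ Λ₁ σ₁) :
    TM2.Cfg (Alph Γ₁ R) Λ (σ₁ × Option Bool) :=
  ⟨some (c.l.elim xfer emb), (c.var, none), joinStk c.stk fun _ => []⟩

variable [DecidableEq K₁]

/-- Lifted statements touch neither the buffer nor the added stacks, so these stay empty throughout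
the simulation. -/
theorem stepAux_liftStmt (emb : Λ₁ → Λ) (xfer : Λ) (q : TM2.Stmt Γ₁ Λ₁ σ₁) (v : σ₁)
    (S : ∀ k, List (Γ₁ k)) :
    TM2.stepAux (liftStmt (R := R) emb xfer q) (v, none) (joinStk S fun _ => []) =
      liftCfg emb xfer (TM2.stepAux q v S) := by
  induction q generalizing v S with
  | push k f q ih =>
    simp only [liftStmt, TM2.stepAux]
    rw [update_joinStk_inl, ih]
    rfl
  | peek k f q ih =>
    simp only [liftStmt, TM2.stepAux]
    rw [ih]
    rfl
  | pop k f q ih =>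
    simp only [liftStmt, TM2.stepAux]
    rw [update_joinStk_inl, ih]
    rfl
  | load f q ih =>
    simp only [liftStmt, TM2.stepAux]
    rw [ih]
  | branch f q q' ih ih' =>
    simp only [liftStmt, TM2.stepAux]
    rw [ih, ih']
    cases f v <;> rfl
  | goto f => rfl
  | halt => rfl

theorem stepsIn_liftCfg {m₁ : Λ₁ → TM2.Stmt Γ₁ Λ₁ σ₁}
    {m : Λ → TM2.Stmt (Alph Γ₁ R) Λ (σ₁ × Option Bool)} {emb : Λ₁ → Λ} {xfer : Λ}
    (hm : ∀ l, m (emb l) = liftStmt emb xfer (m₁ l)) {n : ℕ} {c c' : TM2.Cfg Γ₁ Λ₁ σ₁}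
    (h : StepsIn (TM2.step m₁) n c c') :
    StepsIn (TM2.step m) n (liftCfg emb xfer c) (liftCfg emb xfer c') := by
  induction n generalizing c' with
  | zero =>
    cases h
    exact StepsIn.zero _
  | succ n ih =>
    obtain ⟨d, h1, h2⟩ := stepsIn_succ.1 h
    refine stepsIn_succ.2 ⟨_, ih h1, ?_⟩
    obtain ⟨l, v, S⟩ := d
    cases l with
    | none => cases h2
    | some l =>
      cases h2
      simp only [liftCfg, Option.elim, TM2.step, hm]
      rw [stepAux_liftStmt]
      rfl

/-- The number of `push` operations in a statement. -/
def pushes : TM2.Stmt Γ₁ Λ₁ σ₁ → ℕ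
  | .push _ _ q => pushes q + 1
  | .peek _ _ q => pushes q
  | .pop _ _ q => pushes q
  | .load _ q => pushes q
  | .branch _ q q' => max (pushes q) (pushes q')
  | .goto _ => 0
  | .halt => 0

theorem length_stepAux_le (q : TM2.Stmt Γ₁ Λ₁ σ₁) (v : σ₁) (S : ∀ k, List (Γ₁ k)) (k : K₁) :
    ((TM2.stepAux q v S).stk k).length ≤ (S k).length + pushes q := by
  induction q generalizing v S with
  | push k' f q ih =>
    simp only [TM2.stepAux, pushes]
    refine (ih _ _).trans ?_
    by_cases h : k = k'
    · subst h
      simp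
      omega
    · simp [h]
  | peek k f q ih => exact ih _ _
  | pop k' f q ih =>
    simp only [TM2.stepAux, pushes]
    refine (ih _ _).trans ?_
    by_cases h : k = k'
    · subst h
      simp
    · simp [h]
  | load f q ih => exact ih _ _
  | branch f q q' ih ih' =>
    simp only [TM2.stepAux, pushes]
    cases f v
    · exact (ih' _ _).trans (by omega)
    · exact (ih _ _).trans (by omega)
  | goto f => simp [TM2.stepAux, pushes]
  | halt => simp [TM2.stepAux, pushes]

theorem length_stepsIn_le {m₁ : Λ₁ → TM2.Stmt Γ₁ Λ₁ σ₁} {C : ℕ} (hC : ∀ l, pushes (m₁ l) ≤ C)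
    {n : ℕ} {c c' : TM2.Cfg Γ₁ Λ₁ σ₁} (h : StepsIn (TM2.step m₁) n c c') (k : K₁) :
    (c'.stk k).length ≤ (c.stk k).length + n * C := by
  induction n generalizing c' with
  | zero =>
    cases h
    simp
  | succ n ih =>
    obtain ⟨d, h1, h2⟩ := stepsIn_succ.1 h
    have h3 := ih h1
    obtain ⟨l, v, S⟩ := d
    cases l with
    | none => cases h2
    | some l =>
      cases h2
      have h4 := length_stepAux_le (m₁ l) v S k
      have h5 := hC l
      dsimp only at h3
      rw [Nat.succ_mul]
      omega

end Lift

/-- The labels of `M` followed by the program `P`. -/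
abbrev FinTM2.ThenLab (M : FinTM2) (P : Prog) : Type := M.Λ ⊕ P.Lab ⊕ Bool

/-- The statements of the machine that runs `M`, moves its output to stack `1`, and then
runs `P`. -/
def FinTM2.thenStmt (M : FinTM2) (e : M.Γ M.k₁ ≃ Bool) (P : Prog) (R : ℕ) :
    M.ThenLab P → TM2.Stmt (Alph M.Γ R) (M.ThenLab P) (M.σ × Option Bool)
  | .inl l => liftStmt Sum.inl (.inr (.inr false)) (M.m l)
  | .inr (.inl l) => compile P (Sum.inr ∘ Sum.inl) (.inr (.inr true)) l
  | .inr (.inr false) => .pop (Sum.inl M.k₁) (fun v o => (v.1, o.map e))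
      (.branch (fun v => v.2.isSome)
        (.push (reg M.K R 1) (fun v => v.2.getD false) (.goto fun _ => .inr (.inr false)))
        (.goto fun _ => .inr (.inl P.entry)))
  | .inr (.inr true) => .load (fun v => (v.1, none)) .halt

/-- The machine that runs `M`, moves its output to stack `1`, and then runs `P`. Its output is the
content of stack `3`. -/
noncomputable def FinTM2.andThen (M : FinTM2) (e : M.Γ M.k₁ ≃ Bool) (P : Prog) : FinTM2 :=
  let R := max P.regs 3
  haveI := M.kDecidableEq
  haveI := M.kFin
  haveI := M.ΛFin
  haveI := M.σFin
  haveI : Fintype P.Lab := Fintype.ofFinite _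
  { K := M.K ⊕ Fin (R + 1)
    k₀ := Sum.inl M.k₀
    k₁ := reg M.K R 3
    Γ := Alph M.Γ R
    Λ := M.ThenLab P
    main := Sum.inl M.main
    σ := M.σ × Option Bool
    initialState := (M.initialState, none)
    Γk₀Fin := M.Γk₀Fin
    m := M.thenStmt e P R }

/-- The stack contents with `w` on stack `r` and nothing elsewhere. -/
def Store.single (r : ℕ) (w : List Bool) : Store := Function.update (fun _ => []) r w

/-- Popping from one stack and pushing onto another reverses the string. The extra step is the pop
from the empty stack that ends the loop. -/
theorem stepsIn_transfer (M : FinTM2) (e : M.Γ M.k₁ ≃ Bool) (P : Prog)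
    (w : List (M.Γ M.k₁)) (u : List Bool) (o : Option Bool) :
    StepsIn (TM2.step (M.thenStmt e P (max P.regs 3))) (w.length + 1)
      ⟨some (.inr (.inr false)), (M.initialState, o),
        joinStk (Function.update (fun _ => []) M.k₁ w) (Store.single 1 u)⟩
      ⟨some (.inr (.inl P.entry)), (M.initialState, none),
        joinStk (fun _ => []) (Store.single 1 ((w.map e).reverse ++ u))⟩ := by
  induction w generalizing u o with
  | nil =>
    refine StepsIn.single ?_
    have h : Function.update (fun k => ([] : List (M.Γ k))) M.k₁ [] = fun _ => [] :=
      Function.update_eq_self _ _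
    simp only [FinTM2.thenStmt, TM2.step, TM2.stepAux, List.map_nil, List.reverse_nil,
      List.nil_append]
    rw [update_joinStk_inl, h]
    simp [joinStk]
  | cons x w ih =>
    have h1 := ih (e x :: u) (some (e x))
    have h0 : (x :: w).length + 1 = 1 + (w.length + 1) := by simp [Nat.add_comm]
    simp only [h0]
    refine StepsIn.trans (StepsIn.single ?_) (by simpa using h1)
    simp only [FinTM2.thenStmt, TM2.step, TM2.stepAux]
    rw [update_joinStk_inl]
    have h1 : (1 : ℕ) ≤ max P.regs 3 := by omega
    simp only [joinStk, Function.update_self, List.head?_cons, Option.map_some, Option.isSome_some,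
      cond_true, List.tail_cons, Option.getD_some]
    rw [update_joinStk_reg _ _ h1]
    have h2 : Function.update (Function.update (fun k => ([] : List (M.Γ k))) M.k₁ (x :: w)) M.k₁ w
      = Function.update (fun k => []) M.k₁ w := by simp
    rw [h2]
    simp [Store.single, Nat.mod_eq_of_lt (Nat.lt_succ_of_le h1)]

theorem initList_eq (M : FinTM2) (s : List (M.Γ M.k₀)) :
    initList M s = ⟨some M.main, M.initialState, Function.update (fun _ => []) M.k₀ s⟩ := by
  unfold initList
  congr 1
  funext k
  by_cases hk : k = M.k₀
  · subst hk
    simp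
  · simp [hk]

theorem haltList_eq (M : FinTM2) (s : List (M.Γ M.k₁)) :
    haltList M s = ⟨none, M.initialState, Function.update (fun _ => []) M.k₁ s⟩ := by
  unfold haltList
  congr 1
  funext k
  by_cases hk : k = M.k₁
  · subst hk
    simp
  · simp [hk]

/-- The time is that of `M`, then `w.length + 1` steps for the transfer, `t` for `P`, and one to
halt. A halting configuration in the sense of `haltList` must have the initial internal state and no
content outside the output stack. This is why the last statement resets the buffer and why `P` has
to clean up all stacks but `3`. -/
theorem FinTM2.andThen_outputs (M : FinTM2) (e : M.Γ M.k₁ ≃ Bool) (P : Prog)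
    {x : List (M.Γ M.k₀)} {w out : List Bool} {t T : ℕ}
    (h : TM2OutputsInTime M x (some (w.map e.symm)) T)
    (hP : Exec P (Store.single 1 w.reverse) t (Store.single 3 out)) :
    Nonempty (TM2OutputsInTime (M.andThen e P) x (some out) (T + w.length + t + 2)) := by
  obtain ⟨⟨n, hn⟩, hT⟩ := h
  have h1 : StepsIn (TM2.step M.m) n (initList M x) (haltList M (w.map e.symm)) := hn
  have h2 := stepsIn_liftCfg (m := (M.thenStmt e P (max P.regs 3))) (emb := Sum.inl)
    (xfer := .inr (.inr false)) (fun _ => rfl) h1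
  have h3 : Prog.StepsIn _ _ _ _ := stepsIn_transfer M e P (w.map e.symm) [] none
  obtain ⟨o, h4⟩ := hP.stepsIn (m := (M.thenStmt e P (max P.regs 3))) (le_max_left _ _)
    (Sum.inr ∘ Sum.inl) (.inr (.inr true)) (fun _ => rfl) M.initialState none (fun _ => [])
  have h5 : StepsIn (TM2.step (M.thenStmt e P (max P.regs 3))) 1
      ⟨some (.inr (.inr true)), (M.initialState, o), joinStk (fun _ => []) (Store.single 3 out)⟩
      ⟨none, (M.initialState, none), joinStk (fun _ => []) (Store.single 3 out)⟩ := rfl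
  have hnil : joinStk (R := max P.regs 3) (fun k => ([] : List (M.Γ k))) (fun _ => []) =
      fun _ => [] := by
    funext k
    cases k <;> rfl
  have e1 : liftCfg (R := max P.regs 3) Sum.inl (.inr (.inr false))
      (haltList M (w.map e.symm)) =
      (⟨some (.inr (.inr false)), (M.initialState, none),
        joinStk (Function.update (fun _ => []) M.k₁ (w.map e.symm)) (Store.single 1 [])⟩ :
        TM2.Cfg (Alph M.Γ (max P.regs 3)) (M.ThenLab P) _) := by
    have h6 : (Store.single 1 [] : Store) = fun _ => [] := Function.update_eq_self _ _
    rw [h6, haltList_eq]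
    rfl
  rw [e1] at h2
  have h7 := ((h2.trans h3).trans (by simpa using h4)).trans h5
  have e2 : liftCfg (R := max P.regs 3) Sum.inl (.inr (.inr false)) (initList M x) =
      initList (M.andThen e P) x := by
    rw [initList_eq]
    refine Eq.trans ?_ (initList_eq (M.andThen e P) x).symm
    have := update_joinStk_inl (R := max P.regs 3) (fun k => ([] : List (M.Γ k))) (fun _ => [])
      M.k₀ x
    rw [hnil] at this
    exact congrArg (TM2.Cfg.mk (some (Sum.inl M.main)) (M.initialState, none)) this.symm
  have e3 : (⟨none, (M.initialState, none), joinStk (fun _ => []) (Store.single 3 out)⟩ :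
      TM2.Cfg (Alph M.Γ (max P.regs 3)) (M.ThenLab P) _) = haltList (M.andThen e P) out := by
    refine Eq.trans ?_ (haltList_eq (M.andThen e P) out).symm
    have := update_joinStk_reg (R := max P.regs 3) (fun k => ([] : List (M.Γ k))) (fun _ => [])
      (le_max_right P.regs 3) out
    rw [hnil] at this
    exact congrArg (TM2.Cfg.mk none (M.initialState, none)) this.symm
  rw [e2, e3] at h7
  refine ⟨⟨⟨_, h7⟩, ?_⟩⟩
  change n ≤ T at hT
  simp only [List.length_map]
  omega

end Turing

/-! ### Polynomially bounded functions -/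

/-- A monotone function that is bounded by a polynomial. -/
def PolyBounded (p : ℕ → ℕ) : Prop := Monotone p ∧ ∃ c, ∀ n, p n ≤ (n + 2) ^ c

namespace PolyBounded

variable {p q : ℕ → ℕ}

/-- The base `n + 2` in the bound is at least `2` even for `n = 0`, so constants and constant
factors are absorbed by raising the exponent. -/
theorem const (m : ℕ) : PolyBounded fun _ => m :=
  ⟨monotone_const, m, fun n => m.lt_two_pow_self.le.trans (Nat.pow_le_pow_left (by omega) m)⟩

theorem id : PolyBounded fun n => n := ⟨monotone_id, 1, fun n => by simp⟩

theorem add (hp : PolyBounded p) (hq : PolyBounded q) : PolyBounded fun n => p n + q n := by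
  obtain ⟨hp, c, hc⟩ := hp
  obtain ⟨hq, d, hd⟩ := hq
  refine ⟨hp.add hq, max c d + 1, fun n => ?_⟩
  have h1 := (hc n).trans (Nat.pow_le_pow_right (by omega) (le_max_left c d))
  have h2 := (hd n).trans (Nat.pow_le_pow_right (by omega) (le_max_right c d))
  have h3 : (n + 2) ^ (max c d) * 2 ≤ (n + 2) ^ (max c d + 1) := by
    rw [pow_succ]
    exact Nat.mul_le_mul_left _ (by omega)
  change p n + q n ≤ _
  omega

theorem mul (hp : PolyBounded p) (hq : PolyBounded q) : PolyBounded fun n => p n * q n := by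
  obtain ⟨hp, c, hc⟩ := hp
  obtain ⟨hq, d, hd⟩ := hq
  refine ⟨hp.mul hq (fun _ => Nat.zero_le _) (fun _ => Nat.zero_le _), c + d, fun n => ?_⟩
  rw [pow_add]
  exact Nat.mul_le_mul (hc n) (hd n)

theorem comp (hp : PolyBounded p) (hq : PolyBounded q) : PolyBounded fun n => p (q n) := by
  obtain ⟨hp, c, hc⟩ := hp
  obtain ⟨hq, d, hd⟩ := hq
  refine ⟨hp.comp hq, (d + 2) * c, fun n => (hc _).trans ?_⟩
  rw [pow_mul]
  refine Nat.pow_le_pow_left ?_ c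
  -- The argument of the outer bound is `q n + 2 ≤ (n + 2) ^ d + 2 ≤ 4 (n + 2) ^ d`.
  have h1 : (n + 2) ^ d * 4 ≤ (n + 2) ^ (d + 2) := by
    rw [pow_add]
    refine Nat.mul_le_mul_left _ ?_
    rw [pow_two]
    exact Nat.mul_le_mul (by omega : 2 ≤ n + 2) (by omega : 2 ≤ n + 2)
  have h2 : 1 ≤ (n + 2) ^ d := Nat.one_le_pow _ _ (by omega)
  have h3 := hd n
  omega

end PolyBounded

/-! ### Basic programs -/

/-- The unary representation of a number on a stack. -/
abbrev ones (n : ℕ) : List Bool := List.replicate n true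

namespace Prog

/-- Started in `s`, the program `P` terminates in `s'` after at most `T` steps. -/
def ExecIn (P : Prog) (s : Store) (T : ℕ) (s' : Store) : Prop := ∃ t ≤ T, Exec P s t s'

theorem Exec.execIn {P : Prog} {s s' : Store} {t : ℕ} (h : Exec P s t s') : ExecIn P s t s' :=
  ⟨t, le_rfl, h⟩

theorem ExecIn.seq {P Q : Prog} {s s' s'' : Store} {t t' : ℕ} (h : ExecIn P s t s')
    (h' : ExecIn Q s' t' s'') : ExecIn (P.seq Q) s (t + t') s'' := by
  obtain ⟨a, ha, h⟩ := h
  obtain ⟨b, hb, h'⟩ := h'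
  exact ⟨_, Nat.add_le_add ha hb, h.seq h'⟩

theorem ExecIn.cast {P : Prog} {s s' u u' : Store} {t t' : ℕ} (h : ExecIn P s t s')
    (hs : s = u) (hs' : s' = u') (ht : t ≤ t') : ExecIn P u t' u' := by
  subst hs hs'
  obtain ⟨a, ha, h⟩ := h
  exact ⟨a, ha.trans ht, h⟩

/-- The sequence `st` plays the role of a loop invariant: it prescribes the store after each round.
A round costs its body and one test, and a final test leaves the loop. -/
theorem execIn_loop {r : ℕ} {P : Prog} {T m : ℕ} (st : ℕ → Store)
    (h : ∀ i < m, st i r ≠ [] ∧ ExecIn P (st i) T (st (i + 1))) (hm : st m r = []) :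
    ExecIn (whl r P) (st 0) (m * (T + 1) + 1) (st m) := by
  induction m generalizing st with
  | zero => exact ⟨1, by omega, .whl_nil hm⟩
  | succ m ih =>
    obtain ⟨h1, t, ht, h2⟩ := h 0 (by omega)
    obtain ⟨t', ht', h3⟩ := ih (fun i => st (i + 1)) (fun i hi => h (i + 1) (by omega)) hm
    refine ⟨_, ?_, .whl_cons h1 h2 h3⟩
    have : (m + 1) * (T + 1) = m * (T + 1) + (T + 1) := Nat.succ_mul _ _
    omega

theorem execIn_clear (r : ℕ) (s : Store) :
    ExecIn (whl r (pop r)) s (2 * (s r).length + 1) (Function.update s r []) := by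
  have h := execIn_loop (r := r) (P := pop r) (T := 1) (m := (s r).length)
    (fun i => Function.update s r ((s r).drop i)) (fun i hi => ⟨?_, ?_⟩) (by simp)
  · exact h.cast (by simp) (by simp) (by omega)
  · simpa using hi
  · exact (Exec.pop r _).execIn.cast rfl (by simp) le_rfl

theorem exists_drop_take {x : List Bool} {j : ℕ} (hj : j < x.length) :
    ∃ b, x.drop j = b :: x.drop (j + 1) ∧ x.take (j + 1) = x.take j ++ [b] :=
  ⟨x[j], List.drop_eq_getElem_cons hj, List.take_succ_eq_append_getElem hj⟩

theorem execIn_moveAll {r r' : ℕ} (hr : r ≠ r') (s : Store) :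
    ExecIn (whl r (move r r')) s (2 * (s r).length + 1)
      (Function.update (Function.update s r []) r' ((s r).reverse ++ s r')) := by
  have h := execIn_loop (r := r) (P := move r r') (T := 1) (m := (s r).length)
    (fun i => Function.update (Function.update s r ((s r).drop i)) r'
      (((s r).take i).reverse ++ s r')) (fun i hi => ⟨?_, ?_⟩) (by simp [hr])
  · exact h.cast (by simp) (by simp) (by omega)
  · simpa [hr] using hi
  · refine (Exec.move r r' _).execIn.cast rfl ?_ le_rfl
    obtain ⟨b, h1, h2⟩ := exists_drop_take hi
    simp only [moveStore, Function.update_of_ne hr, Function.update_self, h1]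
    funext x
    by_cases hx : x = r'
    · subst hx
      simp only [Function.update_self, h2, List.reverse_append, List.reverse_singleton,
        List.nil_append, List.cons_append, Function.update_of_ne hr.symm]
    · by_cases hx' : x = r
      · subst hx'
        simp [hx]
      · simp [hx, hx']

end Prog

/-! ### Polynomial time functions -/

/-- Contexts: a bit string (the input) and finitely or infinitely many numbers. -/
class Ctx (α : Type) where
  Idx : Type
  read : α → Idx → ℕ
  inp : α → List Bool

namespace Ctx

instance : Ctx (List Bool) := ⟨Empty, fun _ i => i.elim, id⟩

instance {α : Type} [Ctx α] : Ctx (α × ℕ) :=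
  ⟨Option (Idx α), fun p i => i.elim p.2 (read p.1), fun p => inp p.1⟩

variable {α : Type} [Ctx α]

/-- The length of the input and all numbers are at most `n`. -/
def Bdd (a : α) (n : ℕ) : Prop := (inp a).length ≤ n ∧ ∀ i, read a i ≤ n

/-- Stacks for the numbers of a context, below `d`, and apart from those for input and output. -/
def Frame (loc : Idx α → ℕ) (d : ℕ) : Prop := 3 ≤ d ∧ ∀ i, 3 ≤ loc i ∧ loc i < d

/-- The store `s` represents the context `a`, and its stacks from `d` on are empty. -/
structure Located (loc : Idx α → ℕ) (d : ℕ) (a : α) (s : Store) : Prop where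
  inp : s 0 = Ctx.inp a
  aux : s 1 = []
  read : ∀ i, s (loc i) = ones (Ctx.read a i)
  clean : ∀ r, d ≤ r → s r = []

theorem Bdd.mono {a : α} {n m : ℕ} (h : Bdd a n) (hm : n ≤ m) : Bdd a m :=
  ⟨h.1.trans hm, fun i => (h.2 i).trans hm⟩

theorem Bdd.pair {a : α} {n j : ℕ} (h : Bdd a n) (hj : j ≤ n) : Bdd (a, j) n :=
  ⟨h.1, fun i => by
    cases i with
    | none => exact hj
    | some i => exact h.2 i⟩

end Ctx

open Ctx Prog

section

variable {α : Type} [Ctx α]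

/-- `f` can be computed in polynomial time, with all numbers in unary. -/
def PolyTime (f : α → ℕ) : Prop :=
  (∃ p, PolyBounded p ∧ ∀ a n, Bdd a n → f a ≤ p n) ∧
  ∀ (loc : Idx α → ℕ) (d : ℕ), Frame loc d → ∃ P p, PolyBounded p ∧
    ∀ a n s, Bdd a n → Located loc d a s →
      ExecIn P s (p n) (Function.update s d (ones (f a)))

/-- The string `g a` can be written out in polynomial time. -/
def PolyOut (g : α → List Bool) : Prop :=
  (∃ p, PolyBounded p ∧ ∀ a n, Bdd a n → (g a).length ≤ p n) ∧
  ∀ (loc : Idx α → ℕ) (d : ℕ), Frame loc d → ∃ P p, PolyBounded p ∧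
    ∀ a n s, Bdd a n → Located loc d a s →
      ExecIn P s (p n) (Function.update s 2 ((g a).reverse ++ s 2))

theorem Ctx.Located.update {loc : Idx α → ℕ} {d : ℕ} {a : α} {s : Store} (h : Located loc d a s)
    (hf : Frame loc d) {r : ℕ} (hr : d ≤ r) (l : List Bool) {d' : ℕ} (hd : r < d') :
    Located loc d' a (Function.update s r l) := by
  have h3 := hf.1
  refine ⟨?_, ?_, fun i => ?_, fun x hx => ?_⟩
  · rw [Function.update_of_ne (by omega), h.inp]
  · rw [Function.update_of_ne (by omega), h.aux]
  · have := (hf.2 i).2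
    rw [Function.update_of_ne (by omega), h.read]
  · rw [Function.update_of_ne (by omega), h.clean x (by omega)]

theorem Ctx.Located.update_out {loc : Idx α → ℕ} {d : ℕ} {a : α} {s : Store}
    (h : Located loc d a s) (hf : Frame loc d) (l : List Bool) :
    Located loc d a (Function.update s 2 l) := by
  have h3 := hf.1
  refine ⟨?_, ?_, fun i => ?_, fun x hx => ?_⟩
  · rw [Function.update_of_ne (by omega), h.inp]
  · rw [Function.update_of_ne (by omega), h.aux]
  · have := (hf.2 i).1
    rw [Function.update_of_ne (by omega), h.read]
  · rw [Function.update_of_ne (by omega), h.clean x (by omega)]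

theorem Ctx.Located.pair {loc : Idx α → ℕ} {d : ℕ} {a : α} {s : Store} (h : Located loc d a s)
    {r j : ℕ} (hr : s r = ones j) :
    Located (fun i : Idx (α × ℕ) => Option.elim i r loc) d (a, j) s :=
  ⟨h.inp, h.aux, fun i => by
    cases i with
    | none => exact hr
    | some i => exact h.read i, h.clean⟩

theorem Ctx.Frame.pair {loc : Idx α → ℕ} {d : ℕ} (h : Frame loc d) {r : ℕ} (hr : 3 ≤ r)
    (hd : r < d) : Frame (fun i : Idx (α × ℕ) => Option.elim i r loc) d :=
  ⟨h.1, fun i => by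
    cases i with
    | none => exact ⟨hr, hd⟩
    | some i => exact h.2 i⟩

theorem Ctx.Frame.mono {loc : Idx α → ℕ} {d d' : ℕ} (h : Frame loc d) (hd : d ≤ d') :
    Frame loc d' := ⟨h.1.trans hd, fun i => ⟨(h.2 i).1, (h.2 i).2.trans_le hd⟩⟩

namespace PolyTime

theorem of_eq {f g : α → ℕ} (hf : PolyTime f) (h : ∀ a, f a = g a) : PolyTime g :=
  (funext h : f = g) ▸ hf

theorem zero : PolyTime fun _ : α => 0 := by
  -- Stack `d` is empty, so popping it changes nothing; it serves as the idle program.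
  refine ⟨⟨_, .const 0, fun _ _ _ => le_rfl⟩, fun loc d hd => ⟨pop d, _, .const 1, ?_⟩⟩
  intro a n s _ hs
  exact (Exec.pop d s).execIn.cast rfl (by simp [hs.clean d le_rfl]) le_rfl

theorem succ {f : α → ℕ} (hf : PolyTime f) : PolyTime fun a => f a + 1 := by
  obtain ⟨⟨q, hq, hfq⟩, hf⟩ := hf
  refine ⟨⟨_, hq.add (.const 1), fun a n h => by simpa using hfq a n h⟩, fun loc d hd => ?_⟩
  obtain ⟨P, p, hp, h⟩ := hf loc d hd
  refine ⟨P.seq (push d true), _, hp.add (.const 1), fun a n s ha hs => ?_⟩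
  exact ((h a n s ha hs).seq (Exec.push d true _).execIn).cast rfl
    (by simp [List.replicate_succ]) le_rfl

theorem pred {f : α → ℕ} (hf : PolyTime f) : PolyTime fun a => f a - 1 := by
  obtain ⟨⟨q, hq, hfq⟩, hf⟩ := hf
  refine ⟨⟨_, hq, fun a n h => (Nat.sub_le _ _).trans (hfq a n h)⟩, fun loc d hd => ?_⟩
  obtain ⟨P, p, hp, h⟩ := hf loc d hd
  refine ⟨P.seq (pop d), _, hp.add (.const 1), fun a n s ha hs => ?_⟩
  exact ((h a n s ha hs).seq (Exec.pop d _).execIn).cast rfl (by simp) le_rfl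

/-- A unary number can only be read destructively: it is unloaded into two copies, one of which is
then moved back. -/
theorem read (i : Idx α) : PolyTime fun a : α => Ctx.read a i := by
  refine ⟨⟨_, .id, fun a n h => h.2 i⟩, fun loc d hd => ?_⟩
  refine ⟨(whl (loc i) ((pop (loc i)).seq ((push d true).seq (push (d + 1) true)))).seq
    (whl (d + 1) (move (d + 1) (loc i))), fun n => (n * 4 + 1) + (2 * n + 1),
    ((PolyBounded.id.mul (.const 4)).add (.const 1)).add
      (((PolyBounded.const 2).mul .id).add (.const 1)), ?_⟩
  intro a n s ha hs
  set m := Ctx.read a i with hm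
  have hmn : m ≤ n := ha.2 i
  have hi := (hd.2 i).2
  have h3 := hs.read i
  have h4 := hs.clean d le_rfl
  have h5 := hs.clean (d + 1) (by omega)
  rw [← hm] at h3
  have h1 := execIn_loop (r := loc i)
    (P := (pop (loc i)).seq ((push d true).seq (push (d + 1) true))) (T := 3) (m := m)
    (fun j => Function.update (Function.update (Function.update s (loc i) (ones (m - j)))
      d (ones j)) (d + 1) (ones j)) (fun j hj => ⟨?_, ?_⟩) ?_
  · refine (h1.seq (execIn_moveAll (show d + 1 ≠ loc i by omega) _)).cast ?_ ?_ ?_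
    · funext x
      simp only [Function.update_apply]
      split_ifs <;> simp_all
    · funext x
      simp only [Function.update_apply]
      split_ifs <;> first | omega | simp_all
    · simp
      omega
  · have : m - j ≠ 0 := by omega
    simp [show loc i ≠ d by omega, show loc i ≠ d + 1 by omega, this]
  · refine (Exec.seq (.pop (loc i) _) (.seq (.push d true _) (.push (d + 1) true _))).execIn.cast
      rfl ?_ le_rfl
    funext x
    simp only [Function.update_apply]
    split_ifs <;> first | omega | simp_all [List.replicate_succ, Nat.sub_sub]
  · simp [show loc i ≠ d by omega, show loc i ≠ d + 1 by omega]

/-- Stack `d` holds the current value, `d + 1` the counter `j`, `d + 2` the number of rounds left,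
and `S` is evaluated into `d + 3`. The bound `q` on all intermediate values is indispensable, since
iterating a polynomial time step may otherwise produce numbers of exponential size. -/
theorem bounded_recursion {N Z : α → ℕ} {S : (α × ℕ) × ℕ → ℕ} (f : α → ℕ → ℕ) (hN : PolyTime N)
    (hZ : PolyTime Z) (hS : PolyTime S) {q : ℕ → ℕ} (hq : PolyBounded q)
    (h0 : ∀ a, f a 0 = Z a) (h1 : ∀ a j, f a (j + 1) = S ((a, j), f a j))
    (hf : ∀ a n j, Bdd a n → j ≤ N a → f a j ≤ q n) : PolyTime fun a => f a (N a) := by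
  obtain ⟨⟨pN, hpN, hNb⟩, hN⟩ := hN
  obtain ⟨-, hZ⟩ := hZ
  obtain ⟨-, hS⟩ := hS
  refine ⟨⟨q, hq, fun a n h => hf a n _ h le_rfl⟩, fun loc d hd => ?_⟩
  obtain ⟨PZ, tZ, htZ, hZ⟩ := hZ loc d hd
  have hd2 : Frame loc (d + 2) := hd.mono (by omega)
  obtain ⟨PN, tN, htN, hN⟩ := hN loc (d + 2) hd2
  have hd3 := Frame.pair ((hd.mono (show d ≤ d + 3 by omega)).pair (r := d + 1)
    (hd.1.trans (Nat.le_succ d)) (by omega)) (show 3 ≤ d from hd.1) (show d < d + 3 by omega)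
  obtain ⟨PS, tS, htS, hS⟩ := hS _ (d + 3) hd3
  let body := PS.seq ((whl d (pop d)).seq ((whl (d + 3) (move (d + 3) d)).seq
    ((push (d + 1) true).seq (pop (d + 2)))))
  let T : ℕ → ℕ := fun n => tS (n + pN n + q n) + ((2 * q n + 1) + ((2 * q n + 1) + 2))
  have hn : PolyBounded fun n => n + pN n + q n := (PolyBounded.id.add hpN).add hq
  have hT : PolyBounded T := (htS.comp hn).add ((((PolyBounded.const 2).mul hq).add
    (.const 1)).add ((((PolyBounded.const 2).mul hq).add (.const 1)).add (.const 2)))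
  refine ⟨PZ.seq (PN.seq ((whl (d + 2) body).seq (whl (d + 1) (pop (d + 1))))),
    fun n => tZ n + (tN n + ((pN n * (T n + 1) + 1) + (2 * pN n + 1))),
    htZ.add (htN.add (((hpN.mul (hT.add (.const 1))).add (.const 1)).add
      (((PolyBounded.const 2).mul hpN).add (.const 1)))), ?_⟩
  intro a n s ha hs
  have hm := hNb a n ha
  obtain ⟨m, hmd⟩ : ∃ m, N a = m := ⟨_, rfl⟩
  simp only [hmd] at hm ⊢
  have h3 := hd.1
  have hc0 := hs.clean d le_rfl
  have hc1 := hs.clean (d + 1) (by omega)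
  have hc2 := hs.clean (d + 2) (by omega)
  have hc3 := hs.clean (d + 3) (by omega)
  let st : ℕ → Store := fun j => Function.update (Function.update (Function.update s
    d (ones (f a j))) (d + 1) (ones j)) (d + 2) (ones (m - j))
  have hst : ∀ j, Located loc (d + 3) a (st j) := fun j =>
    ((hs.update hd le_rfl _ (Nat.lt_succ_self _)).update (hd.mono (Nat.le_succ _)) le_rfl _
      (Nat.lt_succ_self _)).update hd2 le_rfl _ (Nat.lt_succ_self _)
  have hloop := execIn_loop (r := d + 2) (P := body) (T := T n) (m := m) st
    (fun j hj => ⟨?_, ?_⟩) (by simp [st])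
  · refine ((hZ a n s ha hs).seq ((hN a n _ ha (hs.update hd le_rfl _ (by omega))).seq
      ((hloop.cast ?_ rfl le_rfl).seq (execIn_clear (d + 1) _)))).cast rfl ?_ ?_
    · funext x
      simp only [st, Function.update_apply, h0]
      split_ifs <;> simp_all
    · funext x
      simp only [st, Function.update_apply]
      split_ifs <;> first | omega | simp_all
    · have hl : (st m (d + 1)).length = m := by simp [st]
      rw [hl]
      have := Nat.mul_le_mul_right (T n + 1) hm
      simp only [add_le_add_iff_left]
      omega
  · have : m - j ≠ 0 := by omega
    simp [st, this]
  · have hb : Bdd ((a, j), f a j) (n + pN n + q n) := by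
      have := hf a n j ha (hmd ▸ hj.le)
      exact ((ha.mono (by omega)).pair (by omega)).pair (by omega)
    have hl : Located _ (d + 3) ((a, j), f a j) (st j) :=
      ((hst j).pair (r := d + 1) (by simp [st])).pair (r := d) (by simp [st])
    have e1 := hf a n j ha (hmd ▸ hj.le)
    have e2 := hf a n (j + 1) ha (hmd ▸ hj)
    refine ((hS _ _ _ hb hl).seq ((execIn_clear d _).seq ((execIn_moveAll
      (show d + 3 ≠ d by omega) _).seq (Exec.seq (.push (d + 1) true _)
        (.pop (d + 2) _)).execIn))).cast rfl ?_ ?_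
    · funext x
      simp only [st, Function.update_apply, ← h1]
      split_ifs <;> first | omega | simp_all [List.replicate_succ, Nat.sub_sub]
    · simp [st, T, ← h1]
      omega

/-- The first `f a` bits of the input are put aside on stack `1`, the next one is inspected, and the
bits are moved back. Beyond the end of the input the moves do nothing and the inspected bit is
absent. -/
theorem bit {f : α → ℕ} (hf : PolyTime f) :
    PolyTime fun a => if (Ctx.inp a)[f a]? = some true then 1 else 0 := by
  obtain ⟨⟨q, hq, hfq⟩, hf⟩ := hf
  refine ⟨⟨_, .const 1, fun a n h => ?_⟩, fun loc d hd => ?_⟩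
  · dsimp only
    split_ifs <;> omega
  obtain ⟨P, p, hp, h⟩ := hf loc d hd
  refine ⟨P.seq ((whl d ((pop d).seq (move 0 1))).seq ((ite 0 (push d true) (pop d)).seq
    (whl 1 (move 1 0)))), fun n => p n + ((q n * 3 + 1) + (2 + (2 * n + 1))),
    hp.add (((hq.mul (.const 3)).add (.const 1)).add ((PolyBounded.const 2).add
      (((PolyBounded.const 2).mul .id).add (.const 1)))), ?_⟩
  intro a n s ha hs
  have hm := hfq a n ha
  have hx := ha.1
  have h3 := hd.1
  have hs0 := hs.inp
  have hP := h a n s ha hs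
  beta_reduce
  generalize f a = m at hm hP ⊢
  generalize Ctx.inp a = x at hx hs0 ⊢
  clear h hf hfq
  have hs1 := hs.aux
  have hs2 := hs.clean d le_rfl
  have e0 : d ≠ 0 := by omega
  have e1 : d ≠ 1 := by omega
  let st : ℕ → Store := fun j => Function.update (Function.update (Function.update s
    d (ones (m - j))) 0 (x.drop j)) 1 (x.take j).reverse
  have hloop := execIn_loop (r := d) (P := (pop d).seq (move 0 1)) (T := 2) (m := m) st
    (fun j hj => ⟨?_, ?_⟩) (by simp [st, e0, e1])
  -- After the loop stack `d` is empty, so that the `pop` in the negative branch is idle and leaves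
  -- the number `0`.
  · have hite : ExecIn (ite 0 (push d true) (pop d)) (st m) 2
        (Function.update (st m) d (ones (if x[m]? = some true then 1 else 0))) := by
      have h4 : (st m 0).head? = x[m]? := by simp [st]
      have h5 : st m d = [] := by simp [st, e0, e1]
      split_ifs with hb
      · exact (Exec.ite_true (h4.trans hb) (.push d true _)).execIn.cast rfl (by simp [h5]) le_rfl
      · exact (Exec.ite_false (by rwa [h4]) (.pop d _)).execIn.cast rfl (by simp [h5]) le_rfl
    refine (hP.seq ((hloop.cast ?_ rfl le_rfl).seq (hite.seq
      (execIn_moveAll (show 1 ≠ 0 by omega) _)))).cast rfl ?_ ?_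
    · funext r
      simp only [st, Function.update_apply]
      split_ifs <;> simp_all
    · funext r
      simp only [st, Function.update_apply]
      split_ifs <;> first | omega | simp_all
    · simp [st, e1.symm]
      omega
  · have : m - j ≠ 0 := by omega
    simp [st, e0, e1, this]
  · refine (Exec.seq (.pop d _) (.move 0 1 _)).execIn.cast rfl ?_ le_rfl
    have e2 : ∀ r, (st (j + 1)) r = if r = 1 then (x.take (j + 1)).reverse else
        if r = 0 then x.drop (j + 1) else if r = d then ones (m - (j + 1)) else s r := by
      intro r
      simp [st, Function.update_apply]
    by_cases hj' : j < x.length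
    · obtain ⟨b, h5, h6⟩ := exists_drop_take hj'
      have h7 : Function.update (st j) d (st j d).tail 0 = b :: x.drop (j + 1) := by
        simp [st, e0.symm, h5]
      funext r
      rw [e2]
      simp only [moveStore, h7]
      simp only [st, Function.update_apply, h6]
      clear h5 h6 h7 e2
      split_ifs <;> first | omega | simp_all [Nat.sub_sub]
    · have h5 : x.drop j = [] := List.drop_eq_nil_of_le (by omega)
      have h6 : x.drop (j + 1) = [] := List.drop_eq_nil_of_le (by omega)
      have h8 : x.take (j + 1) = x.take j := by
        rw [List.take_of_length_le (by omega), List.take_of_length_le (by omega)]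
      have h7 : Function.update (st j) d (st j d).tail 0 = [] := by
        simp [st, e0.symm, h5]
      funext r
      rw [e2]
      simp only [moveStore, h7]
      simp only [st, Function.update_apply, h6, h8, h5]
      split_ifs <;> first | omega | simp_all [Nat.sub_sub]

theorem length : PolyTime fun a : α => (Ctx.inp a).length := by
  refine ⟨⟨_, .id, fun a n h => h.1⟩, fun loc d hd => ?_⟩
  refine ⟨(whl 0 ((move 0 1).seq (push d true))).seq (whl 1 (move 1 0)),
    fun n => (n * 3 + 1) + (2 * n + 1),
    ((PolyBounded.id.mul (.const 3)).add (.const 1)).add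
      (((PolyBounded.const 2).mul .id).add (.const 1)), ?_⟩
  intro a n s ha hs
  have hx := ha.1
  have h3 := hd.1
  have hs0 := hs.inp
  have hs1 := hs.aux
  have hs2 := hs.clean d le_rfl
  have e0 : d ≠ 0 := by omega
  have e1 : d ≠ 1 := by omega
  beta_reduce
  generalize Ctx.inp a = x at hx hs0 ⊢
  let st : ℕ → Store := fun j => Function.update (Function.update (Function.update s
    d (ones j)) 0 (x.drop j)) 1 (x.take j).reverse
  have hloop := execIn_loop (r := 0) (P := (move 0 1).seq (push d true)) (T := 2)
    (m := x.length) st (fun j hj => ⟨?_, ?_⟩) (by simp [st])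
  · refine (hloop.seq (execIn_moveAll (show 1 ≠ 0 by omega) _)).cast ?_ ?_ ?_
    · funext r
      simp only [st, Function.update_apply]
      split_ifs <;> simp_all
    · funext r
      simp only [st, Function.update_apply]
      split_ifs <;> first | omega | simp_all
    · simp [st]
      omega
  · simpa [st] using hj
  · refine (Exec.seq (.move 0 1 _) (.push d true _)).execIn.cast rfl ?_ le_rfl
    obtain ⟨b, h5, h6⟩ := exists_drop_take hj
    have h7 : st j 0 = b :: x.drop (j + 1) := by simp [st, h5]
    funext r
    simp only [moveStore, h7]
    simp only [st, Function.update_apply, h6]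
    clear h5 h6 h7
    split_ifs <;> first | omega | simp_all [List.replicate_succ]

end PolyTime

namespace PolyOut

theorem of_eq {f g : α → List Bool} (hf : PolyOut f) (h : ∀ a, f a = g a) : PolyOut g :=
  (funext h : f = g) ▸ hf

theorem nil : PolyOut fun _ : α => [] := by
  refine ⟨⟨_, .const 0, fun _ _ _ => le_rfl⟩, fun loc d hd => ⟨pop d, _, .const 1,
    fun a n s _ hs => ?_⟩⟩
  refine (Exec.pop d s).execIn.cast rfl ?_ le_rfl
  simp [hs.clean d le_rfl, Function.update_eq_self_iff]

theorem bit (b : Bool) : PolyOut fun _ : α => [b] :=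
  ⟨⟨_, .const 1, fun _ _ _ => le_rfl⟩, fun _ _ _ => ⟨push 2 b, _, .const 1, fun _ _ s _ _ => (Exec.push 2 b s).execIn⟩⟩

theorem append {f g : α → List Bool} (hf : PolyOut f) (hg : PolyOut g) :
    PolyOut fun a => f a ++ g a := by
  obtain ⟨⟨p, hp, hfp⟩, hf⟩ := hf
  obtain ⟨⟨q, hq, hgq⟩, hg⟩ := hg
  refine ⟨⟨_, hp.add hq, fun a n h => ?_⟩, fun loc d hd => ?_⟩
  · simpa using Nat.add_le_add (hfp a n h) (hgq a n h)
  obtain ⟨P, p, hp, hf⟩ := hf loc d hd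
  obtain ⟨Q, q, hq, hg⟩ := hg loc d hd
  refine ⟨P.seq Q, _, hp.add hq, fun a n s ha hs => ?_⟩
  exact ((hf a n s ha hs).seq (hg a n _ ha (hs.update_out hd _))).cast rfl (by simp) le_rfl

/-- Stack `2` stores the output in reverse, so writing a further piece is pushing onto it. Stack `d`
is the counter `j`, which `g` sees as an additional number of its context, and `d + 1` counts the
remaining rounds. -/
theorem flatMap_range {N : α → ℕ} {g : α × ℕ → List Bool} (hN : PolyTime N) (hg : PolyOut g) :
    PolyOut fun a => (List.range (N a)).flatMap fun j => g (a, j) := by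
  obtain ⟨⟨pN, hpN, hNb⟩, hN⟩ := hN
  obtain ⟨⟨pg, hpg, hgb⟩, hg⟩ := hg
  refine ⟨⟨_, hpN.mul (hpg.comp (PolyBounded.id.add hpN)), fun a n h => ?_⟩, fun loc d hd => ?_⟩
  · have hm := hNb a n h
    rw [List.length_flatMap]
    refine (List.sum_le_card_nsmul _ (pg (n + pN n)) ?_).trans ?_
    · simp only [List.mem_map, List.mem_range]
      rintro _ ⟨j, hj, rfl⟩
      exact hgb _ _ ((h.mono (by omega)).pair (by omega))
    · simpa using Nat.mul_le_mul_right _ hm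
  have hd1 : Frame loc (d + 1) := hd.mono (by omega)
  obtain ⟨PN, tN, htN, hN⟩ := hN loc (d + 1) hd1
  have hd3 := (hd.mono (show d ≤ d + 2 by omega)).pair (r := d) hd.1 (by omega)
  obtain ⟨Pg, tg, htg, hg⟩ := hg _ (d + 2) hd3
  let body := Pg.seq ((push d true).seq (pop (d + 1)))
  let T : ℕ → ℕ := fun n => tg (n + pN n) + 2
  have hT : PolyBounded T := (htg.comp (PolyBounded.id.add hpN)).add (.const 2)
  refine ⟨PN.seq ((whl (d + 1) body).seq (whl d (pop d))),
    fun n => tN n + ((pN n * (T n + 1) + 1) + (2 * pN n + 1)),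
    htN.add (((hpN.mul (hT.add (.const 1))).add (.const 1)).add
      (((PolyBounded.const 2).mul hpN).add (.const 1))), ?_⟩
  intro a n s ha hs
  have hm := hNb a n ha
  obtain ⟨m, hmd⟩ : ∃ m, N a = m := ⟨_, rfl⟩
  simp only [hmd] at hm ⊢
  have h3 := hd.1
  have hc0 := hs.clean d le_rfl
  have hc1 := hs.clean (d + 1) (by omega)
  let out : ℕ → List Bool := fun j =>
    ((List.range j).flatMap fun j => g (a, j)).reverse ++ s 2
  let st : ℕ → Store := fun j => Function.update (Function.update (Function.update s
    2 (out j)) d (ones j)) (d + 1) (ones (m - j))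
  have hst : ∀ j, Located loc (d + 2) a (st j) := fun j =>
    ((hs.update_out hd _).update hd le_rfl _ (Nat.lt_succ_self _)).update hd1 le_rfl _
      (Nat.lt_succ_self _)
  have e2 : 2 ≠ d := by omega
  have e3 : 2 ≠ d + 1 := by omega
  have hloop := execIn_loop (r := d + 1) (P := body) (T := T n) (m := m) st
    (fun j hj => ⟨?_, ?_⟩) (by simp [st])
  · refine ((hN a n _ ha ⟨hs.inp, hs.aux, hs.read, fun r hr => hs.clean r (by omega)⟩).seq
      ((hloop.cast ?_ rfl le_rfl).seq (execIn_clear d _))).cast rfl ?_ ?_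
    · funext x
      simp only [st, out, Function.update_apply]
      split_ifs <;> simp_all
    · funext x
      simp only [st, out, Function.update_apply]
      split_ifs <;> first | omega | simp_all
    · have hl : (st m d).length = m := by simp [st]
      rw [hl]
      have := Nat.mul_le_mul_right (T n + 1) hm
      simp only [add_le_add_iff_left]
      omega
  · have : m - j ≠ 0 := by omega
    simp [st, this]
  · have hb : Bdd (a, j) (n + pN n) := (ha.mono (by omega)).pair (by omega)
    have hl : Located _ (d + 2) (a, j) (st j) := (hst j).pair (r := d) (by simp [st])
    refine ((hg _ _ _ hb hl).seq (Exec.seq (.push d true _) (.pop (d + 1) _)).execIn).cast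
      rfl ?_ le_rfl
    funext x
    simp only [st, out, Function.update_apply]
    split_ifs <;> first | omega | simp_all [List.replicate_succ, Nat.sub_sub, List.range_succ]

/-- Adapts a program to the interface of `FinTM2.andThen_outputs`: the input arrives reversed on
stack `1`, and the reversed output on stack `2` is turned over onto stack `3`. -/
theorem exists_prog {g : List Bool → List Bool} (hg : PolyOut g) :
    ∃ P p, PolyBounded p ∧ ∀ x : List Bool,
      ExecIn P (Turing.Store.single 1 x.reverse) (p x.length)
        (Turing.Store.single 3 (g x)) := by
  have hfr : Frame (fun i : Idx (List Bool) => i.elim) 3 := ⟨le_rfl, fun i => i.elim⟩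
  obtain ⟨⟨q, hq, hgq⟩, hg⟩ := hg
  obtain ⟨P, p, hp, h⟩ := hg _ 3 hfr
  refine ⟨(whl 1 (move 1 0)).seq (P.seq ((whl 0 (pop 0)).seq (whl 2 (move 2 3)))),
    fun n => (2 * n + 1) + (p n + ((2 * n + 1) + (2 * q n + 1))),
    (((PolyBounded.const 2).mul .id).add (.const 1)).add (hp.add
      ((((PolyBounded.const 2).mul .id).add (.const 1)).add
        (((PolyBounded.const 2).mul hq).add (.const 1)))), fun x => ?_⟩
  have hl : Located (fun i : Idx (List Bool) => i.elim) 3 x (Turing.Store.single 0 x) := by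
    refine ⟨by simp [Turing.Store.single, Ctx.inp], by simp [Turing.Store.single],
      fun i => i.elim, fun r hr => ?_⟩
    simp [Turing.Store.single, show r ≠ 0 by omega]
  have hb : Bdd x x.length := ⟨le_rfl, fun i => i.elim⟩
  have hq := hgq x _ hb
  refine ((execIn_moveAll (show 1 ≠ 0 by omega) _).seq (((h x _ _ hb hl).cast ?_ rfl le_rfl).seq
    ((execIn_clear 0 _).seq (execIn_moveAll (show 2 ≠ 3 by omega) _)))).cast rfl ?_ ?_
  · funext r
    simp only [Turing.Store.single, Function.update_apply]
    split_ifs <;> first | omega | simp_all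
  · funext r
    simp only [Turing.Store.single, Function.update_apply]
    split_ifs <;> first | omega | simp_all
  · simp [Turing.Store.single]
    omega

end PolyOut

end

/-! ### Parameterized reductions followed by polynomial time functions -/

theorem Computable.nat_mul_fun {f g : ℕ → ℕ} (hf : Computable f) (hg : Computable g) :
    Computable fun k => f k * g k :=
  (Primrec.nat_mul.to_comp : Computable₂ ((· * ·) : ℕ → ℕ → ℕ)).comp hf hg

theorem Computable.nat_add_fun {f g : ℕ → ℕ} (hf : Computable f) (hg : Computable g) :
    Computable fun k => f k + g k :=
  (Primrec.nat_add.to_comp : Computable₂ ((· + ·) : ℕ → ℕ → ℕ)).comp hf hg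

theorem Computable.nat_pow_const {f : ℕ → ℕ} (hf : Computable f) (e : ℕ) :
    Computable fun k => f k ^ e := by
  induction e with
  | zero => simpa using Computable.const 1
  | succ e ih => simpa only [pow_succ] using ih.nat_mul_fun hf

theorem length_update_nil_le {K : Type} [DecidableEq K] {Γ : K → Type} (k₀ k₁ : K)
    (x : List (Γ k₀)) :
    (Function.update (fun k => ([] : List (Γ k))) k₀ x k₁).length ≤ x.length := by
  by_cases h : k₁ = k₀
  · subst h
    simp
  · simp [h]

/-- A machine pushes at most a constant number of symbols per step. So the instance produced by an
fpt reduction has fpt size, and a polynomial of this size is again an admissible running time. -/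
theorem Turing.FinTM2.exists_length_le (M : FinTM2) :
    ∃ C, ∀ x w T, TM2OutputsInTime M x (some w) T → w.length ≤ x.length + T * C := by
  have := M.ΛFin
  refine ⟨Finset.univ.sup fun l => pushes (M.m l), fun x w T ⟨⟨n, hn⟩, hT⟩ => ?_⟩
  have h1 : Prog.StepsIn (TM2.step M.m) n (initList M x) (haltList M w) := hn
  have h2 := length_stepsIn_le (C := Finset.univ.sup fun l => pushes (M.m l))
    (fun l => Finset.le_sup (f := fun l => pushes (M.m l)) (Finset.mem_univ l)) h1 M.k₁
  rw [initList_eq, haltList_eq] at h2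
  have h3 := length_update_nil_le (Γ := M.Γ) M.k₀ M.k₁ x
  simp only [Function.update_self] at h2
  have h5 := Nat.mul_le_mul_right (Finset.univ.sup fun l => pushes (M.m l)) (show n ≤ T from hT)
  omega

theorem ParamReduces.trans_polyOut {L L' L'' : ParamProblem} (h : ParamReduces L L')
    (R : L'.Inst → L''.Inst) (hR : ∀ x, ParamProblem.Yes x ↔ ParamProblem.Yes (R x))
    {g : ℕ → ℕ} (hg : Computable g) (hgm : Monotone g)
    (hRg : ∀ x, ParamProblem.param (R x) ≤ g (ParamProblem.param x))
    {G : List Bool → List Bool} (hG : PolyOut G)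
    (hcode : ∀ x, ParamProblem.code (R x) = G (ParamProblem.code x)) : ParamReduces L L'' := by
  obtain ⟨R₁, hR₁, ⟨g₁, hg₁, hRg₁⟩, f, c, M, hf, hM⟩ := h
  obtain ⟨P, p, ⟨-, e, hp⟩, hP⟩ := hG.exists_prog
  obtain ⟨C, hC⟩ := M.tm.exists_length_le
  refine ⟨R ∘ R₁, fun x => (hR₁ x).trans (hR _), ⟨g ∘ g₁, hg.comp hg₁, fun x =>
    (hRg _).trans (hgm (hRg₁ x))⟩, fun k => 3 * ((C + 3) * (f k + 1)) ^ (e + 1),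
    (c + 1) * (e + 1), ⟨M.tm.andThen M.outputAlphabet P, M.inputAlphabet, Equiv.refl _⟩, ?_, ?_⟩
  · exact (Computable.const 3).nat_mul_fun (((Computable.const (C + 3)).nat_mul_fun
      (hf.nat_add_fun (Computable.const 1))).nat_pow_const _)
  · intro x
    obtain ⟨h⟩ := hM x
    obtain ⟨t, ht, hE⟩ := hP (ParamProblem.code (R₁ x))
    rw [← hcode] at hE
    obtain ⟨h'⟩ := M.tm.andThen_outputs M.outputAlphabet P h hE
    have hlen := hC _ _ _ h
    simp only [List.length_map] at hlen
    refine ⟨⟨⟨h'.steps, ?_⟩, h'.steps_le_m.trans ?_⟩⟩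
    · refine h'.evals_in_steps.trans ?_
      exact congrArg (fun l => some (Turing.haltList (M.tm.andThen M.outputAlphabet P) l))
        (List.map_id _).symm
    have hp' := hp (ParamProblem.code (R₁ x)).length
    generalize (ParamProblem.code (R₁ x)).length = w at *
    generalize (ParamProblem.code x).length = n at *
    beta_reduce
    generalize f (ParamProblem.param x) = F at *
    -- The quantity `X` dominates both the running time of the first machine and the length `w` of
    -- its output plus `2`. The three parts of the total time, namely first machine, transfer and
    -- `P`, are then each at most `X ^ (e + 1)`.
    set Y := (n + 1) ^ (c + 1) with hY
    set X := (C + 3) * (F + 1) * Y with hX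
    have h1 : n + 1 ≤ Y := by
      rw [hY, pow_succ]
      exact Nat.le_mul_of_pos_left _ (by positivity)
    have h2 : F * (n + 1) ^ c ≤ F * Y :=
      Nat.mul_le_mul_left _ (Nat.pow_le_pow_right (by omega) (by omega))
    have h3 : F * (n + 1) ^ c * C ≤ F * Y * C := Nat.mul_le_mul_right _ h2
    have hXe : X = F * Y * C + C * Y + 3 * (F * Y) + 3 * Y := by
      rw [hX]
      ring
    have h4 : w + 2 ≤ X := by
      have : 0 ≤ C * Y := Nat.zero_le _
      omega
    have h5 : F * (n + 1) ^ c ≤ X := by omega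
    have h6 : (w + 2) ^ e ≤ X ^ e := Nat.pow_le_pow_left h4 e
    have hX1 : 1 ≤ X := by omega
    have h7 : X ^ e ≤ X ^ (e + 1) := Nat.pow_le_pow_right hX1 (by omega)
    have h8 : X ≤ X ^ (e + 1) := Nat.le_self_pow (by omega) X
    have h9 : 3 * ((C + 3) * (F + 1)) ^ (e + 1) * (n + 1) ^ ((c + 1) * (e + 1)) =
        3 * X ^ (e + 1) := by
      rw [hX, hY, mul_pow _ ((n + 1) ^ (c + 1)), ← pow_mul]
      ring
    rw [h9]
    omega

/-! ### Derived polynomial time functions -/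

section

variable {α : Type} [Ctx α]

theorem Ctx.Bdd.fst {p : α × ℕ} {n : ℕ} (h : Bdd p n) : Bdd p.1 n :=
  ⟨h.1, fun i => h.2 (some i)⟩

namespace PolyTime

variable {f g : α → ℕ}

theorem snd : PolyTime fun p : α × ℕ => p.2 := read (α := α × ℕ) none

/-- The program is unchanged; the stack of the additional number is never used. -/
theorem fst (hf : PolyTime f) : PolyTime fun p : α × ℕ => f p.1 := by
  obtain ⟨⟨q, hq, hfq⟩, hf⟩ := hf
  refine ⟨⟨q, hq, fun a n h => hfq _ _ h.fst⟩, fun loc d hd => ?_⟩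
  obtain ⟨P, p, hp, h⟩ := hf (fun i => loc (some i)) d ⟨hd.1, fun i => hd.2 (some i)⟩
  exact ⟨P, p, hp, fun a n s ha hs => h a.1 n s ha.fst
    ⟨hs.inp, hs.aux, fun i => hs.read (some i), hs.clean⟩⟩

theorem const (m : ℕ) : PolyTime fun _ : α => m := by
  induction m with
  | zero => exact zero
  | succ m ih => exact ih.succ

theorem add (hf : PolyTime f) (hg : PolyTime g) : PolyTime fun a => f a + g a := by
  obtain ⟨p, hp, hfp⟩ := hf.1
  obtain ⟨q, hq, hgq⟩ := hg.1
  refine bounded_recursion (fun a j => f a + j) hg hf (S := fun p => p.2 + 1) snd.succ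
    (hp.add hq) (fun a => rfl) (fun a j => rfl) fun a n j ha hj => ?_
  exact Nat.add_le_add (hfp a n ha) (hj.trans (hgq a n ha))

theorem sub (hf : PolyTime f) (hg : PolyTime g) : PolyTime fun a => f a - g a := by
  obtain ⟨p, hp, hfp⟩ := hf.1
  exact bounded_recursion (fun a j => f a - j) hg hf (S := fun p => p.2 - 1) snd.pred
    hp (fun a => rfl) (fun a j => rfl) fun a n j ha hj => (Nat.sub_le _ _).trans (hfp a n ha)

theorem mul (hf : PolyTime f) (hg : PolyTime g) : PolyTime fun a => f a * g a := by
  obtain ⟨p, hp, hfp⟩ := hf.1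
  obtain ⟨q, hq, hgq⟩ := hg.1
  refine bounded_recursion (fun a j => f a * j) hg zero (S := fun p => p.2 + f p.1.1)
    (snd.add hf.fst.fst) (hp.mul hq) (fun a => rfl) (fun a j => rfl) fun a n j ha hj => ?_
  exact Nat.mul_le_mul (hfp a n ha) (hj.trans (hgq a n ha))

theorem pow_const (hf : PolyTime f) (m : ℕ) : PolyTime fun a => f a ^ m := by
  induction m with
  | zero => simpa using const 1
  | succ m ih => simpa only [pow_succ] using ih.mul hf

theorem sum_range_const {F : ℕ → α → ℕ} (h : ∀ l, PolyTime (F l)) (m : ℕ) :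
    PolyTime fun a => ∑ l ∈ Finset.range m, F l a := by
  induction m with
  | zero => simpa using zero
  | succ m ih => simpa only [Finset.sum_range_succ] using ih.add (h m)

end PolyTime

open Classical in
/-- `p` can be decided in polynomial time, with all numbers in unary. -/
def PolyPred (p : α → Prop) : Prop := PolyTime fun a => if p a then 1 else 0

namespace PolyPred

variable {f g : α → ℕ} {p q : α → Prop}

theorem of_iff (hp : PolyPred p) (h : ∀ a, p a ↔ q a) : PolyPred q :=
  (funext fun a => propext (h a) : p = q) ▸ hp

theorem fst (hp : PolyPred p) : PolyPred fun a : α × ℕ => p a.1 := PolyTime.fst hp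

theorem le (hf : PolyTime f) (hg : PolyTime g) : PolyPred fun a => f a ≤ g a :=
  -- With truncated subtraction, `1 - (f a - g a)` is the indicator of `f a ≤ g a`.
  ((PolyTime.const 1).sub (hf.sub hg)).of_eq fun a => by split_ifs <;> omega

theorem lt (hf : PolyTime f) (hg : PolyTime g) : PolyPred fun a => f a < g a :=
  le hf.succ hg

theorem and (hp : PolyPred p) (hq : PolyPred q) : PolyPred fun a => p a ∧ q a :=
  (PolyTime.mul hp hq).of_eq fun a => by split_ifs <;> simp_all

theorem not (hp : PolyPred p) : PolyPred fun a => ¬ p a :=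
  ((PolyTime.const 1).sub hp).of_eq fun a => by split_ifs <;> simp_all

theorem or (hp : PolyPred p) (hq : PolyPred q) : PolyPred fun a => p a ∨ q a :=
  (hp.not.and hq.not).not.of_iff fun a => by tauto

theorem imp (hp : PolyPred p) (hq : PolyPred q) : PolyPred fun a => p a → q a :=
  (hp.not.or hq).of_iff fun a => by tauto

theorem eq (hf : PolyTime f) (hg : PolyTime g) : PolyPred fun a => f a = g a :=
  ((le hf hg).and (le hg hf)).of_iff fun a => by omega

theorem const (c : Prop) : PolyPred fun _ : α => c := by
  by_cases hc : c
  · exact (PolyTime.const 1).of_eq fun a => by simp [hc]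
  · exact (PolyTime.const 0).of_eq fun a => by simp [hc]

theorem forall_lt_const {P : ℕ → α → Prop} (h : ∀ l, PolyPred (P l)) (m : ℕ) :
    PolyPred fun a => ∀ l < m, P l a := by
  induction m with
  | zero => exact (const True).of_iff fun a => by simp
  | succ m ih =>
    refine (ih.and (h m)).of_iff fun a => ?_
    simp only [Nat.lt_succ_iff_lt_or_eq, or_imp, forall_and, forall_eq]

theorem exists_lt_const {P : ℕ → α → Prop} (h : ∀ l, PolyPred (P l)) (m : ℕ) :
    PolyPred fun a => ∃ l < m, P l a :=
  (forall_lt_const (fun l => (h l).not) m).not.of_iff fun a => by simp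

theorem bit (hf : PolyTime f) : PolyPred fun a => (Ctx.inp a)[f a]? = some true :=
  (PolyTime.bit hf).of_eq fun a => by split_ifs <;> rfl

end PolyPred

namespace PolyTime

variable {f g : α → ℕ} {p : α → Prop}

open Classical in
theorem ite (hp : PolyPred p) (hf : PolyTime f) (hg : PolyTime g) :
    PolyTime fun a => if p a then f a else g a :=
  ((PolyTime.mul hp hf).add (PolyTime.mul hp.not hg)).of_eq fun a => by split_ifs <;> simp_all

/-- The quotient is the number of `i < f a` with `(i + 1) * g a ≤ f a`, a sum of indicators built up
by bounded recursion. -/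
theorem div (hf : PolyTime f) (hg : PolyTime g) (h : ∀ a, 0 < g a) :
    PolyTime fun a => f a / g a := by
  classical
  obtain ⟨p, hp, hfp⟩ := hf.1
  refine of_eq (bounded_recursion
    (fun a j => ((Finset.range j).filter fun i => (i + 1) * g a ≤ f a).card) hf zero
    (S := fun p => p.2 + if (p.1.2 + 1) * g p.1.1 ≤ f p.1.1 then 1 else 0) ?_ hp (fun a => rfl)
    (fun a j => ?_) fun a n j ha hj => ?_) fun a => ?_
  · exact (snd.add (PolyPred.le (PolyTime.mul snd.fst.succ hg.fst.fst) hf.fst.fst)).of_eq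
      fun a => by congr
  · rw [Finset.range_add_one, Finset.filter_insert]
    split_ifs with hc
    · simp
    · simp
  · refine (Finset.card_filter_le _ _).trans ?_
    rw [Finset.card_range]
    exact hj.trans (hfp a n ha)
  · have : ((Finset.range (f a)).filter fun i => (i + 1) * g a ≤ f a) =
        Finset.range (f a / g a) := by
      ext i
      have h1 : i + 1 ≤ f a / g a ↔ (i + 1) * g a ≤ f a := Nat.le_div_iff_mul_le (h a)
      have h2 := Nat.div_le_self (f a) (g a)
      simp only [Finset.mem_filter, Finset.mem_range]
      rw [← h1]
      omega
    rw [this, Finset.card_range]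

theorem mod (hf : PolyTime f) (hg : PolyTime g) (h : ∀ a, 0 < g a) :
    PolyTime fun a => f a % g a :=
  (hf.sub (hg.mul (hf.div hg h))).of_eq fun a => by
    have := Nat.div_add_mod (f a) (g a)
    omega

end PolyTime

namespace PolyOut

theorem fst {g : α → List Bool} (hg : PolyOut g) : PolyOut fun p : α × ℕ => g p.1 := by
  obtain ⟨⟨q, hq, hgq⟩, hg⟩ := hg
  refine ⟨⟨q, hq, fun a n h => hgq _ _ h.fst⟩, fun loc d hd => ?_⟩
  obtain ⟨P, p, hp, h⟩ := hg (fun i => loc (some i)) d ⟨hd.1, fun i => hd.2 (some i)⟩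
  exact ⟨P, p, hp, fun a n s ha hs => h a.1 n s ha.fst
    ⟨hs.inp, hs.aux, fun i => hs.read (some i), hs.clean⟩⟩

theorem const (w : List Bool) : PolyOut fun _ : α => w := by
  induction w with
  | nil => exact nil
  | cons b w ih => exact (bit b).append ih

theorem replicate {f : α → ℕ} (hf : PolyTime f) (w : List Bool) :
    PolyOut fun a => (List.replicate (f a) w).flatten :=
  (flatMap_range hf (const w)).of_eq fun a => by
    generalize f a = n
    induction n with
    | zero => rfl
    | succ n ih => rw [List.range_succ, List.flatMap_append, ih, List.replicate_succ']; simp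

-- Each branch is written as many times as its indicator says, that is, once or not at all.
open Classical in
theorem ite {p : α → Prop} {g h : α → List Bool} (hp : PolyPred p) (hg : PolyOut g)
    (hh : PolyOut h) : PolyOut fun a => if p a then g a else h a :=
  ((flatMap_range hp hg.fst).append (flatMap_range hp.not hh.fst)).of_eq fun a => by
    split_ifs <;> simp_all

end PolyOut

end

/-! ### Reading a formula -/

/-- The state of an automaton that reads the code of a formula with a parameter. The `mode` tells
which part is being read: `0` the parameter, `1` the number of variables, `2` the mark in front of
a clause, `3` the mark in front of a literal, `4` the variable and `5` the sign of a literal. The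
other components are the variable of the literal, `1` or `0` according to whether all literals of
the clause read so far are false, `1` or `0` according to whether some clause read so far consists
of false literals, the parameter, and the number of variables. -/
structure Scan where
  mode : ℕ
  var : ℕ
  alive : ℕ
  found : ℕ
  weight : ℕ
  numVars : ℕ

namespace Scan

/-- The transitions of the mode. -/
def nextMode (m : ℕ) (b : Prop) [Decidable b] : ℕ :=
  if m = 0 then if b then 0 else 1
  else if m = 1 then if b then 1 else 2
  else if m = 2 then if b then 3 else 6
  else if m = 3 then if b then 4 else 2
  else if m = 4 then if b then 4 else 5
  else if m = 5 then 3
  else 6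

open Classical in
/-- The transitions; `D v b` says that the literal with variable `v` and sign `b` is false. -/
noncomputable def step (D : ℕ → Bool → Prop) (s : Scan) (b : Bool) : Scan where
  mode := nextMode s.mode (b = true)
  var := if s.mode = 4 then if b = true then s.var + 1 else s.var else 0
  alive := if s.mode = 2 then 1 else if s.mode = 5 then
    if (b = true → D s.var true) ∧ (¬ b = true → D s.var false) then s.alive else 0 else s.alive
  found := if s.mode = 3 ∧ ¬ b = true ∧ s.alive = 1 then 1 else s.found
  weight := if s.mode = 0 ∧ b = true then s.weight + 1 else s.weight
  numVars := if s.mode = 1 ∧ b = true then s.numVars + 1 else s.numVars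

/-- The states of the automaton on the input `x`. -/
noncomputable def seq (D : ℕ → Bool → Prop) (x : List Bool) : ℕ → Scan
  | 0 => ⟨0, 0, 0, 0, 0, 0⟩
  | j + 1 => step D (seq D x j) (decide (x[j]? = some true))

/-- Access by position suits bounded recursion, while the fold splits along concatenation and so can
be evaluated on codes. -/
theorem seq_eq_foldl (D : ℕ → Bool → Prop) (x : List Bool) {j : ℕ} (hj : j ≤ x.length) :
    seq D x j = (x.take j).foldl (step D) ⟨0, 0, 0, 0, 0, 0⟩ := by
  induction j with
  | zero => rfl
  | succ j ih =>
    have hj' : j < x.length := hj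
    rw [seq, ih hj'.le, List.take_succ_eq_append_getElem hj', List.foldl_append]
    congr
    simp [List.getElem?_eq_getElem hj']

theorem seq_length (D : ℕ → Bool → Prop) (x : List Bool) :
    seq D x x.length = x.foldl (step D) ⟨0, 0, 0, 0, 0, 0⟩ := by
  rw [seq_eq_foldl D x le_rfl, List.take_length]

variable (D : ℕ → Bool → Prop)

theorem foldl_encNat_weight (m : ℕ) (s : Scan) (h : s.mode = 0) :
    (encNat m).foldl (step D) s = ⟨1, 0, s.alive, s.found, s.weight + m, s.numVars⟩ := by
  induction m generalizing s with
  | zero => simp [encNat, step, nextMode, h]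
  | succ m ih =>
    rw [show encNat (m + 1) = true :: encNat m by simp [encNat, List.replicate_succ],
      List.foldl_cons, ih _ (by simp [step, nextMode, h])]
    simp [step, h]
    omega

theorem foldl_encNat_numVars (m : ℕ) (s : Scan) (h : s.mode = 1) :
    (encNat m).foldl (step D) s = ⟨2, 0, s.alive, s.found, s.weight, s.numVars + m⟩ := by
  induction m generalizing s with
  | zero => simp [encNat, step, nextMode, h]
  | succ m ih =>
    rw [show encNat (m + 1) = true :: encNat m by simp [encNat, List.replicate_succ],
      List.foldl_cons, ih _ (by simp [step, nextMode, h])]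
    simp [step, h]
    omega

theorem foldl_encNat_var (m : ℕ) (s : Scan) (h : s.mode = 4) :
    (encNat m).foldl (step D) s =
      ⟨5, s.var + m, s.alive, s.found, s.weight, s.numVars⟩ := by
  induction m generalizing s with
  | zero => simp [encNat, step, nextMode, h]
  | succ m ih =>
    rw [show encNat (m + 1) = true :: encNat m by simp [encNat, List.replicate_succ],
      List.foldl_cons, ih _ (by simp [step, nextMode, h])]
    simp [step, h]
    omega

variable {n : ℕ}

-- The value `al` left in `alive` is of no account, because the mark in front of the next clause
-- resets it to `1`.
open Classical in
theorem foldl_clause (C : List (Fin n × Bool)) (s : Scan) (h : s.mode = 3) (hv : s.var = 0) :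
    ∃ al, (encList CNFFormula.encLiteral C).foldl (step D) s =
      ⟨2, 0, al, if s.alive = 1 ∧ ∀ l ∈ C, D l.1.val l.2 then 1 else s.found,
        s.weight, s.numVars⟩ := by
  induction C generalizing s with
  | nil => simp [encList, step, nextMode, h]
  | cons l C ih =>
    obtain ⟨v, b⟩ := l
    have e : (encList CNFFormula.encLiteral ((v, b) :: C)).foldl (step D) s =
        (encList CNFFormula.encLiteral C).foldl (step D)
          ⟨3, 0, if D v.val b then s.alive else 0, s.found, s.weight, s.numVars⟩ := by
      simp only [encList, CNFFormula.encLiteral, encFin, List.foldl_cons, List.foldl_append,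
        List.foldl_nil]
      rw [foldl_encNat_var D _ _ (by simp [step, nextMode, h])]
      congr 1
      cases b <;> simp [step, nextMode, h]
    obtain ⟨al, h1⟩ := ih ⟨3, 0, if D v.val b then s.alive else 0, s.found, s.weight, s.numVars⟩
      rfl rfl
    refine ⟨al, ?_⟩
    rw [e, h1]
    congr 2
    by_cases hD : D v.val b <;> simp [hD]

open Classical in
theorem foldl_clauses (Cs : List (List (Fin n × Bool))) (s : Scan) (h : s.mode = 2) :
    ((encList (encList CNFFormula.encLiteral) Cs).foldl (step D) s).found =
      (if ∃ C ∈ Cs, ∀ l ∈ C, D l.1.val l.2 then 1 else s.found) ∧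
    ((encList (encList CNFFormula.encLiteral) Cs).foldl (step D) s).weight = s.weight ∧
    ((encList (encList CNFFormula.encLiteral) Cs).foldl (step D) s).numVars = s.numVars := by
  induction Cs generalizing s with
  | nil => simp [encList, step, h]
  | cons C Cs ih =>
    simp only [encList, List.foldl_cons, List.foldl_append]
    obtain ⟨al, h1⟩ := foldl_clause D C (step D s true) (by simp [step, nextMode, h])
      (by simp [step, h])
    rw [h1]
    obtain ⟨h2, h3, h4⟩ := ih ⟨2, 0, al, if (step D s true).alive = 1 ∧ ∀ l ∈ C, D l.1.val l.2
      then 1 else (step D s true).found, (step D s true).weight, (step D s true).numVars⟩ rfl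
    rw [h2, h3, h4]
    refine ⟨?_, by simp [step, h], by simp [step, h]⟩
    by_cases h5 : ∃ C ∈ Cs, ∀ l ∈ C, D l.1.val l.2
    · have h7 : ∃ C' ∈ C :: Cs, ∀ l ∈ C', D l.1.val l.2 := by
        obtain ⟨C', h8, h9⟩ := h5
        exact ⟨C', List.mem_cons_of_mem _ h8, h9⟩
      rw [if_pos h5, if_pos h7]
    · by_cases h6 : ∀ l ∈ C, D l.1.val l.2
      · have h7 : ∃ C' ∈ C :: Cs, ∀ l ∈ C', D l.1.val l.2 := ⟨C, by simp, h6⟩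
        rw [if_pos h7, if_neg h5, if_pos ⟨by simp [step, h], h6⟩]
      · have h7 : ¬ ∃ C' ∈ C :: Cs, ∀ l ∈ C', D l.1.val l.2 := by
          rintro ⟨C', h8, h9⟩
          rcases List.mem_cons.1 h8 with rfl | h8
          · exact h6 h9
          · exact h5 ⟨C', h8, h9⟩
        rw [if_neg h7, if_neg h5, if_neg fun h => h6 h.2]
        simp [step, h]

end Scan

/-- The final state of the automaton. -/
noncomputable def Scan.final (D : ℕ → Bool → Prop) (x : List Bool) : Scan := Scan.seq D x x.length

section

variable (φ : CNFFormula) (k : ℕ) (D : ℕ → Bool → Prop)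

open Classical in
theorem Scan.final_code :
    (Scan.final D (encNat k ++ φ.enc)).found =
      (if ∃ C ∈ φ.clauses, ∀ l ∈ C, D l.1.val l.2 then 1 else 0) ∧
    (Scan.final D (encNat k ++ φ.enc)).weight = k ∧
    (Scan.final D (encNat k ++ φ.enc)).numVars = φ.numVars := by
  rw [Scan.final, Scan.seq_length, CNFFormula.enc, List.foldl_append, List.foldl_append,
    Scan.foldl_encNat_weight D k _ rfl, Scan.foldl_encNat_numVars D φ.numVars _ rfl]
  simpa using Scan.foldl_clauses D φ.clauses ⟨2, 0, 0, 0, 0 + k, 0 + φ.numVars⟩ rfl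

end

/-! ### The automaton in polynomial time -/

section

variable {α β : Type} [Ctx α] [Ctx β]

theorem PolyTime.reindex {f : α → ℕ} (hf : PolyTime f) (φ : β → α) (ι : Idx α → Idx β)
    (hi : ∀ b, Ctx.inp (φ b) = Ctx.inp b) (hr : ∀ b i, Ctx.read (φ b) i = Ctx.read b (ι i)) :
    PolyTime fun b => f (φ b) := by
  obtain ⟨⟨q, hq, hfq⟩, hf⟩ := hf
  have hb : ∀ b n, Bdd b n → Bdd (φ b) n := fun b n h =>
    ⟨by rw [hi]; exact h.1, fun i => by rw [hr]; exact h.2 _⟩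
  refine ⟨⟨q, hq, fun a n h => hfq _ _ (hb _ _ h)⟩, fun loc d hd => ?_⟩
  obtain ⟨P, p, hp, h⟩ := hf (fun i => loc (ι i)) d ⟨hd.1, fun i => hd.2 (ι i)⟩
  exact ⟨P, p, hp, fun a n s ha hs => h (φ a) n s (hb _ _ ha)
    ⟨by rw [hi, hs.inp], hs.aux, fun i => by rw [hr, hs.read], hs.clean⟩⟩

/-- Substitution is a degenerate recursion: run for `g a + 1` rounds a step that forgets the
previous value and returns `F (a, j)`. The last round has `j = g a`. -/
theorem PolyTime.comp_pair {F : α × ℕ → ℕ} {g : α → ℕ} (hF : PolyTime F) (hg : PolyTime g) :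
    PolyTime fun a => F (a, g a) := by
  obtain ⟨p, hp, hFp⟩ := hF.1
  obtain ⟨q, hq, hgq⟩ := hg.1
  refine of_eq (bounded_recursion (fun a j => if j = 0 then 0 else F (a, j - 1)) hg.succ zero
    hF.fst (hp.comp (PolyBounded.id.add hq)) (fun a => by simp) (fun a j => by simp)
    fun a n j ha hj => ?_) fun a => by simp
  split_ifs with h0
  · exact Nat.zero_le _
  · have := hgq a n ha
    exact hFp _ _ ((ha.mono (by omega)).pair (by omega))

/-- `D` can be decided in polynomial time. -/
def PolyLit (D : α → ℕ → Bool → Prop) : Prop :=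
  ∀ b, PolyPred fun p : α × ℕ => D p.1 p.2 b

theorem PolyLit.fst {D : α → ℕ → Bool → Prop} (hD : PolyLit D) :
    PolyLit fun p : α × ℕ => D p.1 := fun b =>
  PolyTime.reindex (β := (α × ℕ) × ℕ) (hD b) (fun p => (p.1.1, p.2))
    (fun i => i.elim none fun i => some (some i)) (fun _ => rfl) fun _ i => by cases i <;> rfl

theorem PolyLit.comp {D : α → ℕ → Bool → Prop} (hD : PolyLit D) {v : α → ℕ} (hv : PolyTime v)
    (b : Bool) : PolyPred fun a => D a (v a) b := PolyTime.comp_pair (hD b) hv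

theorem PolyTime.nextMode {m : α → ℕ} {b : α → Prop} [∀ a, Decidable (b a)] (hm : PolyTime m)
    (hb : PolyPred b) : PolyTime fun a => Scan.nextMode (m a) (b a) :=
  (ite (.eq hm (const 0)) (ite hb (const 0) (const 1)) <|
    ite (.eq hm (const 1)) (ite hb (const 1) (const 2)) <|
    ite (.eq hm (const 2)) (ite hb (const 3) (const 6)) <|
    ite (.eq hm (const 3)) (ite hb (const 4) (const 2)) <|
    ite (.eq hm (const 4)) (ite hb (const 4) (const 5)) <|
    ite (.eq hm (const 5)) (const 3) (const 6)).of_eq fun a => by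
      unfold Scan.nextMode
      congr

namespace Scan

theorem nextMode_le (m : ℕ) (b : Prop) [Decidable b] : nextMode m b ≤ 6 := by
  unfold nextMode
  split_ifs <;> omega

theorem seq_le (D : ℕ → Bool → Prop) (x : List Bool) (j : ℕ) :
    (seq D x j).mode ≤ 6 ∧ (seq D x j).var ≤ j ∧ (seq D x j).alive ≤ 1 ∧
      (seq D x j).found ≤ 1 ∧ (seq D x j).weight ≤ j ∧ (seq D x j).numVars ≤ j := by
  induction j with
  | zero => simp [seq]
  | succ j ih =>
    obtain ⟨h1, h2, h3, h4, h5, h6⟩ := ih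
    refine ⟨nextMode_le _ _, ?_, ?_, ?_, ?_, ?_⟩ <;> simp only [seq, step] <;> split_ifs <;> omega

variable {D : α → ℕ → Bool → Prop} {j : α → ℕ}

/-- Bounded recursion handles single numbers, not records. This is enough because the components are
triangular: `mode` depends only on itself and the bit read, and each other component on itself, the
bit read and components treated before it. -/
theorem polyTime_mode (hj : PolyTime j) :
    PolyTime fun a => (seq (D a) (Ctx.inp a) (j a)).mode := by
  refine PolyTime.bounded_recursion (fun a i => (seq (D a) (Ctx.inp a) i).mode) hj .zero
    (S := fun q => nextMode q.2 ((Ctx.inp q)[q.1.2]? = some true)) ?_ (.const 6)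
    (fun a => rfl) (fun a j => ?_) fun a n i _ _ => (seq_le _ _ _).1
  · exact PolyTime.snd.nextMode (.bit PolyTime.snd.fst)
  · simp only [seq, step, decide_eq_true_eq]
    rfl

theorem polyTime_var (hj : PolyTime j) :
    PolyTime fun a => (seq (D a) (Ctx.inp a) (j a)).var := by
  obtain ⟨q, hq, hjq⟩ := hj.1
  refine PolyTime.bounded_recursion (fun a i => (seq (D a) (Ctx.inp a) i).var) hj .zero
    (.ite (.eq (PolyTime.fst (polyTime_mode (D := fun p : α × ℕ => D p.1) .snd)) (.const 4))
      (.ite (.bit PolyTime.snd.fst) (PolyTime.snd.succ) .snd) .zero) hq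
    (fun a => rfl) (fun a j => ?_) fun a n i ha hi =>
      (seq_le _ _ _).2.1.trans (hi.trans (hjq a n ha))
  simp only [seq, step, decide_eq_true_eq, Ctx.inp]

theorem polyTime_alive (hD : PolyLit D) (hj : PolyTime j) :
    PolyTime fun a => (seq (D a) (Ctx.inp a) (j a)).alive := by
  have hm := polyTime_mode (D := fun p : α × ℕ => D p.1) .snd
  have hv := polyTime_var (D := fun p : α × ℕ => D p.1) .snd
  have hb : PolyPred fun p : α × ℕ => (Ctx.inp p)[p.2]? = some true := .bit .snd
  refine PolyTime.bounded_recursion (fun a i => (seq (D a) (Ctx.inp a) i).alive) hj .zero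
    (.ite (.eq hm.fst (.const 2)) (.const 1) (.ite (.eq hm.fst (.const 5))
      (.ite (PolyPred.fst ((hb.imp (hD.fst.comp hv true)).and
        (hb.not.imp (hD.fst.comp hv false)))) .snd .zero) .snd)) (.const 1)
    (fun a => rfl) (fun a j => ?_) fun a n i ha hi => (seq_le _ _ _).2.2.1
  simp only [seq, step, decide_eq_true_eq, Ctx.inp]
  split_ifs <;> first | rfl | simp_all

theorem polyTime_found (hD : PolyLit D) (hj : PolyTime j) :
    PolyTime fun a => (seq (D a) (Ctx.inp a) (j a)).found := by
  have hm := polyTime_mode (D := fun p : α × ℕ => D p.1) .snd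
  have ha := polyTime_alive hD.fst .snd
  have hb : PolyPred fun p : α × ℕ => (Ctx.inp p)[p.2]? = some true := .bit .snd
  refine PolyTime.bounded_recursion (fun a i => (seq (D a) (Ctx.inp a) i).found) hj .zero
    (.ite (PolyPred.fst ((PolyPred.eq hm (.const 3)).and (hb.not.and (.eq ha (.const 1)))))
      (.const 1) .snd) (.const 1)
    (fun a => rfl) (fun a j => ?_) fun a n i ha hi => (seq_le _ _ _).2.2.2.1
  simp only [seq, step, decide_eq_true_eq, Ctx.inp]

theorem polyTime_weight (hj : PolyTime j) :
    PolyTime fun a => (seq (D a) (Ctx.inp a) (j a)).weight := by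
  obtain ⟨q, hq, hjq⟩ := hj.1
  have hm := polyTime_mode (D := fun p : α × ℕ => D p.1) .snd
  have hb : PolyPred fun p : α × ℕ => (Ctx.inp p)[p.2]? = some true := .bit .snd
  refine PolyTime.bounded_recursion (fun a i => (seq (D a) (Ctx.inp a) i).weight) hj .zero
    (.ite (PolyPred.fst ((PolyPred.eq hm (.const 0)).and hb)) PolyTime.snd.succ .snd) hq
    (fun a => rfl) (fun a j => ?_) fun a n i ha hi =>
      (seq_le _ _ _).2.2.2.2.1.trans (hi.trans (hjq a n ha))
  simp only [seq, step, decide_eq_true_eq, Ctx.inp]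

theorem polyTime_numVars (hj : PolyTime j) :
    PolyTime fun a => (seq (D a) (Ctx.inp a) (j a)).numVars := by
  obtain ⟨q, hq, hjq⟩ := hj.1
  have hm := polyTime_mode (D := fun p : α × ℕ => D p.1) .snd
  have hb : PolyPred fun p : α × ℕ => (Ctx.inp p)[p.2]? = some true := .bit .snd
  refine PolyTime.bounded_recursion (fun a i => (seq (D a) (Ctx.inp a) i).numVars) hj .zero
    (.ite (PolyPred.fst ((PolyPred.eq hm (.const 1)).and hb)) PolyTime.snd.succ .snd) hq
    (fun a => rfl) (fun a j => ?_) fun a n i ha hi =>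
      (seq_le _ _ _).2.2.2.2.2.trans (hi.trans (hjq a n ha))
  simp only [seq, step, decide_eq_true_eq, Ctx.inp]

end Scan

end

/-! ### Planning instances that choose tuples of elements -/

/-- A system of constraints: `elts` elements, `tuples` tuples of `len + 1` elements each, some of
which are good, and `cons` constraints, each tuple belonging to one of them. -/
structure TupleSystem where
  elts : ℕ
  tuples : ℕ
  cons : ℕ
  len : ℕ
  elt : ℕ → ℕ → ℕ
  con : ℕ → ℕ
  good : ℕ → Prop
  elt_lt : ∀ j c, elt j c < elts
  con_lt : ∀ c, con c < cons

namespace TupleSystem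

/-- The value of a binary variable. -/
def val (b : Bool) : Fin 2 := if b then 1 else 0

/-- The action with precondition `1` on the variable `m.1` (none, if there is no such variable)
that sets the variable `m.2.1` to `m.2.2`. -/
def act (N : ℕ) (m : ℕ × ℕ × Bool) : SASAction N 2 where
  pre u := if u.val = m.1 then some 1 else none
  eff u := if u.val = m.2.1 then some (val m.2.2) else none

variable (G : TupleSystem)

/-- The variable that belongs to position `j` of the tuple `c`. -/
def tupleVar (j c : ℕ) : ℕ := G.elts + (j * G.tuples + c)

/-- The variable that belongs to a constraint. -/
def conVar (i : ℕ) : ℕ := G.elts + ((G.len + 1) * G.tuples + i)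

/-- The number of variables. -/
def numVars : ℕ := G.elts + ((G.len + 1) * G.tuples + G.cons)

open Classical in
/-- The actions. An element can be switched on. The variables of a good tuple can be switched on one
after the other, the last of them allows to switch on its constraint, and they can be switched off
if the elements of the tuple are switched on. -/
noncomputable def moves : List (ℕ × ℕ × Bool) :=
  (List.range G.elts).map (fun e => (G.numVars, e, true)) ++
  (List.range G.tuples).flatMap fun c =>
    (if G.good c then [(G.numVars, G.tupleVar 0 c, true)] else []) ++
    ((List.range G.len).map (fun j => (G.tupleVar j c, G.tupleVar (j + 1) c, true)) ++
    ((List.range (G.len + 1)).map (fun j => (G.elt j c, G.tupleVar j c, false)) ++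
    [(G.tupleVar G.len c, G.conVar (G.con c), true)]))

/-- The list of actions. -/
noncomputable def acts : List (SASAction G.numVars 2) := G.moves.map (act G.numVars)

/-- The planning instance: initially everything is switched off; in the end the constraints have to
be switched on and the variables of tuples off. -/
noncomputable def instance_ : SASInstance where
  numVars := G.numVars
  domSize := 2
  acts := G.acts
  init _ := 0
  goal u := if u.val < G.elts then none else
    if u.val < G.elts + (G.len + 1) * G.tuples then some 0 else some 1

theorem mem_moves {m : ℕ × ℕ × Bool} : m ∈ G.moves ↔
    (∃ e < G.elts, m = (G.numVars, e, true)) ∨ ∃ c < G.tuples,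
      (G.good c ∧ m = (G.numVars, G.tupleVar 0 c, true)) ∨
      (∃ j < G.len, m = (G.tupleVar j c, G.tupleVar (j + 1) c, true)) ∨
      (∃ j < G.len + 1, m = (G.elt j c, G.tupleVar j c, false)) ∨
      m = (G.tupleVar G.len c, G.conVar (G.con c), true) := by
  simp only [moves, List.mem_append, List.mem_map, List.mem_range, List.mem_flatMap,
    List.mem_ite_nil_right, List.mem_singleton]
  simp only [eq_comm (a := m)]

variable {G}

theorem tupleVar_lt {j c : ℕ} (hj : j < G.len + 1) (hc : c < G.tuples) :
    G.tupleVar j c < G.elts + (G.len + 1) * G.tuples := by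
  have := Nat.mul_le_mul_right G.tuples (show j + 1 ≤ G.len + 1 from hj)
  rw [Nat.succ_mul] at this
  unfold tupleVar
  omega

theorem tupleVar_inj {j c j' c' : ℕ} (hc : c < G.tuples) (hc' : c' < G.tuples)
    (h : G.tupleVar j c = G.tupleVar j' c') : j = j' ∧ c = c' := by
  unfold tupleVar at h
  have h0 : j * G.tuples + c = j' * G.tuples + c' := by omega
  have hp : 0 < G.tuples := by omega
  have h1 : (j * G.tuples + c) / G.tuples = j := by
    rw [Nat.mul_comm, Nat.mul_add_div hp, Nat.div_eq_of_lt hc, Nat.add_zero]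
  have h2 : (j' * G.tuples + c') / G.tuples = j' := by
    rw [Nat.mul_comm, Nat.mul_add_div hp, Nat.div_eq_of_lt hc', Nat.add_zero]
  have h3 : j = j' := by rw [← h1, ← h2, h0]
  subst h3
  omega

theorem move_lt {m : ℕ × ℕ × Bool} (hm : m ∈ G.moves) : m.2.1 < G.numVars := by
  have hN : G.elts + (G.len + 1) * G.tuples ≤ G.numVars := by unfold numVars; omega
  rcases G.mem_moves.1 hm with ⟨e, he, rfl⟩ | ⟨c, hc, ⟨-, rfl⟩ | ⟨j, hj, rfl⟩ | ⟨j, hj, rfl⟩ | rfl⟩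
  · exact (he.trans_le (Nat.le_add_right _ _))
  · exact (tupleVar_lt (Nat.succ_pos _) hc).trans_le hN
  · exact (tupleVar_lt (by omega) hc).trans_le hN
  · exact (tupleVar_lt hj hc).trans_le hN
  · have := G.con_lt c
    simp only [conVar, numVars]
    omega

/-! #### Plans -/

section Plan

open SASInstance

variable {N : ℕ} {acts : List (SASAction N 2)} {s t : TotalState N 2}

theorem result_act (m : ℕ × ℕ × Bool) (s : TotalState N 2) (u : Fin N) :
    (act N m).result s u = if u.val = m.2.1 then val m.2.2 else s u := by
  unfold SASAction.result act
  dsimp only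
  split_ifs <;> rfl

/-- This and the next two lemmas extract all the information on the order of a plan that is needed
later; afterwards only the set of effects that occur in it matters. -/
theorem exists_move_of_ne {μ : List (ℕ × ℕ × Bool)} (h : IsPlanFrom acts s (μ.map (act N)) t)
    {u : Fin N} (hu : s u ≠ t u) : ∃ m ∈ μ, m.2.1 = u.val ∧ val m.2.2 = t u := by
  induction μ generalizing s with
  | nil => exact absurd (congrFun h u) hu
  | cons m μ ih =>
    obtain ⟨-, -, h⟩ := h
    by_cases h1 : (act N m).result s u = t u
    · rw [result_act] at h1
      split_ifs at h1 with h2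
      · exact ⟨m, by simp, h2.symm, h1⟩
      · exact absurd h1 hu
    · obtain ⟨m', hm', h2⟩ := ih h h1
      exact ⟨m', List.mem_cons_of_mem _ hm', h2⟩

theorem exists_move_of_pre {μ : List (ℕ × ℕ × Bool)} (h : IsPlanFrom acts s (μ.map (act N)) t)
    {u : Fin N} (hu : s u = 0) {m : ℕ × ℕ × Bool} (hm : m ∈ μ) (hmu : m.1 = u.val) :
    ∃ m' ∈ μ, m'.2.1 = u.val ∧ m'.2.2 = true := by
  induction μ generalizing s with
  | nil => simp at hm
  | cons m₀ μ ih =>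
    obtain ⟨-, hv, h⟩ := h
    rcases List.mem_cons.1 hm with rfl | hm
    · have := hv u
      simp [act, hmu, hu] at this
    · by_cases h1 : (act N m₀).result s u = 0
      · obtain ⟨m', hm', h2⟩ := ih h h1 hm
        exact ⟨m', List.mem_cons_of_mem _ hm', h2⟩
      · rw [result_act] at h1
        split_ifs at h1 with h2
        · refine ⟨m₀, by simp, h2.symm, ?_⟩
          by_contra h3
          simp [val, h3] at h1
        · exact absurd hu h1

theorem exists_move_of_eff {μ : List (ℕ × ℕ × Bool)} (h : IsPlanFrom acts s (μ.map (act N)) t)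
    {u : Fin N} {m : ℕ × ℕ × Bool} (hm : m ∈ μ) (hmu : m.2.1 = u.val) (hne : val m.2.2 ≠ t u) :
    ∃ m' ∈ μ, m'.2.1 = u.val ∧ val m'.2.2 = t u := by
  induction μ generalizing s with
  | nil => simp at hm
  | cons m₀ μ ih =>
    obtain ⟨-, -, h⟩ := h
    rcases List.mem_cons.1 hm with rfl | hm
    · obtain ⟨m', hm', h2⟩ := exists_move_of_ne h (u := u) (by rwa [result_act, if_pos hmu.symm])
      exact ⟨m', List.mem_cons_of_mem _ hm', h2⟩
    · obtain ⟨m', hm', h2⟩ := ih h hm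
      exact ⟨m', List.mem_cons_of_mem _ hm', h2⟩

theorem mem_of_isPlanFrom {n d : ℕ} {acts : List (SASAction n d)} {s t : TotalState n d}
    {ω : List (SASAction n d)} (h : IsPlanFrom acts s ω t) : ∀ a ∈ ω, a ∈ acts := by
  induction ω generalizing s with
  | nil => simp
  | cons a ω ih =>
    intro b hb
    rcases List.mem_cons.1 hb with rfl | hb
    · exact h.1
    · exact ih h.2.2 b hb

theorem isPlanFrom_append {n d : ℕ} {acts : List (SASAction n d)} {s t u : TotalState n d}
    {ω ω' : List (SASAction n d)} (h : IsPlanFrom acts s ω t) (h' : IsPlanFrom acts t ω' u) :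
    IsPlanFrom acts s (ω ++ ω') u := by
  induction ω generalizing s with
  | nil =>
    cases h
    exact h'
  | cons a ω ih => exact ⟨h.1, h.2.1, ih h.2.2⟩

open Classical in
/-- The state in which exactly the variables in `S` are switched on. -/
noncomputable def state (N : ℕ) (S : Set ℕ) : TotalState N 2 := fun u => if u.val ∈ S then 1 else 0

theorem isPlanFrom_single {m : ℕ × ℕ × Bool} {S S' : Set ℕ} (hm : act N m ∈ acts)
    (hp : m.1 < N → m.1 ∈ S) (hS : S' = if m.2.2 then insert m.2.1 S else S \ {m.2.1}) :
    IsPlanFrom acts (state N S) [act N m] (state N S') := by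
  refine ⟨hm, fun u => ?_, ?_⟩
  · by_cases h : u.val = m.1
    · left
      have := hp (h ▸ u.isLt)
      simp [act, state, h, this]
    · right
      simp [act, h]
  · change (act N m).result (state N S) = _
    funext u
    rw [result_act, hS]
    obtain ⟨p, w, b⟩ := m
    simp only [state]
    cases b
    · simp only [Bool.false_eq_true, if_false, Set.mem_sdiff, Set.mem_singleton_iff, val]
      by_cases h : u.val = w <;> by_cases h' : u.val ∈ S <;> simp [h, h']
    · simp only [if_true, Set.mem_insert_iff, val]
      by_cases h : u.val = w <;> by_cases h' : u.val ∈ S <;> simp [h, h']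

/-- Iterating moves that change the set of variables that are switched on. -/
theorem isPlanFrom_iterate {μ : ℕ → List (SASAction N 2)} {S : ℕ → Set ℕ} {n : ℕ}
    (h : ∀ i < n, IsPlanFrom acts (state N (S i)) (μ i) (state N (S (i + 1)))) :
    IsPlanFrom acts (state N (S 0)) ((List.range n).flatMap μ) (state N (S n)) := by
  induction n with
  | zero => rfl
  | succ n ih =>
    rw [List.range_succ, List.flatMap_append]
    exact isPlanFrom_append (ih fun i hi => h i (by omega)) (by simpa using h n (by omega))

end Plan

/-! ### From chosen elements to plans and back -/

open SASInstance

/-- The actions that use the tuple `c` to switch on its constraint. -/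
noncomputable def tuplePlan (G : TupleSystem) (c : ℕ) : List (SASAction G.numVars 2) :=
  ([act G.numVars (G.numVars, G.tupleVar 0 c, true)] ++
    (List.range G.len).flatMap fun j =>
      [act G.numVars (G.tupleVar j c, G.tupleVar (j + 1) c, true)]) ++
  ([act G.numVars (G.tupleVar G.len c, G.conVar (G.con c), true)] ++
    (List.range (G.len + 1)).flatMap fun j =>
      [act G.numVars (G.elt j c, G.tupleVar j c, false)])

theorem length_flatMap_single {γ : Type} (n : ℕ) (f : ℕ → γ) :
    ((List.range n).flatMap fun j => [f j]).length = n := by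
  simp [List.length_flatMap]

theorem length_tuplePlan (c : ℕ) : (G.tuplePlan c).length = 2 * (G.len + 1) + 1 := by
  simp only [tuplePlan, List.length_append, length_flatMap_single, List.length_singleton]
  omega

theorem isPlanFrom_tuplePlan {c : ℕ} (hc : c < G.tuples) (hg : G.good c) {S : Set ℕ}
    (hS : ∀ j < G.len + 1, G.elt j c ∈ S) (hT : ∀ j < G.len + 1, G.tupleVar j c ∉ S) :
    IsPlanFrom G.acts (state G.numVars S) (G.tuplePlan c)
      (state G.numVars (insert (G.conVar (G.con c)) S)) := by
  have hmem : ∀ m, m ∈ G.moves → act G.numVars m ∈ G.acts := fun m hm =>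
    List.mem_map_of_mem hm
  -- `U j` is what is on after positions `0, …, j` of the row have been switched on, and `W j` what
  -- is on after the constraint has been switched on and the first `j` positions off again.
  let U : ℕ → Set ℕ := fun j => S ∪ {u | ∃ i < j + 1, u = G.tupleVar i c}
  let W : ℕ → Set ℕ := fun j => insert (G.conVar (G.con c)) (U G.len) \
    {u | ∃ i < j, u = G.tupleVar i c}
  have h1 : IsPlanFrom G.acts (state G.numVars S)
      [act G.numVars (G.numVars, G.tupleVar 0 c, true)] (state G.numVars (U 0)) := by
    refine isPlanFrom_single (hmem _ (G.mem_moves.2 (Or.inr ⟨c, hc, Or.inl ⟨hg, rfl⟩⟩)))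
      (fun h => absurd h (lt_irrefl _)) ?_
    ext u
    simp [U, or_comm]
  have h2 : IsPlanFrom G.acts (state G.numVars (U 0))
      ((List.range G.len).flatMap fun j =>
        [act G.numVars (G.tupleVar j c, G.tupleVar (j + 1) c, true)])
      (state G.numVars (U G.len)) := by
    refine isPlanFrom_iterate fun j hj => isPlanFrom_single (hmem _ (G.mem_moves.2
      (Or.inr ⟨c, hc, Or.inr (Or.inl ⟨j, hj, rfl⟩)⟩)))
      (fun _ => Or.inr ⟨j, by omega, rfl⟩) ?_
    ext u
    simp only [U, Set.mem_union, Set.mem_ofPred_eq, if_true, Set.mem_insert_iff]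
    constructor
    · rintro (h | ⟨i, hi, rfl⟩)
      · exact Or.inr (Or.inl h)
      · rcases Nat.lt_succ_iff_lt_or_eq.1 hi with h | rfl
        · exact Or.inr (Or.inr ⟨i, h, rfl⟩)
        · exact Or.inl rfl
    · rintro (rfl | h | ⟨i, hi, rfl⟩)
      · exact Or.inr ⟨j + 1, by omega, rfl⟩
      · exact Or.inl h
      · exact Or.inr ⟨i, by omega, rfl⟩
  have h3 : IsPlanFrom G.acts (state G.numVars (U G.len))
      [act G.numVars (G.tupleVar G.len c, G.conVar (G.con c), true)]
      (state G.numVars (W 0)) := by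
    refine isPlanFrom_single (hmem _ (G.mem_moves.2 (Or.inr ⟨c, hc, Or.inr (Or.inr (Or.inr
      rfl))⟩))) (fun _ => Or.inr ⟨G.len, by omega, rfl⟩) ?_
    simp [W]
  have h4 : IsPlanFrom G.acts (state G.numVars (W 0))
      ((List.range (G.len + 1)).flatMap fun j =>
        [act G.numVars (G.elt j c, G.tupleVar j c, false)])
      (state G.numVars (W (G.len + 1))) := by
    refine isPlanFrom_iterate fun j hj => isPlanFrom_single (hmem _ (G.mem_moves.2
      (Or.inr ⟨c, hc, Or.inr (Or.inr (Or.inl ⟨j, hj, rfl⟩))⟩)))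
      (fun _ => ⟨Or.inr (Or.inl (hS j hj)), ?_⟩) ?_
    -- The element stays on during the cleaning up because elements and row variables have different
    -- numbers.
    · rintro ⟨i, -, hi⟩
      have := G.elt_lt j c
      simp only [tupleVar] at hi
      omega
    · ext u
      simp only [W, Set.mem_sdiff, Set.mem_ofPred_eq, Bool.false_eq_true, if_false,
        Set.mem_singleton_iff]
      constructor
      · rintro ⟨h, h'⟩
        exact ⟨⟨h, fun ⟨i, hi, e⟩ => h' ⟨i, by omega, e⟩⟩, fun e => h' ⟨j, by omega, e⟩⟩
      · rintro ⟨⟨h, h'⟩, h''⟩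
        refine ⟨h, fun ⟨i, hi, e⟩ => ?_⟩
        rcases Nat.lt_succ_iff_lt_or_eq.1 hi with hi | rfl
        · exact h' ⟨i, hi, e⟩
        · exact h'' e
  have h5 : W (G.len + 1) = insert (G.conVar (G.con c)) S := by
    ext u
    simp only [W, U, Set.mem_sdiff, Set.mem_ofPred_eq, Set.mem_insert_iff, Set.mem_union]
    constructor
    · rintro ⟨h | h | h, h'⟩
      · exact Or.inl h
      · exact Or.inr h
      · exact absurd h h'
    · rintro (rfl | h)
      · refine ⟨Or.inl rfl, ?_⟩
        rintro ⟨i, hi, e⟩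
        have := tupleVar_lt hi hc
        simp only [conVar] at e
        omega
      · refine ⟨Or.inr (Or.inl h), ?_⟩
        rintro ⟨i, hi, rfl⟩
        exact hT i hi h
  rw [h5] at h4
  exact isPlanFrom_append (isPlanFrom_append h1 h2) (isPlanFrom_append h3 h4)

/-- The plan that belongs to a set of elements which contains a tuple for every constraint. -/
theorem exists_plan {X : Finset ℕ} (hX : ∀ e ∈ X, e < G.elts)
    (h : ∀ i < G.cons, ∃ c < G.tuples, G.good c ∧ G.con c = i ∧ ∀ j < G.len + 1, G.elt j c ∈ X) :
    ∃ ω, G.instance_.IsPlan ω ∧ ω.length ≤ X.card + G.cons * (2 * (G.len + 1) + 1) := by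
  choose! c hc hg hcon hel using h
  have hx : ∀ l : List ℕ, (∀ e ∈ l, e < G.elts) → IsPlanFrom G.acts
      (state G.numVars ∅) (l.map fun e => act G.numVars (G.numVars, e, true))
      (state G.numVars {e | e ∈ l}) := by
    intro l
    induction l using List.reverseRecOn with
    | nil =>
      intro _
      simp only [List.map_nil, IsPlanFrom]
      congr 1
      ext
      simp
    | append_singleton l e ih =>
      intro hl
      rw [List.map_append]
      refine isPlanFrom_append (ih fun e he => hl e (by simp [he])) (isPlanFrom_single
        (List.mem_map_of_mem (G.mem_moves.2 (Or.inl ⟨e, hl e (by simp), rfl⟩)))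
        (fun h => absurd h (lt_irrefl _)) ?_)
      ext u
      simp [or_comm]
  have h1 := hx X.toList fun e he => hX e (by simpa using he)
  -- Between two constraints all rows are off: what is on are the elements of `X` and the
  -- constraints treated so far.
  let S : ℕ → Set ℕ := fun i => {u | u ∈ X ∨ ∃ i' < i, u = G.conVar i'}
  have h2 : IsPlanFrom G.acts (state G.numVars (S 0))
      ((List.range G.cons).flatMap fun i => G.tuplePlan (c i)) (state G.numVars (S G.cons)) := by
    refine isPlanFrom_iterate fun i hi => ?_
    have h3 := isPlanFrom_tuplePlan (hc i hi) (hg i hi) (S := S i)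
      (fun j hj => Or.inl (hel i hi j hj)) ?_
    · have h4 : S (i + 1) = insert (G.conVar (G.con (c i))) (S i) := ?_
      · rw [h4]
        exact h3
      ext u
      simp only [S, Set.mem_ofPred_eq, Set.mem_insert_iff, hcon i hi]
      constructor
      · rintro (h | ⟨i', hi', rfl⟩)
        · exact Or.inr (Or.inl h)
        · rcases Nat.lt_succ_iff_lt_or_eq.1 hi' with h | rfl
          · exact Or.inr (Or.inr ⟨i', h, rfl⟩)
          · exact Or.inl rfl
      · rintro (rfl | h | ⟨i', hi', rfl⟩)
        · exact Or.inr ⟨i, by omega, rfl⟩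
        · exact Or.inl h
        · exact Or.inr ⟨i', by omega, rfl⟩
    · rintro j hj (h | ⟨i', -, e⟩)
      · have := hX _ h
        unfold tupleVar at this
        omega
      · have := tupleVar_lt hj (hc i hi)
        simp only [conVar] at e
        omega
  have h3 : {e | e ∈ X.toList} = S 0 := by
    ext u
    simp [S]
  rw [h3] at h1
  refine ⟨X.toList.map (fun e => act G.numVars (G.numVars, e, true)) ++
    (List.range G.cons).flatMap fun i => G.tuplePlan (c i), ⟨state G.numVars (S G.cons), fun u => ?_, ?_⟩, ?_⟩
  · by_cases hu : u.val < G.elts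
    · exact Or.inr (if_pos hu)
    · left
      by_cases hu' : u.val < G.elts + (G.len + 1) * G.tuples
      · have : u.val ∉ S G.cons := by
          rintro (h | ⟨i', -, e⟩)
          · exact hu (hX _ h)
          · simp only [conVar] at e
            omega
        change (if u.val < G.elts then none else _) = _
        rw [if_neg hu, if_pos hu']
        exact congrArg some (if_neg this).symm
      · have hu2 : u.val < G.elts + ((G.len + 1) * G.tuples + G.cons) := u.isLt
        have : u.val ∈ S G.cons :=
          Or.inr ⟨u.val - (G.elts + (G.len + 1) * G.tuples), by omega, by
            simp only [conVar]; omega⟩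
        change (if u.val < G.elts then none else _) = _
        rw [if_neg hu, if_neg hu']
        exact congrArg some (if_pos this).symm
  · have h4 : state G.numVars ∅ = fun _ => 0 := by
      funext u
      simp [state]
    have h5 := isPlanFrom_append h1 h2
    rw [h4] at h5
    exact h5
  · change List.length (α := SASAction G.numVars 2) _ ≤ _
    simp [List.length_flatMap, length_tuplePlan]

theorem exists_moves_of_plan {ω : List (SASAction G.numVars 2)}
    (h : ∀ a ∈ ω, a ∈ G.acts) :
    ∃ μ : List (ℕ × ℕ × Bool), (∀ m ∈ μ, m ∈ G.moves) ∧ ω = μ.map (act G.numVars) := by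
  induction ω with
  | nil => exact ⟨[], by simp, rfl⟩
  | cons a ω ih =>
    obtain ⟨μ, h1, rfl⟩ := ih fun b hb => h b (List.mem_cons_of_mem _ hb)
    obtain ⟨m, hm, rfl⟩ := List.mem_map.1 (h a (by simp))
    refine ⟨m :: μ, fun m' hm' => ?_, rfl⟩
    rcases List.mem_cons.1 hm' with rfl | hm'
    · exact hm
    · exact h1 _ hm'

/-- A short plan yields a small set of elements which contains a tuple for every constraint. -/
theorem exists_elements {ω : List (SASAction G.numVars 2)} (hω : G.instance_.IsPlan ω) :
    ∃ X : Finset ℕ, X.card + G.cons * (2 * (G.len + 1) + 1) ≤ ω.length ∧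
      ∀ i < G.cons, ∃ c < G.tuples, G.good c ∧ G.con c = i ∧ ∀ j < G.len + 1, G.elt j c ∈ X := by
  obtain ⟨(t : TotalState G.numVars 2), ht, (hplan : IsPlanFrom G.acts (fun _ => 0) ω t)⟩ := hω
  obtain ⟨μ, hμ, rfl⟩ := exists_moves_of_plan (mem_of_isPlanFrom hplan)
  -- `K` collects the effects that occur in the plan, as pairs of a variable and its new value. Its
  -- cardinality is at most the length of the plan, so a lower bound follows by exhibiting different
  -- members of `K`.
  let K : Finset (ℕ × Bool) := (μ.map Prod.snd).toFinset
  have hK : ∀ {w b}, (w, b) ∈ K ↔ ∃ p, (p, w, b) ∈ μ := by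
    intro w b
    simp [K]
  have hpre : ∀ {p w b}, (p, w, b) ∈ μ → p < G.numVars → (p, true) ∈ K := by
    intro p w b hm hp
    obtain ⟨⟨p', w', b'⟩, hm', h1, h2⟩ := exists_move_of_pre hplan (u := ⟨p, hp⟩) rfl hm rfl
    dsimp only at h1 h2
    subst h1 h2
    exact hK.2 ⟨p', hm'⟩
  have hN : G.elts + (G.len + 1) * G.tuples ≤ G.numVars := by unfold numVars; omega
  -- switched on constraints
  have hcon : ∀ i < G.cons, (G.conVar i, true) ∈ K := by
    intro i hi
    have hlt : G.conVar i < G.numVars := by unfold conVar numVars; omega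
    have h1 : t ⟨G.conVar i, hlt⟩ = 1 := by
      have : G.instance_.goal ⟨G.conVar i, hlt⟩ = some (t ⟨G.conVar i, hlt⟩) ∨
        G.instance_.goal ⟨G.conVar i, hlt⟩ = none := ht ⟨G.conVar i, hlt⟩
      have e1 : ¬ G.conVar i < G.elts := by unfold conVar; omega
      have e2 : ¬ G.conVar i < G.elts + (G.len + 1) * G.tuples := by unfold conVar; omega
      have e3 : G.instance_.goal ⟨G.conVar i, hlt⟩ = some (1 : Fin 2) := by
        change (if G.conVar i < G.elts then none else _) = _
        rw [if_neg e1, if_neg e2]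
      rw [e3] at this
      rcases this with this | this
      · exact (Option.some.inj this).symm
      · cases this
    obtain ⟨⟨p, w, b⟩, hm, h2, h3⟩ := exists_move_of_ne hplan (u := ⟨G.conVar i, hlt⟩)
      (by rw [h1]; decide)
    dsimp only at h2 h3
    subst h2
    rw [h1] at h3
    cases b with
    | false => exact absurd h3 (by decide)
    | true => exact hK.2 ⟨p, hm⟩
  -- switched on variables of tuples are switched off, so that the elements are switched on
  have hoff : ∀ j < G.len + 1, ∀ c < G.tuples, (G.tupleVar j c, true) ∈ K →
      (G.tupleVar j c, false) ∈ K ∧ (G.elt j c, true) ∈ K := by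
    intro j hj c hc h
    have hlt : G.tupleVar j c < G.elts + (G.len + 1) * G.tuples := tupleVar_lt hj hc
    have hlt' := hlt.trans_le hN
    have h1 : t ⟨G.tupleVar j c, hlt'⟩ = 0 := by
      have : G.instance_.goal ⟨G.tupleVar j c, hlt'⟩ = some (t ⟨G.tupleVar j c, hlt'⟩) ∨
        G.instance_.goal ⟨G.tupleVar j c, hlt'⟩ = none := ht ⟨G.tupleVar j c, hlt'⟩
      have e1 : ¬ G.tupleVar j c < G.elts := by unfold tupleVar; omega
      have e3 : G.instance_.goal ⟨G.tupleVar j c, hlt'⟩ = some (0 : Fin 2) := by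
        change (if G.tupleVar j c < G.elts then none else _) = _
        rw [if_neg e1, if_pos hlt]
      rw [e3] at this
      rcases this with this | this
      · exact (Option.some.inj this).symm
      · cases this
    obtain ⟨p, hm⟩ := hK.1 h
    obtain ⟨⟨p', w, b⟩, hm', h2, h3⟩ := exists_move_of_eff hplan (u := ⟨G.tupleVar j c, hlt'⟩)
      hm rfl (by rw [h1]; exact one_ne_zero)
    dsimp only at h2 h3
    subst h2
    rw [h1] at h3
    cases b with
    | true => exact absurd h3 (by decide)
    | false =>
      refine ⟨hK.2 ⟨p', hm'⟩, ?_⟩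
      rcases G.mem_moves.1 (hμ _ hm') with ⟨e, _, he⟩ | ⟨c', hc', ⟨-, he⟩ | ⟨i, _, he⟩ |
        ⟨i, hi, he⟩ | he⟩ <;> simp only [Prod.mk.injEq, Bool.false_eq_true, and_false] at he
      obtain ⟨rfl, he, -⟩ := he
      obtain ⟨rfl, rfl⟩ := tupleVar_inj hc hc' he
      exact hpre hm' ((G.elt_lt _ _).trans_le (by unfold numVars; omega))
  -- A position of a row can be switched on only through the position before it, and the first one
  -- only for good tuples; so one descends along the row.
  have hback : ∀ j < G.len + 1, ∀ c < G.tuples, (G.tupleVar j c, true) ∈ K →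
      G.good c ∧ ∀ i < j + 1, (G.tupleVar i c, true) ∈ K := by
    intro j
    induction j with
    | zero =>
      intro _ c hc h
      refine ⟨?_, fun i hi => by rwa [show i = 0 by omega]⟩
      obtain ⟨p, hm⟩ := hK.1 h
      have hlt := tupleVar_lt (j := 0) (Nat.succ_pos G.len) hc
      rcases G.mem_moves.1 (hμ _ hm) with ⟨e, hlt', he⟩ | ⟨c', hc', ⟨hg, he⟩ | ⟨i, _, he⟩ |
        ⟨i, hi, he⟩ | he⟩ <;> simp only [Prod.mk.injEq, Bool.true_eq_false, and_false] at he
      · have := he.2.1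
        unfold tupleVar at this
        omega
      · obtain ⟨-, rfl⟩ := tupleVar_inj hc hc' he.2.1
        exact hg
      · have := (tupleVar_inj hc hc' he.2.1).1
        omega
      · have := he.2.1
        unfold conVar at this
        omega
    | succ j ih =>
      intro hj c hc h
      obtain ⟨p, hm⟩ := hK.1 h
      have hlt := tupleVar_lt hj hc
      have hp : (G.tupleVar j c, true) ∈ K := by
        rcases G.mem_moves.1 (hμ _ hm) with ⟨e, hlt', he⟩ | ⟨c', hc', ⟨hg, he⟩ | ⟨i, _, he⟩ |
          ⟨i, hi, he⟩ | he⟩ <;> simp only [Prod.mk.injEq, Bool.true_eq_false, and_false] at he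
        · have := he.2.1
          unfold tupleVar at this
          omega
        · have := (tupleVar_inj hc hc' he.2.1).1
          omega
        · obtain ⟨h1, rfl⟩ := tupleVar_inj hc hc' he.2.1
          obtain rfl : j = i := by omega
          obtain ⟨rfl, -⟩ := he
          exact hpre hm ((tupleVar_lt (by omega) hc).trans_le hN)
        · have := he.2.1
          unfold conVar at this
          omega
      obtain ⟨hg, hi⟩ := ih (by omega) c hc hp
      refine ⟨hg, fun i hi' => ?_⟩
      rcases Nat.lt_succ_iff_lt_or_eq.1 hi' with h1 | rfl
      · exact hi i h1
      · exact h
  -- The only moves with effect on a constraint have the last variable of a row belonging to it as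
  -- precondition.
  have htup : ∀ i < G.cons, ∃ c < G.tuples, G.con c = i ∧ (G.tupleVar G.len c, true) ∈ K := by
    intro i hi
    obtain ⟨p, hm⟩ := hK.1 (hcon i hi)
    rcases G.mem_moves.1 (hμ _ hm) with ⟨e, hlt', he⟩ | ⟨c', hc', ⟨hg, he⟩ | ⟨j, hj, he⟩ |
      ⟨j, hj, he⟩ | he⟩ <;> simp only [Prod.mk.injEq, Bool.true_eq_false, and_false] at he
    · have := he.2.1
      unfold conVar at this
      omega
    · have := tupleVar_lt (j := 0) (Nat.succ_pos G.len) hc'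
      have := he.2.1
      unfold conVar at this
      omega
    · have := tupleVar_lt (j := j + 1) (by omega) hc'
      have := he.2.1
      unfold conVar at this
      omega
    · obtain ⟨rfl, he, -⟩ := he
      refine ⟨c', hc', ?_, hpre hm ((tupleVar_lt (by omega) hc').trans_le hN)⟩
      unfold conVar at he
      omega
  choose! c hc hci hcK using htup
  have hall : ∀ i < G.cons, G.good (c i) ∧ ∀ j < G.len + 1, (G.tupleVar j (c i), true) ∈ K :=
    fun i hi => hback G.len (by omega) (c i) (hc i hi) (hcK i hi)
  let X : Finset ℕ := (Finset.range G.elts).filter fun e => (e, true) ∈ K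
  refine ⟨X, ?_, fun i hi => ⟨c i, hc i hi, (hall i hi).1, hci i hi, fun j hj => ?_⟩⟩
  -- Four disjoint families in `K`: elements on (`A`), constraints on (`Z`), row variables of the
  -- selected tuples on and off (`Y true`, `Y false`). They have `X.card`, `G.cons`, and twice
  -- `G.cons * (G.len + 1)` members.
  · let Y : Bool → Finset (ℕ × Bool) := fun b =>
      (Finset.range G.cons ×ˢ Finset.range (G.len + 1)).image fun p => (G.tupleVar p.2 (c p.1), b)
    let A : Finset (ℕ × Bool) := X.image fun e => (e, true)
    let Z : Finset (ℕ × Bool) := (Finset.range G.cons).image fun i => (G.conVar i, true)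
    have hY : ∀ b, (Y b).card = G.cons * (G.len + 1) := by
      intro b
      rw [Finset.card_image_of_injOn, Finset.card_product, Finset.card_range, Finset.card_range]
      rintro ⟨i, j⟩ hij ⟨i', j'⟩ hij' h
      simp only [Finset.coe_product, Finset.coe_range, Set.mem_prod, Set.mem_Iio] at hij hij'
      simp only [Prod.mk.injEq, and_true] at h
      obtain ⟨rfl, h1⟩ := tupleVar_inj (hc i hij.1) (hc i' hij'.1) h
      -- Different constraints have different selected tuples, as `G.con` recovers `i` from `c i`.
      rw [← hci i hij.1, ← hci i' hij'.1, h1]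
    have hA : A.card = X.card := Finset.card_image_of_injective _ fun a b h => by simpa using h
    have hZ : Z.card = G.cons := by
      rw [Finset.card_image_of_injective, Finset.card_range]
      intro a b h
      simp only [Prod.mk.injEq, conVar, and_true] at h
      omega
    have hYlt : ∀ {w b b'}, (w, b) ∈ Y b' →
        b = b' ∧ G.elts ≤ w ∧ w < G.elts + (G.len + 1) * G.tuples := by
      intro w b b' h
      simp only [Y, Finset.mem_image, Finset.mem_product, Finset.mem_range, Prod.mk.injEq] at h
      obtain ⟨⟨i, j⟩, ⟨hi, hj⟩, rfl, rfl⟩ := h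
      refine ⟨rfl, ?_, tupleVar_lt hj (hc i hi)⟩
      unfold tupleVar
      omega
    have hAlt : ∀ {w b}, (w, b) ∈ A → w < G.elts := by
      intro w b h
      simp only [A, X, Finset.mem_image, Finset.mem_filter, Finset.mem_range, Prod.mk.injEq] at h
      obtain ⟨e, ⟨he, -⟩, rfl, -⟩ := h
      exact he
    have hZlt : ∀ {w b}, (w, b) ∈ Z → G.elts + (G.len + 1) * G.tuples ≤ w := by
      intro w b h
      simp only [Z, Finset.mem_image, Finset.mem_range, Prod.mk.injEq] at h
      obtain ⟨i, -, rfl, -⟩ := h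
      unfold conVar
      omega
    have hd1 : Disjoint A Z := Finset.disjoint_left.2 fun ⟨w, b⟩ h h' => by
      have := hAlt h
      have := hZlt h'
      omega
    have hd2 : Disjoint (Y true) (Y false) := Finset.disjoint_left.2 fun ⟨w, b⟩ h h' => by
      have := (hYlt h).1
      have := (hYlt h').1
      simp_all
    have hd3 : Disjoint (A ∪ Z) (Y true ∪ Y false) := Finset.disjoint_left.2 fun ⟨w, b⟩ h h' => by
      have h1 : G.elts ≤ w ∧ w < G.elts + (G.len + 1) * G.tuples := by
        rcases Finset.mem_union.1 h' with h' | h' <;> exact (hYlt h').2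
      rcases Finset.mem_union.1 h with h | h
      · have := hAlt h
        omega
      · have := hZlt h
        omega
    have hsub : (A ∪ Z) ∪ (Y true ∪ Y false) ⊆ K := by
      refine Finset.union_subset (Finset.union_subset ?_ ?_) (Finset.union_subset ?_ ?_)
      · intro x hx
        obtain ⟨e, he, rfl⟩ := Finset.mem_image.1 hx
        exact (Finset.mem_filter.1 he).2
      · intro x hx
        obtain ⟨i, hi, rfl⟩ := Finset.mem_image.1 hx
        exact hcon i (Finset.mem_range.1 hi)
      · intro x hx
        obtain ⟨⟨i, j⟩, hij, rfl⟩ := Finset.mem_image.1 hx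
        simp only [Finset.mem_product, Finset.mem_range] at hij
        exact (hall i hij.1).2 j hij.2
      · intro x hx
        obtain ⟨⟨i, j⟩, hij, rfl⟩ := Finset.mem_image.1 hx
        simp only [Finset.mem_product, Finset.mem_range] at hij
        exact (hoff j hij.2 (c i) (hc i hij.1) ((hall i hij.1).2 j hij.2)).1
    have h1 := Finset.card_le_card hsub
    rw [Finset.card_union_of_disjoint hd3, Finset.card_union_of_disjoint hd1,
      Finset.card_union_of_disjoint hd2, hA, hZ, hY, hY] at h1
    have h2 : K.card ≤ μ.length := by
      simpa using (μ.map Prod.snd).toFinset_card_le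
    have h3 : G.cons * (2 * (G.len + 1) + 1) =
        G.cons + (G.cons * (G.len + 1) + G.cons * (G.len + 1)) := by ring
    rw [List.length_map]
    omega
  · exact Finset.mem_filter.2 ⟨Finset.mem_range.2 (G.elt_lt _ _),
      (hoff j hj (c i) (hc i hi) ((hall i hi).2 j hj)).2⟩

/-! #### Restrictions -/

theorem restrictionU : G.instance_.RestrictionU := by
  intro a ha
  obtain ⟨m, hm, rfl⟩ := List.mem_map.1 ha
  refine ⟨⟨m.2.1, move_lt hm⟩, ?_, fun u hu => ?_⟩
  · exact ne_of_eq_of_ne (if_pos rfl) (Option.some_ne_none _)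
  · ext
    by_contra h
    exact hu (if_neg h)

theorem restrictionB : G.instance_.RestrictionB := rfl

/-- All preconditions have the value `1`, so two of them on the same variable agree, whatever the
effects are. -/
theorem restrictionS : G.instance_.RestrictionS := by
  intro a ha b hb v hav hbv _ _
  obtain ⟨m, -, rfl⟩ := List.mem_map.1 ha
  obtain ⟨m', -, rfl⟩ := List.mem_map.1 hb
  have h1 : v.val = m.1 := by
    by_contra h
    exact hav (if_neg h)
  have h2 : v.val = m'.1 := by
    by_contra h
    exact hbv (if_neg h)
  exact (if_pos h1).trans (if_pos h2).symm

theorem numPre_le_one {a : SASAction G.numVars 2} (ha : a ∈ G.instance_.acts) : a.numPre ≤ 1 := by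
  obtain ⟨m, -, rfl⟩ := List.mem_map.1 ha
  refine Finset.card_le_one.2 fun u hu v hv => ?_
  simp [act] at hu hv
  exact Fin.ext (hu.trans hv.symm)

theorem numEff_le_one {a : SASAction G.numVars 2} (ha : a ∈ G.instance_.acts) : a.numEff ≤ 1 := by
  obtain ⟨m, -, rfl⟩ := List.mem_map.1 ha
  refine Finset.card_le_one.2 fun u hu v hv => ?_
  simp [act] at hu hv
  exact Fin.ext (hu.trans hv.symm)

end TupleSystem

/-! ### Weighted satisfiability as a tuple system -/

/-- Vectors are coded by their digits, in base `elts n k` for tuples of gaps and in base `k + 1` for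
vectors of indices. The digit facts are read off from `finFunctionFinEquiv`. -/
theorem Nat.sum_digits_lt {m : ℕ} (r : ℕ) {d : ℕ → ℕ} (hd : ∀ j, d j < m) :
    ∑ j ∈ Finset.range r, d j * m ^ j < m ^ r := by
  have := (finFunctionFinEquiv fun j : Fin r => (⟨d j, hd j⟩ : Fin m)).isLt
  rwa [finFunctionFinEquiv_apply, ← Finset.sum_range fun j => d j * m ^ j] at this

theorem Nat.sum_digits_div_mod {m r : ℕ} {d : ℕ → ℕ} (hd : ∀ j, d j < m) {j : ℕ} (hj : j < r) :
    (∑ j ∈ Finset.range r, d j * m ^ j) / m ^ j % m = d j := by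
  have h := congrArg Fin.val (congrFun (finFunctionFinEquiv.symm_apply_apply
    fun j : Fin r => (⟨d j, hd j⟩ : Fin m)) ⟨j, hj⟩)
  rwa [finFunctionFinEquiv_symm_apply_val, finFunctionFinEquiv_apply,
    ← Finset.sum_range fun j => d j * m ^ j] at h

theorem Nat.sum_div_mod_mul_pow {m r i : ℕ} (hi : i < m ^ r) :
    ∑ j ∈ Finset.range r, i / m ^ j % m * m ^ j = i := by
  have h := congrArg Fin.val (finFunctionFinEquiv.apply_symm_apply (⟨i, hi⟩ : Fin (m ^ r)))
  rw [finFunctionFinEquiv_apply] at h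
  simp only [finFunctionFinEquiv_symm_apply_val] at h
  rwa [Finset.sum_range fun j => i / m ^ j % m * m ^ j]

namespace WeightedSat

/-! An assignment of weight `k` to `n` variables is viewed as a sequence
`0 = a₀ < a₁ < ⋯ < aₖ₊₁ = n + 1`, where `a₁, …, aₖ` are the successors of the true variables. An
element is a number that encodes a gap `(i, aᵢ, aᵢ₊₁)` of such a sequence. -/

/-- The number of elements. -/
def elts (n k : ℕ) : ℕ := (k + 1) * (n + 2) ^ 2

/-- The index of a gap. -/
def pos (n e : ℕ) : ℕ := e / (n + 2) ^ 2

/-- The lower end of a gap. -/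
def lo (n e : ℕ) : ℕ := e / (n + 2) % (n + 2)

/-- The upper end of a gap. -/
def hi (n e : ℕ) : ℕ := e % (n + 2)

/-- The gap with given index and ends. -/
def gap (n i a b : ℕ) : ℕ := i * (n + 2) ^ 2 + (a * (n + 2) + b)

/-- The entry `j` of the tuple `c`. -/
def entry (n k j c : ℕ) : ℕ := c / elts n k ^ j % elts n k

/-- The constraint of a tuple of length `r`: it determines the indices of its entries. -/
def con (n k r c : ℕ) : ℕ := ∑ j ∈ Finset.range r, pos n (entry n k j c) * (k + 1) ^ j

/-- The gaps in the tuple `c` fit together. -/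
def Consistent (n k r c : ℕ) : Prop :=
  (∀ j < r, lo n (entry n k j c) < hi n (entry n k j c) ∧
    (pos n (entry n k j c) = 0 → lo n (entry n k j c) = 0) ∧
    (pos n (entry n k j c) = k → hi n (entry n k j c) = n + 1)) ∧
  ∀ j < r, ∀ j' < r, pos n (entry n k j' c) = pos n (entry n k j c) + 1 →
    hi n (entry n k j c) = lo n (entry n k j' c)

/-- The gaps in the tuple `c` show that the literal `(v, b)` is false. -/
def Falsifies (n k r c v : ℕ) (b : Bool) : Prop :=
  if b = true then ∃ j < r, lo n (entry n k j c) < v + 1 ∧ v + 1 < hi n (entry n k j c)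
  else ∃ j < r, lo n (entry n k j c) = v + 1

/-! ### Arithmetic of the numbering of gaps -/

theorem elts_pos (n k : ℕ) : 0 < elts n k := by
  unfold elts
  positivity

theorem pos_lt {n k e : ℕ} (h : e < elts n k) : pos n e < k + 1 :=
  Nat.div_lt_of_lt_mul (by rwa [mul_comm])

theorem entry_lt (n k j c : ℕ) : entry n k j c < elts n k := Nat.mod_lt _ (elts_pos n k)

theorem gap_ends_lt {n a b : ℕ} (ha : a < n + 2) (hb : b < n + 2) :
    a * (n + 2) + b < (n + 2) ^ 2 := by
  nlinarith

theorem pos_gap {n i a b : ℕ} (ha : a < n + 2) (hb : b < n + 2) : pos n (gap n i a b) = i := by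
  rw [pos, gap, mul_comm i, Nat.mul_add_div (by positivity), Nat.div_eq_of_lt (gap_ends_lt ha hb),
    add_zero]

theorem gap_lt {n k i a b : ℕ} (hi : i < k + 1) (ha : a < n + 2) (hb : b < n + 2) :
    gap n i a b < elts n k := by
  have h1 := gap_ends_lt ha hb
  have h2 := Nat.mul_le_mul_right ((n + 2) ^ 2) (show i + 1 ≤ k + 1 from hi)
  rw [Nat.succ_mul] at h2
  unfold gap elts
  omega

theorem gap_eq (n i a b : ℕ) : gap n i a b = (n + 2) * (i * (n + 2) + a) + b := by
  unfold gap
  ring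

theorem lo_gap {n i a b : ℕ} (ha : a < n + 2) (hb : b < n + 2) : lo n (gap n i a b) = a := by
  rw [lo, gap_eq, Nat.mul_add_div (by positivity), Nat.div_eq_of_lt hb, add_zero,
    Nat.mul_add_mod_self_right, Nat.mod_eq_of_lt ha]

theorem hi_gap {n i a b : ℕ} (hb : b < n + 2) : hi n (gap n i a b) = b := by
  rw [hi, gap_eq, Nat.mul_add_mod, Nat.mod_eq_of_lt hb]

/-- The tuples of gaps that fit together and do not have the property `F`. -/
def tupleSystem (q n k : ℕ) (F : ℕ → Prop) : TupleSystem where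
  elts := elts n k
  tuples := elts n k ^ (q + 2)
  cons := (k + 1) ^ (q + 2)
  -- Tuples have `q + 2` entries: enough to witness that all of up to `q` literals are false, and
  -- never fewer than the two needed to compare neighbouring gaps.
  len := q + 1
  elt := entry n k
  con := con n k (q + 2)
  good c := Consistent n k (q + 2) c ∧ ¬ F c
  elt_lt := entry_lt _ _
  con_lt _ := Nat.sum_digits_lt _ fun _ => pos_lt (entry_lt _ _ _ _)

/-- The tuple system of a formula whose clauses have at most `q` literals. -/
def system (q k : ℕ) (φ : CNFFormula) : TupleSystem :=
  tupleSystem q φ.numVars k fun c =>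
    ∃ C ∈ φ.clauses, ∀ l ∈ C, Falsifies φ.numVars k (q + 2) c l.1.val l.2

/-! ### Small sets of gaps versus assignments of weight `k` -/

variable {q k : ℕ} {φ : CNFFormula}

/-- Since `X` has at most `k + 1` members and must contain a gap `E i` for each index `i`, it has no
others. The tuple that meets the constraint of a vector `I` is therefore `E ∘ I`, so goodness of `E
∘ I` is available for any `I`. Suitable vectors give the chain conditions and exclude a violated
clause. -/
theorem exists_assignment (hq : ∀ C ∈ φ.clauses, C.length ≤ q) {X : Finset ℕ}
    (hX : X.card ≤ k + 1)
    (h : ∀ i < (k + 1) ^ (q + 2), ∃ c < (system q k φ).tuples, (system q k φ).good c ∧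
      (system q k φ).con c = i ∧ ∀ j < q + 2, entry φ.numVars k j c ∈ X) :
    ∃ τ, φ.SatisfiedBy τ ∧ CNFFormula.weight τ = k := by
  set n := φ.numVars with hn
  have h1 : ∀ I : ℕ → ℕ, (∀ j, I j < k + 1) → ∃ c, (system q k φ).good c ∧
      ∀ j < q + 2, entry n k j c ∈ X ∧ pos n (entry n k j c) = I j := by
    intro I hI
    obtain ⟨c, -, hg, hc, hcX⟩ := h _ (Nat.sum_digits_lt (q + 2) hI)
    refine ⟨c, hg, fun j hj => ⟨hcX j hj, ?_⟩⟩
    rw [← Nat.sum_digits_div_mod hI hj, ← hc]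
    exact (Nat.sum_digits_div_mod (fun j => pos_lt (entry_lt n k j c)) hj).symm
  have h2 : ∀ i < k + 1, ∃ e ∈ X, pos n e = i := by
    intro i hi
    obtain ⟨c, -, hc⟩ := h1 (fun _ => i) fun _ => hi
    exact ⟨_, hc 0 (by omega)⟩
  choose! E hEX hE using h2
  have hX' : (Finset.range (k + 1)).image E = X := by
    refine Finset.eq_of_subset_of_card_le ?_ ?_
    · intro e he
      obtain ⟨i, hi, rfl⟩ := Finset.mem_image.1 he
      exact hEX i (Finset.mem_range.1 hi)
    · rw [Finset.card_image_of_injOn, Finset.card_range]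
      · exact hX
      · intro i hi j hj hij
        rw [← hE i (by simpa using hi), ← hE j (by simpa using hj)]
        exact congrArg _ hij
  have h3 : ∀ I : ℕ → ℕ, (∀ j, I j < k + 1) → ∃ c, (system q k φ).good c ∧
      ∀ j < q + 2, entry n k j c = E (I j) := by
    intro I hI
    obtain ⟨c, hg, hc⟩ := h1 I hI
    refine ⟨c, hg, fun j hj => ?_⟩
    obtain ⟨hjX, hj'⟩ := hc j hj
    rw [← hX'] at hjX
    obtain ⟨i, hi, he⟩ := Finset.mem_image.1 hjX
    rw [← he, hE i (Finset.mem_range.1 hi)] at hj'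
    rw [← he, hj']
  have hlt : ∀ i < k + 1, lo n (E i) < hi n (E i) ∧ (i = 0 → lo n (E i) = 0) ∧
      (i = k → hi n (E i) = n + 1) := by
    intro i hi
    obtain ⟨c, ⟨⟨hg, -⟩, -⟩, hc⟩ := h3 (fun _ => i) fun _ => hi
    have := hg 0 (by omega)
    rwa [← hn, hc 0 (by omega), hE i hi] at this
  have hsucc : ∀ i < k, hi n (E i) = lo n (E (i + 1)) := by
    intro i hi
    -- The vector starts with `i, i + 1`, so that goodness compares two neighbouring gaps.
    obtain ⟨c, ⟨⟨-, hg⟩, -⟩, hc⟩ := h3 (fun j => if j = 0 then i else i + 1) (by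
      intro j
      split_ifs <;> omega)
    have h0 : entry n k 0 c = E i := hc 0 (by omega)
    have h1 : entry n k 1 c = E (i + 1) := hc 1 (by omega)
    have := hg 0 (by omega) 1 (by omega)
    rw [← hn, h0, h1, hE _ (by omega), hE _ (by omega)] at this
    exact this rfl
  have hmono : ∀ i j, i < j → j < k + 1 → lo n (E i) < lo n (E j) := by
    intro i j hij
    induction j, hij using Nat.le_induction with
    | base =>
      intro hj
      rw [← hsucc i (by omega)]
      exact (hlt i (by omega)).1
    | succ j hij ih =>
      intro hj
      refine (ih (by omega)).trans ?_
      rw [← hsucc j (by omega)]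
      exact (hlt j (by omega)).1
  have hhi : ∀ e, hi n e < n + 2 := fun e => Nat.mod_lt _ (by omega)
  have hle : ∀ i < k + 1, lo n (E i) < n + 1 := by
    intro i hi
    have := (hlt i hi).1
    have := hhi (E i)
    omega
  classical
  -- The lower ends of the gaps `1, …, k` are the inner members `a₁, …, aₖ` of the chain; gap `0`
  -- starts at `0` and stands for no variable.
  let τ : Fin n → Bool := fun v => decide (∃ i < k, lo n (E (i + 1)) = v.val + 1)
  refine ⟨τ, fun C hC => ?_, ?_⟩
  · by_contra hfalse
    push Not at hfalse
    have h4 : ∀ l : Fin n × Bool, τ l.1 ≠ l.2 → ∃ i < k + 1,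
        if l.2 = true then lo n (E i) < l.1.val + 1 ∧ l.1.val + 1 < hi n (E i)
        else lo n (E i) = l.1.val + 1 := by
      rintro ⟨v, b⟩ hl
      cases b with
      | false =>
        have h5 : τ v = true := by simpa using hl
        obtain ⟨i, hi, h6⟩ := of_decide_eq_true h5
        exact ⟨i + 1, by omega, h6⟩
      | true =>
        have h5 : ¬ ∃ i < k, lo n (E (i + 1)) = v.val + 1 := by
          simpa [τ] using hl
        -- If no gap jumps over `v + 1` and `v + 1` is not in the chain, then by induction all lower
        -- ends lie below `v + 1`, and the last gap ends at `v + 1` at the latest. But it ends at `n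
        -- + 1`.
        by_contra h6
        have h7 : ∀ i < k + 1, lo n (E i) < v.val + 1 → hi n (E i) ≤ v.val + 1 := by
          intro i hi h
          by_contra h'
          exact h6 ⟨i, hi, by simp only [if_true]; omega⟩
        have h8 : ∀ i < k + 1, lo n (E i) < v.val + 1 := by
          intro i
          induction i with
          | zero =>
            intro hi
            rw [(hlt 0 hi).2.1 rfl]
            omega
          | succ i ih =>
            intro hi
            have h9 := h7 i (by omega) (ih (by omega))
            rw [hsucc i (by omega)] at h9
            exact lt_of_le_of_ne h9 fun e => h5 ⟨i, by omega, e⟩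
        have h9 := h7 k (by omega) (h8 k (by omega))
        rw [(hlt k (by omega)).2.2 rfl] at h9
        have := v.isLt
        omega
    choose! idx hidx using h4
    obtain ⟨c, ⟨-, hg⟩, hc⟩ := h3
      -- The vector lists the indices of gaps witnessing that the literals of `C` are false; the
      -- unused positions are filled with index `0`.
      (fun j => if hj : j < C.length then idx C[j] else 0) (by
        intro j
        split_ifs with hj
        · exact (hidx _ (hfalse _ (List.getElem_mem hj))).1
        · omega)
    refine hg ⟨C, hC, fun l hl => ?_⟩
    obtain ⟨j, hj, rfl⟩ := List.mem_iff_getElem.1 hl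
    have hjq : j < q + 2 := by
      have := hq C hC
      omega
    have h10 := hc j hjq
    simp only [hj, dif_pos] at h10
    have h11 := (hidx _ (hfalse _ hl)).2
    rw [← h10] at h11
    unfold Falsifies
    split_ifs at h11 ⊢ with h12
    · exact ⟨j, hjq, h11⟩
    · exact ⟨j, hjq, h11⟩
  -- The true variables correspond to the lower ends of the gaps `1, …, k`, which are different by
  -- strict monotonicity.
  · have h4 : ∀ i < k, 0 < lo n (E (i + 1)) := fun i hi =>
      (Nat.zero_le _).trans_lt (hmono i (i + 1) (Nat.lt_succ_self i) (by omega))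
    have h5 : (Finset.univ.filter fun v => τ v = true) = Finset.univ.image fun i : Fin k =>
        (⟨lo n (E (i.val + 1)) - 1, by
          have := h4 i i.isLt
          have := hle (i + 1) (by omega)
          omega⟩ : Fin n) := by
      ext v
      simp only [Finset.mem_filter, Finset.mem_univ, true_and, Finset.mem_image, τ,
        decide_eq_true_eq, Fin.ext_iff]
      constructor
      · rintro ⟨i, hi, h⟩
        exact ⟨⟨i, hi⟩, by dsimp only; omega⟩
      · rintro ⟨i, h⟩
        have := h4 i i.isLt
        exact ⟨i, i.isLt, by omega⟩
    rw [CNFFormula.weight, h5, Finset.card_image_of_injective, Finset.card_univ, Fintype.card_fin]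
    intro i j hij
    have hi := h4 i i.isLt
    have hj := h4 j j.isLt
    simp only [Fin.mk.injEq] at hij
    ext
    by_contra hne
    rcases Nat.lt_or_gt_of_ne hne with h | h
    · have := hmono (i + 1) (j + 1) (by omega) (by omega)
      omega
    · have := hmono (j + 1) (i + 1) (by omega) (by omega)
      omega

/-- The numbers `0`, `n + 1` and `v + 1` for the true variables `v` are `k + 2` in number; listing
them in increasing order gives the chain. A true literal is never falsified: no gap jumps over a
member of the chain, and no gap starts at `v + 1` if `v` is false. -/
theorem exists_gaps {τ : Fin φ.numVars → Bool} (hτ : φ.SatisfiedBy τ)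
    (hw : CNFFormula.weight τ = k) :
    ∃ X : Finset ℕ, X.card ≤ k + 1 ∧ (∀ e ∈ X, e < elts φ.numVars k) ∧
      ∀ i < (k + 1) ^ (q + 2), ∃ c < (system q k φ).tuples, (system q k φ).good c ∧
        (system q k φ).con c = i ∧ ∀ j < q + 2, entry φ.numVars k j c ∈ X := by
  let T : Finset ℕ := (Finset.univ.filter fun v => τ v = true).image fun v => v.val + 1
  let S : Finset ℕ := insert 0 (insert (φ.numVars + 1) T)
  have hT : ∀ {x}, x ∈ T ↔ ∃ v, τ v = true ∧ v.val + 1 = x := by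
    intro x
    simp [T]
  have hS : S.card = k + 2 := by
    rw [Finset.card_insert_of_notMem, Finset.card_insert_of_notMem, Finset.card_image_of_injective]
    · exact congrArg (· + 2) hw
    · intro v w h
      exact Fin.ext (by simpa using h)
    · rw [hT]
      rintro ⟨v, -, h⟩
      have := v.isLt
      omega
    · rw [Finset.mem_insert, hT]
      rintro (h | ⟨v, -, h⟩) <;> omega
  let f : Fin (k + 2) ↪o ℕ := S.orderEmbOfFin hS
  have hfS : ∀ i, f i ∈ S := Finset.orderEmbOfFin_mem S hS
  have hSf : ∀ {x}, x ∈ S → ∃ i, f i = x := fun {x} hx => by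
    have : x ∈ Set.range f := by
      rw [Finset.range_orderEmbOfFin]
      exact hx
    exact this
  let a : ℕ → ℕ := fun i => if h : i < k + 2 then f ⟨i, h⟩ else 0
  have ha : ∀ {i} (h : i < k + 2), a i = f ⟨i, h⟩ := fun h => dif_pos h
  have hS_lt : ∀ {x}, x ∈ S → x ≤ φ.numVars + 1 := by
    intro x hx
    rw [Finset.mem_insert, Finset.mem_insert, hT] at hx
    rcases hx with rfl | rfl | ⟨v, -, rfl⟩
    · omega
    · omega
    · have := v.isLt
      omega
  have ha_lt : ∀ i, a i < φ.numVars + 2 := by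
    intro i
    by_cases h : i < k + 2
    · rw [ha h]
      have := hS_lt (hfS ⟨i, h⟩)
      omega
    · simp [a, h]
  have ha_mono : ∀ {i j}, i < j → j < k + 2 → a i < a j := by
    intro i j hij hj
    rw [ha (hij.trans hj), ha hj]
    exact f.strictMono (Fin.mk_lt_mk.2 hij)
  have ha_surj : ∀ {x}, x ∈ S → ∃ i < k + 2, a i = x := by
    intro x hx
    obtain ⟨i, hi⟩ := hSf hx
    exact ⟨i, i.isLt, by rw [ha i.isLt, ← hi]⟩
  have ha0 : a 0 = 0 := by
    obtain ⟨i, hi, h⟩ := ha_surj (show 0 ∈ S by simp [S])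
    rcases Nat.eq_zero_or_pos i with rfl | h'
    · exact h
    · have := ha_mono h' hi
      omega
  have hak : a (k + 1) = φ.numVars + 1 := by
    obtain ⟨i, hi, h⟩ := ha_surj (show φ.numVars + 1 ∈ S by simp [S])
    rcases Nat.lt_succ_iff_lt_or_eq.1 hi with h' | rfl
    · have := ha_mono h' (by omega)
      have := ha_lt (k + 1)
      omega
    · exact h
  have ha_gap : ∀ {i x}, i < k + 1 → x ∈ S → a i < x → ¬ x < a (i + 1) := by
    intro i x hi hx h1 h2
    obtain ⟨j, hj, rfl⟩ := ha_surj hx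
    rcases Nat.lt_or_ge i j with h | h
    · rcases Nat.eq_or_lt_of_le (show i + 1 ≤ j from h) with rfl | h
      · omega
      · have := ha_mono h hj
        omega
    · rcases Nat.eq_or_lt_of_le h with rfl | h
      · omega
      · have := ha_mono h (by omega)
        omega
  have ha_true : ∀ {i} {v : Fin φ.numVars}, i < k + 1 → a i = v.val + 1 → τ v = true := by
    intro i v hi h
    have h1 := hfS ⟨i, by omega⟩
    rw [← ha, h, Finset.mem_insert, Finset.mem_insert, hT] at h1
    rcases h1 with h1 | h1 | ⟨w, hw, h1⟩
    · omega
    · have := v.isLt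
      omega
    · rwa [show v = w from Fin.ext (by omega)]
  let g : ℕ → ℕ := fun i => gap φ.numVars i (a i) (a (i + 1))
  refine ⟨(Finset.range (k + 1)).image g, ?_, ?_, fun i hi => ?_⟩
  · exact Finset.card_image_le.trans (Finset.card_range _).le
  · intro e he
    obtain ⟨i, hi, rfl⟩ := Finset.mem_image.1 he
    exact gap_lt (Finset.mem_range.1 hi) (ha_lt _) (ha_lt _)
  -- The constraint `i` is a vector of indices in base `k + 1`; the tuple that meets it has the gaps
  -- with these indices as its digits in base `elts`.
  let I : ℕ → ℕ := fun j => i / (k + 1) ^ j % (k + 1)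
  have hI : ∀ j, I j < k + 1 := fun j => Nat.mod_lt _ (Nat.succ_pos k)
  have hgI : ∀ j, g (I j) < elts φ.numVars k := fun j => gap_lt (hI j) (ha_lt _) (ha_lt _)
  let c := ∑ j ∈ Finset.range (q + 2), g (I j) * elts φ.numVars k ^ j
  have hc : ∀ j < q + 2, entry φ.numVars k j c = g (I j) := fun j hj => Nat.sum_digits_div_mod hgI hj
  have hpos : ∀ j < q + 2, pos φ.numVars (entry φ.numVars k j c) = I j := fun j hj => by
    rw [hc j hj]
    exact pos_gap (ha_lt _) (ha_lt _)
  have hlo : ∀ j < q + 2, lo φ.numVars (entry φ.numVars k j c) = a (I j) := fun j hj => by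
    rw [hc j hj]
    exact lo_gap (ha_lt _) (ha_lt _)
  have hhi : ∀ j < q + 2,
      WeightedSat.hi φ.numVars (entry φ.numVars k j c) = a (I j + 1) := fun j hj => by
    rw [hc j hj]
    exact hi_gap (ha_lt _)
  refine ⟨c, Nat.sum_digits_lt _ hgI, ⟨⟨fun j hj => ?_, fun j hj j' hj' h => ?_⟩, ?_⟩, ?_,
    fun j hj => ?_⟩
  · rw [hpos j hj, hlo j hj, hhi j hj]
    refine ⟨ha_mono (Nat.lt_succ_self _) (by have := hI j; omega), fun h => ?_, fun h => ?_⟩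
    · rw [h, ha0]
    · rw [h, hak]
  · rw [hpos j hj, hpos j' hj'] at h
    rw [hlo j' hj', hhi j hj, h]
  · rintro ⟨C, hC, hCf⟩
    obtain ⟨⟨v, b⟩, hl, hlτ⟩ := hτ C hC
    have h1 := hCf _ hl
    dsimp only at hlτ h1
    unfold Falsifies at h1
    split_ifs at h1 with hb
    · obtain ⟨j, hj, h2, h3⟩ := h1
      rw [hlo j hj] at h2
      rw [hhi j hj] at h3
      refine ha_gap (hI j) ?_ h2 h3
      rw [Finset.mem_insert, Finset.mem_insert, hT]
      exact Or.inr (Or.inr ⟨v, hlτ.trans hb, rfl⟩)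
    · obtain ⟨j, hj, h2⟩ := h1
      rw [hlo j hj] at h2
      exact hb (hlτ ▸ ha_true (hI j) h2)
  · change ∑ j ∈ Finset.range (q + 2), pos φ.numVars (entry φ.numVars k j c) * (k + 1) ^ j = i
    rw [Finset.sum_congr rfl fun j hj => by rw [hpos j (Finset.mem_range.1 hj)]]
    exact Nat.sum_div_mod_mul_pow hi
  · rw [hc j hj]
    exact Finset.mem_image_of_mem _ (Finset.mem_range.2 (hI j))

/-- The bound on the length of a plan. -/
def budget (q k : ℕ) : ℕ := (k + 1) + (k + 1) ^ (q + 2) * (2 * (q + 2) + 1)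

theorem exists_plan_iff (hq : ∀ C ∈ φ.clauses, C.length ≤ q) :
    (∃ τ, φ.SatisfiedBy τ ∧ CNFFormula.weight τ = k) ↔
      ∃ ω, (system q k φ).instance_.IsPlan ω ∧ ω.length ≤ budget q k := by
  constructor
  · rintro ⟨τ, hτ, hw⟩
    obtain ⟨X, h1, h2, h3⟩ := exists_gaps (q := q) hτ hw
    obtain ⟨ω, h4, h5⟩ := TupleSystem.exists_plan (G := system q k φ) h2 h3
    exact ⟨ω, h4, h5.trans (Nat.add_le_add_right h1 _)⟩
  · rintro ⟨ω, h1, h2⟩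
    obtain ⟨X, h3, h4⟩ := TupleSystem.exists_elements h1
    refine exists_assignment hq (X := X) ?_ h4
    exact Nat.le_of_add_le_add_right (h3.trans h2)

end WeightedSat

/-! ### Codes of planning instances -/

/-- Programs loop over natural numbers, so codes of vectors indexed by `Fin n` are brought into the
form required by `PolyOut.flatMap_range`. -/
theorem encVec_eq_flatMap {n : ℕ} {α : Type} {e : α → List Bool} {f : Fin n → α}
    {g : ℕ → List Bool} (h : ∀ u, e (f u) = g u.val) :
    encVec e f = (List.range n).flatMap g := by
  induction n generalizing g with
  | zero => rfl
  | succ n ih =>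
    have h1 : encVec e f = e (f 0) ++ encVec e fun i => f i.succ := by
      simp [encVec, List.ofFn_succ]
    rw [h1, ih (g := fun i => g (i + 1)) fun u => by rw [h, Fin.val_succ], List.range_succ_eq_map,
      List.flatMap_cons, List.flatMap_map, h]
    rfl

theorem encList_eq_flatMap {α : Type} (e : α → List Bool) (l : List α) :
    encList e l = (l.flatMap fun a => true :: e a) ++ [false] := by
  induction l with
  | nil => rfl
  | cons a l ih => simp [encList, ih]

namespace PolyOut

variable {α : Type} [Ctx α]

theorem encNat {f : α → ℕ} (hf : PolyTime f) : PolyOut fun a => encNat (f a) :=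
  ((replicate hf [true]).append (const [false])).of_eq fun a => by
    simp [_root_.encNat]

theorem flatMap_range_const {g : ℕ → α → List Bool} (h : ∀ l, PolyOut (g l)) (m : ℕ) :
    PolyOut fun a => (List.range m).flatMap fun l => g l a := by
  induction m with
  | zero => exact nil
  | succ m ih => exact (ih.append (h m)).of_eq fun a => by simp [List.range_succ]

end PolyOut

namespace TupleSystem

/-- The code of an action, with a mark in front. -/
def moveCode (N : ℕ) (m : ℕ × ℕ × Bool) : List Bool :=
  true :: (((List.range N).flatMap fun u => if u = m.1 then [true, true, false] else [false]) ++
    (List.range N).flatMap fun u =>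
      if u = m.2.1 then if m.2.2 then [true, true, false] else [true, false] else [false])

/-- `[true, true, false]`, `[true, false]` and `[false]` are the codes of `some 1`, `some 0` and
`none`; the leading `true` announces an entry of the list of actions. -/
theorem enc_act (N : ℕ) (m : ℕ × ℕ × Bool) : true :: (act N m).enc = moveCode N m := by
  rw [SASAction.enc, moveCode, encVec_eq_flatMap, encVec_eq_flatMap]
  · intro u
    by_cases h : u.val = m.2.1
    · cases hb : m.2.2 <;>
        simp [act, h, hb, val, encOption, encFin, encNat]
    · simp [act, h, encOption]
  · intro u
    by_cases h : u.val = m.1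
    · simp [act, h, encOption, encFin, encNat]
    · simp [act, h, encOption]

theorem enc_instance (G : TupleSystem) : G.instance_.enc =
    encNat G.numVars ++ (encNat 2 ++ (((List.range G.numVars).flatMap fun _ => [false]) ++
      (((List.range G.numVars).flatMap fun u => if u < G.elts then [false] else
        if u < G.elts + (G.len + 1) * G.tuples then [true, false] else [true, true, false]) ++
      ((G.moves.flatMap fun m => moveCode G.numVars m) ++ [false])))) := by
  have h1 : encVec encFin G.instance_.init = (List.range G.numVars).flatMap fun _ => [false] :=
    encVec_eq_flatMap fun _ => rfl
  have h2 : encVec (encOption encFin) G.instance_.goal = (List.range G.numVars).flatMap fun u =>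
      if u < G.elts then [false] else
        if u < G.elts + (G.len + 1) * G.tuples then [true, false] else [true, true, false] := by
    refine encVec_eq_flatMap fun u => ?_
    change encOption encFin (if u.val < G.elts then none else
      if u.val < G.elts + (G.len + 1) * G.tuples then some (0 : Fin 2) else some 1) = _
    split_ifs <;> rfl
  have h3 : encList SASAction.enc G.instance_.acts =
      (G.moves.flatMap fun m => moveCode G.numVars m) ++ [false] := by
    change encList SASAction.enc G.acts = _
    rw [encList_eq_flatMap, acts, List.flatMap_map]
    simp only [enc_act]
  rw [SASInstance.enc, h1, h2, h3]
  rfl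

open Classical in
theorem flatMap_moves (G : TupleSystem) (f : ℕ × ℕ × Bool → List Bool) : G.moves.flatMap f =
    ((List.range G.elts).flatMap fun e => f (G.numVars, e, true)) ++
    (List.range G.tuples).flatMap fun c =>
      (if G.good c then f (G.numVars, G.tupleVar 0 c, true) else []) ++
      (((List.range G.len).flatMap fun j => f (G.tupleVar j c, G.tupleVar (j + 1) c, true)) ++
      (((List.range (G.len + 1)).flatMap fun j => f (G.elt j c, G.tupleVar j c, false)) ++
      f (G.tupleVar G.len c, G.conVar (G.con c), true))) := by
  simp only [moves, List.flatMap_append, List.flatMap_map, List.flatMap_assoc]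
  congr 2
  funext c
  congr 1
  · split_ifs <;> simp
  · simp

variable {α : Type} [Ctx α]

theorem polyOut_moveCode {N p w : α → ℕ} (hN : PolyTime N) (hp : PolyTime p) (hw : PolyTime w)
    (b : Bool) : PolyOut fun a => moveCode (N a) (p a, w a, b) := by
  classical
  have h1 : PolyOut fun a => (List.range (N a)).flatMap fun u =>
      if u = p a then [true, true, false] else [false] :=
    (PolyOut.flatMap_range (g := fun x : α × ℕ => if x.2 = p x.1 then [true, true, false] else
      [false]) hN ((PolyOut.ite (.eq .snd hp.fst) (.const _) (.const _)).of_eq fun a => by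
        congr)).of_eq fun a => rfl
  have h2 : PolyOut fun a => (List.range (N a)).flatMap fun u =>
      if u = w a then if b then [true, true, false] else [true, false] else [false] :=
    (PolyOut.flatMap_range (g := fun x : α × ℕ => if x.2 = w x.1 then
      if b then [true, true, false] else [true, false] else [false]) hN
      ((PolyOut.ite (.eq .snd hw.fst) (.const _) (.const _)).of_eq fun a => by congr)).of_eq
      fun a => rfl
  exact (PolyOut.const [true]).append (h1.append h2)

/-- The planning instances of a family of tuple systems can be computed in polynomial time. -/
theorem polyOut_enc {G : α → TupleSystem} {r : ℕ} (hr : ∀ a, (G a).len = r)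
    (helts : PolyTime fun a => (G a).elts) (htup : PolyTime fun a => (G a).tuples)
    (hcons : PolyTime fun a => (G a).cons)
    (helt : ∀ j, PolyTime fun p : α × ℕ => (G p.1).elt j p.2)
    (hcon : PolyTime fun p : α × ℕ => (G p.1).con p.2)
    (hgood : PolyPred fun p : α × ℕ => (G p.1).good p.2) :
    PolyOut fun a => (G a).instance_.enc := by
  classical
  have htv : PolyTime fun a => (G a).elts + ((r + 1) * (G a).tuples) :=
    helts.add ((PolyTime.const (r + 1)).mul htup)
  have hN : PolyTime fun a => (G a).numVars :=
    (helts.add (((PolyTime.const (r + 1)).mul htup).add hcons)).of_eq fun a => by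
      rw [numVars, hr]
  have hT : ∀ j, PolyTime fun p : α × ℕ => (G p.1).tupleVar j p.2 := fun j =>
    helts.fst.add (((PolyTime.const j).mul htup.fst).add .snd)
  have hC : PolyTime fun p : α × ℕ => (G p.1).conVar ((G p.1).con p.2) :=
    (helts.fst.add (((PolyTime.const (r + 1)).mul htup.fst).add hcon)).of_eq fun p => by
      rw [conVar, hr]
  have hM : PolyOut fun a => (G a).moves.flatMap fun m => moveCode (G a).numVars m := by
    have h1 : PolyOut fun a => (List.range (G a).elts).flatMap fun e =>
        moveCode (G a).numVars ((G a).numVars, e, true) :=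
      PolyOut.flatMap_range (g := fun p : α × ℕ =>
        moveCode (G p.1).numVars ((G p.1).numVars, p.2, true)) helts
        (polyOut_moveCode hN.fst hN.fst .snd true)
    have h2 := PolyOut.ite hgood (polyOut_moveCode hN.fst hN.fst (hT 0) true) .nil
    -- The length `r` of the rows does not depend on the input, so these lists are unrolled. This is
    -- why `elt j` need only be computable for each fixed `j`.
    have h3 := PolyOut.flatMap_range_const
      (fun j => polyOut_moveCode hN.fst (hT j) (hT (j + 1)) true) r
    have h4 := PolyOut.flatMap_range_const
      (fun j => polyOut_moveCode hN.fst (helt j) (hT j) false) (r + 1)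
    have h5 := polyOut_moveCode hN.fst (hT r) hC true
    have h6 := h1.append (PolyOut.flatMap_range htup (h2.append (h3.append (h4.append h5))))
    refine h6.of_eq fun a => ?_
    rw [flatMap_moves, hr]
  have hgoal : PolyOut fun a => (List.range (G a).numVars).flatMap fun u =>
      if u < (G a).elts then [false] else
        if u < (G a).elts + ((G a).len + 1) * (G a).tuples then [true, false] else
          [true, true, false] :=
    (PolyOut.flatMap_range hN (PolyOut.ite (.lt .snd helts.fst) (.const [false])
      (PolyOut.ite (.lt .snd htv.fst) (.const [true, false])
        (.const [true, true, false])))).of_eq fun a => by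
      rw [hr]
      congr 1
      funext u
      congr
  exact ((PolyOut.encNat hN).append ((PolyOut.const (encNat 2)).append
    ((PolyOut.flatMap_range hN (PolyOut.const [false])).append (hgoal.append
      (hM.append (.const [false])))))).of_eq fun a => (enc_instance (G a)).symm

end TupleSystem

/-! ### The reduction in polynomial time -/

namespace WeightedSat

section

variable {α : Type} [Ctx α] {n k : α → ℕ}

theorem polyTime_elts (hn : PolyTime n) (hk : PolyTime k) : PolyTime fun a => elts (n a) (k a) :=
  hk.succ.mul ((hn.add (.const 2)).pow_const 2)

theorem polyTime_entry (hn : PolyTime n) (hk : PolyTime k) (j : ℕ) :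
    PolyTime fun p : α × ℕ => entry (n p.1) (k p.1) j p.2 :=
  have hM := (polyTime_elts hn hk).fst
  (PolyTime.snd.div (hM.pow_const j) fun _ => pow_pos (elts_pos _ _) _).mod hM
    fun _ => elts_pos _ _

theorem polyTime_pos (hn : PolyTime n) (hk : PolyTime k) :
    PolyTime fun a => pos (n a) (k a) :=
  hk.div ((hn.add (.const 2)).pow_const 2) fun _ => by positivity

theorem polyTime_lo (hn : PolyTime n) (hk : PolyTime k) : PolyTime fun a => lo (n a) (k a) :=
  (hk.div (hn.add (.const 2)) fun _ => by positivity).mod (hn.add (.const 2)) fun _ => by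
    positivity

theorem polyTime_hi (hn : PolyTime n) (hk : PolyTime k) : PolyTime fun a => hi (n a) (k a) :=
  hk.mod (hn.add (.const 2)) fun _ => by positivity

theorem polyTime_con (hn : PolyTime n) (hk : PolyTime k) (r : ℕ) :
    PolyTime fun p : α × ℕ => con (n p.1) (k p.1) r p.2 :=
  PolyTime.sum_range_const (fun j => (polyTime_pos hn.fst (polyTime_entry hn hk j)).mul
    (hk.fst.succ.pow_const j)) r

theorem polyPred_consistent (hn : PolyTime n) (hk : PolyTime k) (r : ℕ) :
    PolyPred fun p : α × ℕ => Consistent (n p.1) (k p.1) r p.2 := by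
  have hp := fun j => polyTime_pos hn.fst (polyTime_entry hn hk j)
  have hl := fun j => polyTime_lo hn.fst (polyTime_entry hn hk j)
  have hh := fun j => polyTime_hi hn.fst (polyTime_entry hn hk j)
  exact (PolyPred.forall_lt_const (fun j => (PolyPred.lt (hl j) (hh j)).and
    ((PolyPred.imp (.eq (hp j) (.const 0)) (.eq (hl j) (.const 0))).and
      (PolyPred.imp (.eq (hp j) hk.fst) (.eq (hh j) hn.fst.succ)))) r).and
    (PolyPred.forall_lt_const (fun j => PolyPred.forall_lt_const
      (fun j' => PolyPred.imp (.eq (hp j') (hp j).succ) (.eq (hh j) (hl j'))) r) r)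

theorem polyLit_falsifies (hn : PolyTime n) (hk : PolyTime k) (r : ℕ) :
    PolyLit fun p : α × ℕ => Falsifies (n p.1) (k p.1) r p.2 := by
  intro b
  have hl := fun j => (polyTime_lo hn.fst (polyTime_entry hn hk j)).fst
  have hh := fun j => (polyTime_hi hn.fst (polyTime_entry hn hk j)).fst
  have hv : PolyTime fun p : (α × ℕ) × ℕ => p.2 + 1 := PolyTime.snd.succ
  cases b with
  | false => exact PolyPred.exists_lt_const (fun j => PolyPred.eq (hl j) hv) r
  | true => exact PolyPred.exists_lt_const (fun j => (PolyPred.lt (hl j) hv).and (.lt hv (hh j))) r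

end

/-- The number of variables of the formula with code `x`. -/
noncomputable def inputNumVars (x : List Bool) : ℕ := (Scan.final (fun _ _ => False) x).numVars

/-- The parameter of the instance with code `x`. -/
noncomputable def inputWeight (x : List Bool) : ℕ := (Scan.final (fun _ _ => False) x).weight

/-- The tuple system of the instance with code `x`. -/
noncomputable def inputSystem (q : ℕ) (x : List Bool) : TupleSystem :=
  tupleSystem q (inputNumVars x) (inputWeight x) fun c =>
    (Scan.final (Falsifies (inputNumVars x) (inputWeight x) (q + 2) c) x).found = 1

theorem polyTime_inputNumVars : PolyTime inputNumVars :=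
  Scan.polyTime_numVars (D := fun _ : List Bool => fun _ _ => False) .length

theorem polyTime_inputWeight : PolyTime inputWeight :=
  Scan.polyTime_weight (D := fun _ : List Bool => fun _ _ => False) .length

theorem inputNumVars_code (k : ℕ) (φ : CNFFormula) : inputNumVars (encNat k ++ φ.enc) = φ.numVars :=
  (Scan.final_code φ k _).2.2

theorem inputWeight_code (k : ℕ) (φ : CNFFormula) : inputWeight (encNat k ++ φ.enc) = k :=
  (Scan.final_code φ k _).2.1

/-- The program is specified on all bit strings, so the system has to be a total function of the
string; only its values on codes of instances matter. -/
theorem inputSystem_code (q k : ℕ) (φ : CNFFormula) :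
    inputSystem q (encNat k ++ φ.enc) = system q k φ := by
  rw [inputSystem, inputNumVars_code, inputWeight_code, system]
  congr 1
  funext c
  rw [(Scan.final_code φ k _).1]
  simp

/-- The code of the planning instance as a function of the code of the given instance. -/
noncomputable def outputCode (q : ℕ) (x : List Bool) : List Bool :=
  encNat (budget q (inputWeight x)) ++ (inputSystem q x).instance_.enc

theorem outputCode_code (q k : ℕ) (φ : CNFFormula) : outputCode q (encNat k ++ φ.enc) =
    encNat (budget q k) ++ (system q k φ).instance_.enc := by
  rw [outputCode, inputWeight_code, inputSystem_code]

theorem polyOut_outputCode (q : ℕ) : PolyOut (outputCode q) := by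
  have hn := polyTime_inputNumVars
  have hk := polyTime_inputWeight
  refine (PolyOut.encNat (hk.succ.add ((hk.succ.pow_const _).mul (.const _)))).append
    (TupleSystem.polyOut_enc (r := q + 1) (fun _ => rfl) (polyTime_elts hn hk)
      ((polyTime_elts hn hk).pow_const _) (hk.succ.pow_const _) (polyTime_entry hn hk)
      (polyTime_con hn hk _) ((polyPred_consistent hn hk _).and ?_))
  refine PolyPred.not (PolyPred.eq ?_ (.const 1))
  exact Scan.polyTime_found (polyLit_falsifies hn hk (q + 2)) PolyTime.length

theorem budget_pos (q k : ℕ) : 0 < budget q k := by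
  unfold budget
  omega

theorem budget_mono (q : ℕ) : Monotone (budget q) := fun a b h => by
  unfold budget
  gcongr

theorem computable_budget (q : ℕ) : Computable (budget q) :=
  have h : Computable fun k : ℕ => k + 1 := Computable.succ
  h.nat_add_fun ((h.nat_pow_const _).nat_mul_fun (Computable.const _))

/-- The reduction itself does not depend on `R`, so one construction serves both restrictions in the
theorem. -/
theorem isW1Hard_boundedSASPlanning {R : SASInstance → Prop}
    (hR : ∀ G : TupleSystem, R G.instance_) : IsW1Hard (boundedSASPlanning R) := by
  rintro L ⟨q, h⟩
  exact h.trans_polyOut (L'' := boundedSASPlanning R)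
    (fun x => ⟨((system q x.1.2 x.1.1).instance_, budget q x.1.2), hR _, budget_pos _ _⟩)
    (fun x => exists_plan_iff x.2) (computable_budget q) (budget_mono q) (fun x => le_rfl)
    (polyOut_outputCode q) fun x => (outputCode_code q x.1.2 x.1.1).symm

end WeightedSat

theorem mainTheorem4 :
    IsW1Hard (boundedSASPlanning fun P =>
      P.RestrictionU ∧ P.RestrictionB ∧ P.RestrictionS) ∧
    IsW1Hard (boundedSASPlanning fun P =>
      (P.RestrictionU ∧ P.RestrictionB ∧ P.RestrictionS) ∧
        ∀ a ∈ P.acts, a.numPre ≤ 1 ∧ a.numEff ≤ 1) := by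
  have h := fun G : TupleSystem => And.intro G.restrictionU (And.intro G.restrictionB G.restrictionS)
  exact ⟨WeightedSat.isW1Hard_boundedSASPlanning h, WeightedSat.isW1Hard_boundedSASPlanning
    fun G => ⟨h G, fun a ha => ⟨G.numPre_le_one ha, G.numEff_le_one ha⟩⟩⟩
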